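/- **Setting.** Let $\mathcal H_A=\mathbb C^{D_A}$, $\mathcal H_B=\mathbb C^{D_B}$, $D=D_AD_B$, let $\{|E_j\rangle\}_{j=1}^{D}$ be an orthonormal basis of $\mathcal H_A\otimes\mathcal H_B$ (the energy eigenbasis of a Hamiltonian), $|\Psi_0\rangle$ a unit vector of $\mathcal H_A\otimes\mathcal H_B$, and $\{|z\rangle\}_{z=1}^{D_B}$ an arbitrary orthonormal basis of $\mathcal H_B$. The generator state is drawn from the random phase ensemble $$|\Psi\rangle=\sum_{j=1}^{D}|\langle E_j|\Psi_0\rangle|\,e^{i\varphi_j}|E_j\rangle,\qquad \varphi_1,\dots,\varphi_D \text{ independent and uniform on } [0,2\pi).$$ Put $\sigma=\sum_j|\langle E_j|\Psi_0\rangle|^2|E_j\rangle\langle E_j|$, $\sigma_B=\mathrm{Tr}_A\,\sigma$, $\sigma_{A|z}=(I_A\otimes\langle z|)\,\sigma\,(I_A\otimes|z\rangle)$, $\hat\sigma_{A|z}=\sigma_{A|z}/\langle z|\sigma_B|z\rangle$, and $$\Delta_\beta=\sum_{z=1}^{D_B}\frac{\langle z^{\otimes2}|\,\mathrm{Tr}_A\big(\sigma^{(2)}\big)\,|z^{\otimes2}\rangle}{\langle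 z|\sigma_B|z\rangle},\qquad \sigma^{(2)}=\sum_j|\langle E_j|\Psi_0\rangle|^4\,|E_j^{\otimes2}\rangle\langle E_j^{\otimes2}| ,$$ where $\mathrm{Tr}_A$ in $\Delta_\beta$ traces out both copies of $A$ (outcomes $z$ with $\langle z|\sigma_B|z\rangle=0$ are left out of all sums). With $|\tilde\psi_z\rangle=(I_A\otimes\langle z|)|\Psi\rangle$, $p_z=\langle\tilde\psi_z|\tilde\psi_z\rangle$ and $|\psi_z\rangle=|\tilde\psi_z\rangle/\sqrt{p_z}$, the $k$-th moment of the normalized projected ensemble is $\rho_{\mathcal E}^{(k)}(\Psi)=\sum_z p_z(|\psi_z\rangle\langle\psi_z|)^{\otimes k}$. For a density matrix $\tau$ on $\mathbb C^{d}$, $\rho^{(k)}_{\rm Scrooge}(\tau)$ is the $k$-th moment of the Scrooge ensemble of $\tau$, that is, of the states $\sqrt\tau|\phi\rangle/\|\sqrt\tau|\phi\rangle\|$ with weight $d\,\langle\phi|\tau|\phi\rangle\,\mathrm d\phi$, where $\mathrm d\phi$ is the uniform probability measure on the unit sphere of $\mathbb C^{d}$. $\|\cdot\|_p$ is the Schatten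 $p$-norm. **Proposition 1.** There are absolute constants $c,C>0$ and, for every $D_A$, a constant $C'_{D_A}>0$ depending only on $D_A$, such that for all $D_B$, all $k\ge1$ and all $\{|E_j\rangle\}$, $|\Psi_0\rangle$, $\{|z\rangle\}$ as above: if $k^2\|\hat\sigma_{A|z}\|_2\le c$ for all $z$ (with $\langle z|\sigma_B|z\rangle>0$), then $$\mathbb E_\Psi\Big\|\rho_{\mathcal E}^{(k)}(\Psi)-\sum_{z=1}^{D_B}\langle z|\sigma_B|z\rangle\,\rho^{(k)}_{\rm Scrooge}(\hat\sigma_{A|z})\Big\|_1\;\le\;\sum_{z=1}^{D_B}\langle z|\sigma_B|z\rangle\;C\,k\,\|\hat\sigma_{A|z}\|_2\;+\;C'_{D_A}\,\Delta_\beta^{1/2}.$$ -/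

import Mathlib

open MeasureTheory
open scoped BigOperators

noncomputable section

/-- State vectors of a quantum system with (finite) label set `n`. -/
abbrev Ket (n : Type) [Fintype n] : Type := EuclideanSpace ℂ n

/-- The rank-one operator `|ψ⟩⟨ψ|` as a matrix. -/
def ketbra {n : Type} [Fintype n] (ψ : Ket n) : Matrix n n ℂ :=
  Matrix.of fun i j => ψ i * star (ψ j)

/-- The matrix element `⟨v|M|v⟩`. -/
def sandwich {n : Type} [Fintype n] (M : Matrix n n ℂ) (v : Ket n) : ℂ :=
  ∑ i, ∑ j, star (v i) * M i j * v j

/-- The `k`-fold tensor power `M^{⊗k}`, acting on `(ℂⁿ)^{⊗k}` whose standard basis is indexed by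
`Fin k → n`. -/
def tensorPow {n : Type} (k : ℕ) (M : Matrix n n ℂ) : Matrix (Fin k → n) (Fin k → n) ℂ :=
  Matrix.of fun i j => ∏ l, M (i l) (j l)

/-- The Schatten 1-norm: the sum of the singular values, i.e. of the square roots of the
eigenvalues of `M† M`. -/
def traceNorm {n : Type} [Fintype n] [DecidableEq n] (M : Matrix n n ℂ) : ℝ :=
  ∑ i, √((Matrix.isHermitian_conjTranspose_mul_self M).eigenvalues i)

/-- The Schatten 2-norm `(Tr M† M)^{1/2}`. -/
def hsNorm {n : Type} [Fintype n] (M : Matrix n n ℂ) : ℝ :=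
  √((M.conjTranspose * M).trace.re)

/-! ### Ensembles of pure states -/

/-- The `k`-th moment `E_{ψ ∼ μ} (|ψ⟩⟨ψ|)^{⊗k}` of an ensemble of states, given by its
distribution `μ` (entrywise integral). -/
def stateMoment {n : Type} [Fintype n] (k : ℕ) (μ : Measure (Ket n)) :
    Matrix (Fin k → n) (Fin k → n) ℂ :=
  Matrix.of fun i j => ∫ ψ, tensorPow k (ketbra ψ) i j ∂μ

/-- The Haar (uniform) probability measure on the unit sphere of `ℂᵈ`: normalized surface
measure. -/
def haarSphere (d : ℕ) : Measure (Metric.sphere (0 : Ket (Fin d)) 1) :=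
  ProbabilityTheory.cond (volume : Measure (Ket (Fin d))).toSphere Set.univ

open scoped MatrixOrder ComplexOrder in
/-- The vector `√σ |φ⟩`, for a positive semidefinite matrix `σ`. -/
def sqrtApply {d : ℕ} (σ : Matrix (Fin d) (Fin d) ℂ) (φ : Ket (Fin d)) : Ket (Fin d) :=
  WithLp.toLp 2 ((CFC.sqrt σ).mulVec φ.ofLp)

/-- The Scrooge ensemble of a density matrix `σ` on `ℂᵈ`: the states `√σ|φ⟩ / ‖√σ|φ⟩‖` with
weight `d ⟨φ|σ|φ⟩ dφ`, where `dφ` is the Haar measure on the unit sphere. -/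
def scroogeEnsemble {d : ℕ} (σ : Matrix (Fin d) (Fin d) ℂ) : Measure (Ket (Fin d)) :=
  ((haarSphere d).withDensity fun φ : Metric.sphere (0 : Ket (Fin d)) 1 =>
      ENNReal.ofReal (d * (sandwich σ φ.1).re)).map
    fun φ : Metric.sphere (0 : Ket (Fin d)) 1 =>
      ((‖sqrtApply σ φ.1‖⁻¹ : ℝ) : ℂ) • sqrtApply σ φ.1

/-- The `k`-th moment `ρ_Scrooge^{(k)}(σ)` of the Scrooge ensemble. -/
def scroogeMoment {d : ℕ} (k : ℕ) (σ : Matrix (Fin d) (Fin d) ℂ) :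
    Matrix (Fin k → Fin d) (Fin k → Fin d) ℂ :=
  stateMoment k (scroogeEnsemble σ)

/-! ### The random phase ensemble and the diagonal ensemble -/

/-- The product measure of the uniform distributions on `[0, 2π)`: `d^D φ / (2π)^D` on the
torus `[0, 2π)^D`. -/
def phaseMeasure (D : ℕ) : Measure (Fin D → ℝ) :=
  Measure.pi fun _ => ProbabilityTheory.cond volume (Set.Ico 0 (2 * Real.pi))

/-- The state `∑ⱼ |⟨Eⱼ|Ψ₀⟩| e^{i φⱼ} |Eⱼ⟩`. -/
def phaseState {n : Type} [Fintype n] {D : ℕ} (E : OrthonormalBasis (Fin D) ℂ (Ket n))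
    (Ψ₀ : Ket n) (φ : Fin D → ℝ) : Ket n :=
  ∑ j, ((‖inner ℂ (E j) Ψ₀‖ : ℂ) * Complex.exp (Complex.I * φ j)) • E j

/-- The random phase ensemble of `Ψ₀` with respect to the orthonormal basis `E`. -/
def randomPhaseEnsemble {n : Type} [Fintype n] {D : ℕ}
    (E : OrthonormalBasis (Fin D) ℂ (Ket n)) (Ψ₀ : Ket n) : Measure (Ket n) :=
  (phaseMeasure D).map (phaseState E Ψ₀)

/-- The diagonal ensemble `σ_diag = ∑ⱼ |⟨Eⱼ|Ψ₀⟩|² |Eⱼ⟩⟨Eⱼ|`. -/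
def sigmaDiag {n : Type} [Fintype n] {D : ℕ} (E : OrthonormalBasis (Fin D) ℂ (Ket n))
    (Ψ₀ : Ket n) : Matrix n n ℂ :=
  ∑ j, ((‖inner ℂ (E j) Ψ₀‖ : ℂ) ^ 2) • ketbra (E j)

/-- `ψ ⊗ ψ`, a vector on two copies of the system. -/
def doubleKet {n : Type} [Fintype n] (ψ : Ket n) : Ket (n × n) :=
  WithLp.toLp 2 fun x => ψ x.1 * ψ x.2

/-- The operator `σ_diag^{(2)} = ∑ⱼ |⟨Eⱼ|Ψ₀⟩|⁴ |Eⱼ ⊗ Eⱼ⟩⟨Eⱼ ⊗ Eⱼ|` on two copies. -/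
def sigmaDiagTwo {n : Type} [Fintype n] {D : ℕ} (E : OrthonormalBasis (Fin D) ℂ (Ket n))
    (Ψ₀ : Ket n) : Matrix (n × n) (n × n) ℂ :=
  ∑ j, ((‖inner ℂ (E j) Ψ₀‖ : ℂ) ^ 4) • ketbra (doubleKet (E j))

/-! ### Bipartite systems and the projected ensemble -/

/-- The partial trace over `A`. -/
def traceA {a b : Type} [Fintype a] (M : Matrix (a × b) (a × b) ℂ) : Matrix b b ℂ :=
  Matrix.of fun y y' => ∑ x, M (x, y) (x, y')

/-- The partial trace over both copies of `A`, for an operator on two copies of `AB`. -/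
def traceATwo {a b : Type} [Fintype a]
    (M : Matrix ((a × b) × (a × b)) ((a × b) × (a × b)) ℂ) : Matrix (b × b) (b × b) ℂ :=
  Matrix.of fun y y' => ∑ x₁, ∑ x₂, M ((x₁, y.1), (x₂, y.2)) ((x₁, y'.1), (x₂, y'.2))

/-- The weight `⟨z|σ_B|z⟩`, where `σ_B = Tr_A σ`. -/
def weightB {a b : Type} [Fintype a] [Fintype b] (σ : Matrix (a × b) (a × b) ℂ) (z : Ket b) : ℝ :=
  (sandwich (traceA σ) z).re

/-- The unnormalized conditional operator `σ_{A|z} = (I_A ⊗ ⟨z|) σ (I_A ⊗ |z⟩)`. -/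
def condA {a b : Type} [Fintype b] (σ : Matrix (a × b) (a × b) ℂ) (z : Ket b) : Matrix a a ℂ :=
  Matrix.of fun x x' => ∑ y, ∑ y', star (z y) * σ (x, y) (x', y') * z y'

/-- The normalized conditional state `σ̂_{A|z} = σ_{A|z} / ⟨z|σ_B|z⟩`
(zero if `⟨z|σ_B|z⟩ = 0`). -/
def condAHat {a b : Type} [Fintype a] [Fintype b] (σ : Matrix (a × b) (a × b) ℂ) (z : Ket b) :
    Matrix a a ℂ :=
  (((weightB σ z)⁻¹ : ℝ) : ℂ) • condA σ z

/-- The unnormalized post-measurement state `(I_A ⊗ ⟨z|)|Ψ⟩`. -/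
def projKet {a b : Type} [Fintype a] [Fintype b] (Ψ : Ket (a × b)) (z : Ket b) : Ket a :=
  WithLp.toLp 2 fun x => ∑ y, star (z y) * Ψ (x, y)

/-- The `k`-th moment `∑_z p_z (|ψ_z⟩⟨ψ_z|)^{⊗k}` of the normalized projected ensemble, with Born
probabilities `p_z = ‖(I_A ⊗ ⟨z|)|Ψ⟩‖²` and `|ψ_z⟩ = (I_A ⊗ ⟨z|)|Ψ⟩ / √p_z`
(outcomes with `p_z = 0` do not contribute). -/
def projectedMoment {a b ι : Type} [Fintype a] [Fintype b] [Fintype ι] (k : ℕ)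
    (z : ι → Ket b) (Ψ : Ket (a × b)) : Matrix (Fin k → a) (Fin k → a) ℂ :=
  ∑ s, ((‖projKet Ψ (z s)‖ ^ 2 : ℝ) : ℂ) •
    tensorPow k (ketbra (((‖projKet Ψ (z s)‖⁻¹ : ℝ) : ℂ) • projKet Ψ (z s)))

/-- The generalized Scrooge mixture `∑_z ⟨z|σ_B|z⟩ ρ_Scrooge^{(k)}(σ̂_{A|z})`. -/
def scroogeMixture {dA : ℕ} {b ι : Type} [Fintype b] [Fintype ι] (k : ℕ)
    (σ : Matrix (Fin dA × b) (Fin dA × b) ℂ) (z : ι → Ket b) :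
    Matrix (Fin k → Fin dA) (Fin k → Fin dA) ℂ :=
  ∑ s, (weightB σ (z s) : ℂ) • scroogeMoment k (condAHat σ (z s))

/-- `Δ_β = ∑_z ⟨z ⊗ z| Tr_A σ_diag^{(2)} |z ⊗ z⟩ / ⟨z|σ_B|z⟩`, where the terms with
`⟨z|σ_B|z⟩ = 0` (whose numerator also vanishes) count as zero. -/
def deltaBeta {a b ι : Type} [Fintype a] [Fintype b] [Fintype ι] {D : ℕ}
    (E : OrthonormalBasis (Fin D) ℂ (Ket (a × b))) (Ψ₀ : Ket (a × b)) (z : ι → Ket b) : ℝ :=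
  ∑ s, (sandwich (traceATwo (sigmaDiagTwo E Ψ₀)) (doubleKet (z s))).re /
    weightB (sigmaDiag E Ψ₀) (z s)

end

/-!
Write `cⱼ = |⟨Eⱼ|Ψ₀⟩|` and `v_{sj} = (I ⊗ ⟨z_s|) |Eⱼ⟩`. An entry of the `k`-th moment of the
projected ensemble is `∑ₛ f (∑ⱼ cⱼ e^{iφⱼ} v_{sj})`, where `f` is the corresponding entry of
`‖x‖² (|x⟩⟨x| / ‖x‖²)^{⊗k}` (`homEntry`), a function that is homogeneous of degree two. A Scrooge
moment is a Gaussian expectation of the same function: `⟨z|σ_B|z⟩ ρ_Scrooge(σ̂_{A|z})` has the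
entries `E f (∑ⱼ cⱼ ζⱼ v_{sj})` with independent standard complex Gaussian variables `ζⱼ`, because a
homogeneous function has proportional averages over a Gaussian vector and over the sphere
(`scroogeMoment_eq`, `weightB_mul_scroogeMoment`). So the statement compares random phases with
Gaussian variables.

The function `f` is not smooth at the origin. Replacing a factor `‖x‖^{-2(k-1)}` by
`(1 + ‖x‖²)^{-(k-1)}` gives a smooth function at bounded distance from `f`, with bounded second and
fourth derivatives (`isSymbol_regEntry`, `norm_homEntry_sub_regEntry_le`); rescaling it to
`ε f₁ (ε^{-1/2} x)` reduces the distance to `O(ε)`. For the rescaled functions,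

* the fluctuations are controlled by a second-order Poincaré inequality on the torus: the variance
  of the sum over `s` is `O(∑ⱼ cⱼ⁴)` (`variance_sum_le`);
* the mean is compared with the Gaussian expectation by Lindeberg's replacement argument. Phases and
  Gaussian variables have equal moments up to order three, so each `s` costs `O(R_s / ε_s)` with
  `R_s = ∑ⱼ cⱼ⁴ ‖v_{sj}‖⁴` (`lindeberg`).

The choice `ε_s = √R_s` balances smoothing and replacement. By the Cauchy–Schwarz inequality
`∑ₛ √R_s ≤ √Δ_β` and `∑ⱼ cⱼ⁴ ≤ Δ_β` (`sum_sqrt_le`, `sum_pow_four_le`), so that every entry deviates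
by `O(√Δ_β)` in mean (`IsRegularization.integral_abs_sub_le`).

The constants so obtained depend on `dA` and `k`. As a state on `ℂ^{dA}` has Hilbert–Schmidt norm at
least `dA^{-1/2}`, the smallness hypothesis with `c = 1` forces `k ≤ dA` (`le_of_sq_mul_hsNorm_le`),
and the dependence on `k` is absorbed in a finite sum. The error is then bounded by the term in
`√Δ_β` alone.
-/

noncomputable section

/-! ### Symbol estimates -/

section Symbol

variable {E F G H : Type*} [NormedAddCommGroup E] [NormedSpace ℝ E] [NormedAddCommGroup F]
  [NormedSpace ℝ F] [NormedAddCommGroup G] [NormedSpace ℝ G] [NormedAddCommGroup H]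
  [NormedSpace ℝ H]

/-- The `n`-th derivative of `f` is `O((1 + ‖x‖) ^ e)`, uniformly on the whole space. -/
def DerivGrowth (n : ℕ) (e : ℤ) (f : E → F) : Prop :=
  ∃ C, ∀ x, ‖iteratedFDeriv ℝ n f x‖ ≤ C * (1 + ‖x‖) ^ e

/-- `f` is a symbol of order `e`: its `n`-th derivative is `O((1 + ‖x‖) ^ (e - n))` for every `n`.
The regularity `⊤` is analyticity, which all the functions considered have. -/
def IsSymbol (e : ℤ) (f : E → F) : Prop :=
  ContDiff ℝ ⊤ f ∧ ∀ n : ℕ, DerivGrowth n (e - n) f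

/-- The Leibniz rule for symbol estimates. Only derivatives of order at most `n` enter the
hypotheses, so that the lemma can be used in an induction on the order. -/
lemma derivGrowth_bilinear (B : F →L[ℝ] G →L[ℝ] H) {f : E → F} {g : E → G} {a b : ℤ} {n : ℕ}
    (hf : ContDiff ℝ ⊤ f) (hg : ContDiff ℝ ⊤ g)
    (hfn : ∀ i ≤ n, DerivGrowth i (a - i) f) (hgn : ∀ i ≤ n, DerivGrowth i (b - i) g) :
    DerivGrowth n (a + b - n) (fun x => B (f x) (g x)) := by
  have hB : 0 ≤ ‖B‖ := norm_nonneg B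
  choose! C hC using hfn
  choose! C' hC' using hgn
  refine ⟨‖B‖ * ∑ i ∈ Finset.range (n + 1), (n.choose i : ℝ) * (C i * C' (n - i)), fun x => ?_⟩
  refine (B.norm_iteratedFDeriv_le_of_bilinear hf hg x (n := n) le_top).trans ?_
  rw [mul_assoc, Finset.sum_mul]
  refine mul_le_mul_of_nonneg_left (Finset.sum_le_sum fun i hi => ?_) hB
  have hi' : i ≤ n := Nat.lt_succ_iff.mp (Finset.mem_range.mp hi)
  have hpos : (0 : ℝ) < 1 + ‖x‖ := by positivity
  have h1 := hC i hi' x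
  have h2 := hC' (n - i) (Nat.sub_le _ _) x
  have h3 : (1 + ‖x‖) ^ (a + b - n) =
      (1 + ‖x‖) ^ (a - i) * (1 + ‖x‖) ^ (b - ((n - i : ℕ) : ℤ)) := by
    rw [← zpow_add₀ hpos.ne']
    congr 1
    push_cast [hi']
    ring
  calc (n.choose i : ℝ) * ‖iteratedFDeriv ℝ i f x‖ * ‖iteratedFDeriv ℝ (n - i) g x‖
      = (n.choose i : ℝ) * (‖iteratedFDeriv ℝ i f x‖ * ‖iteratedFDeriv ℝ (n - i) g x‖) := by ring
    _ ≤ (n.choose i : ℝ) * ((C i * (1 + ‖x‖) ^ (a - i)) *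
          (C' (n - i) * (1 + ‖x‖) ^ (b - ((n - i : ℕ) : ℤ)))) := by
        refine mul_le_mul_of_nonneg_left ?_ (by positivity)
        exact mul_le_mul h1 h2 (norm_nonneg _) ((norm_nonneg _).trans h1)
    _ = _ := by rw [h3]; ring

lemma IsSymbol.bilinear (B : F →L[ℝ] G →L[ℝ] H) {f : E → F} {g : E → G} {a b : ℤ}
    (hf : IsSymbol a f) (hg : IsSymbol b g) : IsSymbol (a + b) (fun x => B (f x) (g x)) :=
  ⟨(B.isBoundedBilinearMap.contDiff.of_le le_top).comp₂ hf.1 hg.1, fun _ =>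
    derivGrowth_bilinear B hf.1 hg.1 (fun i _ => hf.2 i) fun i _ => hg.2 i⟩

lemma IsSymbol.const (c : F) : IsSymbol 0 (fun _ : E => c) := by
  refine ⟨contDiff_const, fun n => ?_⟩
  rcases n with _ | n
  · refine ⟨‖c‖, fun x => ?_⟩
    simp
  · refine ⟨0, fun x => ?_⟩
    rw [iteratedFDeriv_const_of_ne (Nat.succ_ne_zero n)]
    simp

/-- A function of growth `e` whose derivative is a symbol of order `e - 1` is a symbol. -/
lemma IsSymbol.of_fderiv {f : E → F} {e : ℤ} (hf : ContDiff ℝ ⊤ f) {C : ℝ}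
    (h0 : ∀ x, ‖f x‖ ≤ C * (1 + ‖x‖) ^ e) (h1 : IsSymbol (e - 1) (fderiv ℝ f)) :
    IsSymbol e f := by
  refine ⟨hf, fun n => ?_⟩
  rcases n with _ | n
  · exact ⟨C, fun x => by simpa using h0 x⟩
  · obtain ⟨C', h⟩ := h1.2 n
    refine ⟨C', fun x => ?_⟩
    rw [← norm_iteratedFDeriv_fderiv]
    convert h x using 3
    push_cast
    ring

lemma IsSymbol.clm (L : E →L[ℝ] F) : IsSymbol 1 (fun x => L x) := by
  refine IsSymbol.of_fderiv (C := ‖L‖) L.contDiff (fun x => ?_) ?_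
  · refine (L.le_opNorm x).trans ?_
    rw [zpow_one]
    exact mul_le_mul_of_nonneg_left (by linarith) (norm_nonneg _)
  · have : fderiv ℝ (fun x => L x) = fun _ => L := by
      ext1 x
      exact L.fderiv
    rw [this]
    exact IsSymbol.const L

lemma IsSymbol.clm_comp (L : F →L[ℝ] G) {f : E → F} {e : ℤ} (hf : IsSymbol e f) :
    IsSymbol e (fun x => L (f x)) := by
  refine ⟨L.contDiff.comp hf.1, fun n => ?_⟩
  obtain ⟨C, hC⟩ := hf.2 n
  refine ⟨‖L‖ * C, fun x => ?_⟩
  refine (L.norm_iteratedFDeriv_comp_left (f := f) (n := n) hf.1.contDiffAt le_top).trans ?_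
  rw [mul_assoc]
  exact mul_le_mul_of_nonneg_left (hC x) (norm_nonneg _)

lemma IsSymbol.mul {f g : E → ℂ} {a b : ℤ} (hf : IsSymbol a f) (hg : IsSymbol b g) :
    IsSymbol (a + b) (fun x => f x * g x) :=
  hf.bilinear (ContinuousLinearMap.mul ℝ ℂ) hg

lemma IsSymbol.prod {ι : Type*} (s : Finset ι) {f : ι → E → ℂ} {e : ℤ}
    (hf : ∀ i ∈ s, IsSymbol e (f i)) : IsSymbol (s.card * e) (fun x => ∏ i ∈ s, f i x) := by
  classical
  induction s using Finset.induction_on with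
  | empty => simpa using IsSymbol.const (1 : ℂ)
  | insert a s ha ih =>
    have h := (hf a (by simp)).mul (ih fun i hi => hf i (by simp [hi]))
    rw [Finset.card_insert_of_notMem ha]
    convert h using 1
    · push_cast; ring
    · ext x
      rw [Finset.prod_insert ha]

end Symbol

/-! ### The inverse of `1 + ‖x‖²` -/

section Japanese

variable {E : Type*} [NormedAddCommGroup E] [InnerProductSpace ℝ E]

lemma fderiv_one_add_norm_sq :
    fderiv ℝ (fun x : E => 1 + ‖x‖ ^ 2) = fun x => ((2 : ℝ) • innerSL ℝ) x := by
  ext1 x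
  have h := (hasStrictFDerivAt_norm_sq x).hasFDerivAt.const_add 1
  rw [h.fderiv]
  simp [two_smul]

lemma fderiv_inv_one_add_norm_sq :
    fderiv ℝ (fun x : E => (1 + ‖x‖ ^ 2)⁻¹) = fun x =>
      (-((1 + ‖x‖ ^ 2)⁻¹ * (1 + ‖x‖ ^ 2)⁻¹)) • ((2 : ℝ) • innerSL ℝ) x := by
  ext1 x
  have h : HasFDerivAt (fun x : E => 1 + ‖x‖ ^ 2) (((2 : ℝ) • innerSL ℝ) x) x := by
    rw [← congrFun fderiv_one_add_norm_sq x]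
    exact ((contDiff_const.add (contDiff_norm_sq ℝ)).differentiable (n := 1)
      (by norm_num)).differentiableAt.hasFDerivAt
  have hne : 1 + ‖x‖ ^ 2 ≠ 0 := by positivity
  have h2 := (hasDerivAt_inv hne).comp_hasFDerivAt x h
  have h3 : (-((1 + ‖x‖ ^ 2) ^ 2)⁻¹) = -((1 + ‖x‖ ^ 2)⁻¹ * (1 + ‖x‖ ^ 2)⁻¹) := by
    rw [sq, mul_inv]
  rw [← h3]
  exact h2.fderiv

lemma inv_one_add_norm_sq_le {E : Type*} [NormedAddCommGroup E] (x : E) :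
    (1 + ‖x‖ ^ 2)⁻¹ ≤ 2 * (1 + ‖x‖) ^ (-2 : ℤ) := by
  have h : (1 + ‖x‖) ^ (-2 : ℤ) = ((1 + ‖x‖) ^ 2)⁻¹ := by
    rw [zpow_neg]; norm_cast
  rw [h, ← div_eq_mul_inv, inv_eq_one_div, div_le_div_iff₀ (by positivity) (by positivity)]
  nlinarith [sq_nonneg (‖x‖ - 1)]

lemma contDiff_inv_one_add_norm_sq : ContDiff ℝ ⊤ (fun x : E => (1 + ‖x‖ ^ 2)⁻¹) :=
  (contDiff_const.add (contDiff_norm_sq ℝ)).inv fun x => by positivity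

/-- The derivative of `h = (1 + ‖x‖²)⁻¹` is `-2 h² ⟨x, ·⟩`, so that the estimate of order `n + 1`
follows from those of order at most `n` by the Leibniz rule. -/
lemma isSymbol_inv_one_add_norm_sq : IsSymbol (-2) (fun x : E => (1 + ‖x‖ ^ 2)⁻¹) := by
  refine ⟨contDiff_inv_one_add_norm_sq, fun n => ?_⟩
  induction n using Nat.strong_induction_on with
  | _ n ih =>
    rcases n with _ | n
    · refine ⟨2, fun x => ?_⟩
      have := inv_one_add_norm_sq_le x
      have h0 : (0 : ℝ) ≤ (1 + ‖x‖ ^ 2)⁻¹ := by positivity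
      rw [norm_iteratedFDeriv_zero, Real.norm_of_nonneg h0]
      simpa using this
    · have hc := contDiff_inv_one_add_norm_sq (E := E)
      have hsq : ∀ i ≤ n, DerivGrowth i ((-2 + -2 : ℤ) - i)
          (fun x : E => ContinuousLinearMap.mul ℝ ℝ (1 + ‖x‖ ^ 2)⁻¹ (1 + ‖x‖ ^ 2)⁻¹) := by
        intro i hi
        exact derivGrowth_bilinear (ContinuousLinearMap.mul ℝ ℝ) hc hc
          (fun j hj => ih j (by omega)) (fun j hj => ih j (by omega))
      have hsc : ContDiff ℝ ⊤
          (fun x : E => ContinuousLinearMap.mul ℝ ℝ (1 + ‖x‖ ^ 2)⁻¹ (1 + ‖x‖ ^ 2)⁻¹) := hc.mul hc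
      have hL := IsSymbol.clm (((-2 : ℝ)) • (innerSL ℝ : E →L[ℝ] E →L[ℝ] ℝ))
      obtain ⟨C, hC⟩ := derivGrowth_bilinear (n := n)
        (ContinuousLinearMap.lsmul ℝ ℝ : ℝ →L[ℝ] (E →L[ℝ] ℝ) →L[ℝ] _) hsc hL.1 hsq
        fun i _ => hL.2 i
      refine ⟨C, fun x => ?_⟩
      rw [← norm_iteratedFDeriv_fderiv, fderiv_inv_one_add_norm_sq]
      have key : (fun x : E => (-((1 + ‖x‖ ^ 2)⁻¹ * (1 + ‖x‖ ^ 2)⁻¹)) •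
            ((2 : ℝ) • innerSL ℝ : E →L[ℝ] E →L[ℝ] ℝ) x) = fun x : E =>
          (ContinuousLinearMap.lsmul ℝ ℝ : ℝ →L[ℝ] (E →L[ℝ] ℝ) →L[ℝ] _)
            (ContinuousLinearMap.mul ℝ ℝ (1 + ‖x‖ ^ 2)⁻¹ (1 + ‖x‖ ^ 2)⁻¹)
            (((-2 : ℝ) • (innerSL ℝ : E →L[ℝ] E →L[ℝ] ℝ)) x) := by
        ext x y
        simp
      rw [key]
      convert hC x using 3
      push_cast
      ring

end Japanese

/-! ### Symbols of order two -/

section SecondOrder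

variable {E : Type*} [NormedAddCommGroup E] [NormedSpace ℝ E]

lemma norm_iteratedDeriv_line_le {f : E → ℝ} (hf : ContDiff ℝ ⊤ f) (x u : E) (n : ℕ) (s : ℝ) :
    ‖iteratedDeriv n (fun s : ℝ => f (x + s • u)) s‖ ≤
      ‖iteratedFDeriv ℝ n f (x + s • u)‖ * ‖u‖ ^ n := by
  have h1 : (fun s : ℝ => f (x + s • u)) =
      (fun y => f (x + y)) ∘ (ContinuousLinearMap.toSpanSingleton ℝ u) := by
    ext s; simp
  have hc : ContDiff ℝ ⊤ (fun y => f (x + y)) := hf.comp (contDiff_const.add contDiff_id)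
  rw [← norm_iteratedFDeriv_eq_norm_iteratedDeriv, h1,
    ContinuousLinearMap.iteratedFDeriv_comp_right _ hc _ (i := n) le_top,
    iteratedFDeriv_comp_add_left]
  refine (ContinuousMultilinearMap.norm_compContinuousLinearMap_le _ _).trans ?_
  simp [ContinuousLinearMap.norm_toSpanSingleton]

lemma deriv_deriv_line {f : E → ℝ} (hf : ContDiff ℝ ⊤ f) (x u : E) (s : ℝ) :
    HasDerivAt (fun s : ℝ => f (x + s • u)) (fderiv ℝ f (x + s • u) u) s ∧
    HasDerivAt (fun s : ℝ => fderiv ℝ f (x + s • u) u)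
      (fderiv ℝ (fderiv ℝ f) (x + s • u) u u) s := by
  have hl : HasDerivAt (fun s : ℝ => x + s • u) u s := by
    simpa using ((hasDerivAt_id s).smul_const u).const_add x
  have hd : Differentiable ℝ f := hf.differentiable (by simp)
  have hd2 : Differentiable ℝ (fderiv ℝ f) :=
    (hf.fderiv_right (m := 1) le_top).differentiable (by simp)
  refine ⟨(hd _).hasFDerivAt.comp_hasDerivAt s hl, ?_⟩
  have h := (hd2 (x + s • u)).hasFDerivAt.comp_hasDerivAt s hl
  exact h.clm_apply (hasDerivAt_const s u) |>.congr_deriv (by simp)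

/-- Symmetrization removes the odd orders of Taylor's formula, so that the remainder after the
second order is controlled by the fourth derivative. -/
lemma abs_second_difference_le {f : E → ℝ} (hf : ContDiff ℝ ⊤ f) {M : ℝ}
    (hM : ∀ x, ‖iteratedFDeriv ℝ 4 f x‖ ≤ M) (x u : E) :
    |f (x + u) + f (x - u) - 2 * f x - fderiv ℝ (fderiv ℝ f) x u u| ≤ M * ‖u‖ ^ 4 := by
  set g : ℝ → ℝ := fun s => f (x + s • u) with hg
  have hgc : ContDiff ℝ ⊤ g :=
    hf.comp (contDiff_const.add (contDiff_id.smul contDiff_const))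
  have hgn : ContDiff ℝ ⊤ (fun s => g (-s)) := hgc.comp contDiff_neg
  set h : ℝ → ℝ := fun s => g s + g (-s) with hh
  have hhc : ContDiff ℝ ⊤ h := hgc.add hgn
  have hit : ∀ n s,
      iteratedDeriv n h s = iteratedDeriv n g s + (-1) ^ n * iteratedDeriv n g (-s) := by
    intro n s
    have h1 : h = g + fun s => g (-s) := rfl
    rw [h1, iteratedDeriv_add (hgc.contDiffAt.of_le le_top) (hgn.contDiffAt.of_le le_top)]
    congr 1
    have := iteratedDeriv_comp_neg n g s
    simpa using this
  obtain ⟨t, -, ht⟩ := taylor_mean_remainder_lagrange_iteratedDeriv (f := h) (x := 1) (x₀ := 0)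
    (n := 3) (by norm_num) ((hhc.of_le le_top).contDiffOn)
  have hU : UniqueDiffOn ℝ (Set.uIcc (0 : ℝ) 1) := by
    rw [Set.uIcc_of_le zero_le_one]
    exact uniqueDiffOn_Icc zero_lt_one
  have hw : ∀ n, iteratedDerivWithin n h (Set.uIcc 0 1) 0 = iteratedDeriv n h 0 := fun n =>
    iteratedDerivWithin_eq_iteratedDeriv hU (hhc.contDiffAt.of_le le_top) (by simp)
  have hd2 : iteratedDeriv 2 g 0 = fderiv ℝ (fderiv ℝ f) x u u := by
    rw [iteratedDeriv_succ, iteratedDeriv_one]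
    have h1 : deriv g = fun s => fderiv ℝ f (x + s • u) u := by
      ext s
      exact (deriv_deriv_line hf x u s).1.deriv
    rw [h1]
    simpa using (deriv_deriv_line hf x u 0).2.deriv
  have h0 : h 0 = 2 * f x := by simp [hh, hg]; ring
  have h1 : h 1 = f (x + u) + f (x - u) := by simp [hh, hg, sub_eq_add_neg]
  have key : h 1 - h 0 - fderiv ℝ (fderiv ℝ f) x u u = iteratedDeriv 4 h t / 24 := by
    simp only [taylor_within_apply, hw, Finset.sum_range_succ, hit] at ht
    simp [hd2, Nat.factorial] at ht
    norm_num at ht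
    have h00 : g 0 + g 0 = h 0 := by simp [hh]
    rw [hit]
    norm_num
    rw [← ht, ← h00]
    ring
  rw [← h0, ← h1, key, hit]
  have hb : ∀ s, |iteratedDeriv 4 g s| ≤ M * ‖u‖ ^ 4 := fun s =>
    (norm_iteratedDeriv_line_le hf x u 4 s).trans
      (mul_le_mul_of_nonneg_right (hM _) (by positivity))
  have h2 := abs_le.mp (hb t)
  have h3 := abs_le.mp (hb (-t))
  rw [abs_le]
  constructor <;> norm_num <;> linarith [(abs_nonneg _).trans (hb t)]

/-- The consequences of being a symbol of order two that the probabilistic estimates use: at most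
quadratic growth, bounded second derivative, and Taylor's formula to fourth order. -/
lemma IsSymbol.second_order {f : E → ℝ} (hf : IsSymbol 2 f) :
    ∃ C, 0 ≤ C ∧ (∀ x, |f x| ≤ C * (1 + ‖x‖) ^ 2) ∧
      (∀ x, ‖fderiv ℝ (fderiv ℝ f) x‖ ≤ C) ∧
      ∀ x u, |f (x + u) + f (x - u) - 2 * f x - fderiv ℝ (fderiv ℝ f) x u u| ≤ C * ‖u‖ ^ 4 := by
  obtain ⟨A, hA⟩ := hf.2 0
  obtain ⟨B, hB⟩ := hf.2 2
  obtain ⟨D, hD⟩ := hf.2 4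
  have hA' : ∀ x, |f x| ≤ A * (1 + ‖x‖) ^ 2 := by
    intro x
    have := hA x
    simp only [norm_iteratedFDeriv_zero, Real.norm_eq_abs, Nat.cast_zero, sub_zero] at this
    exact_mod_cast this
  have hB' : ∀ x, ‖fderiv ℝ (fderiv ℝ f) x‖ ≤ B := by
    intro x
    have := hB x
    rw [← norm_iteratedFDeriv_fderiv, ← norm_iteratedFDeriv_fderiv, norm_iteratedFDeriv_zero]
      at this
    simpa using this
  have hD0 : 0 ≤ D := by
    have := (norm_nonneg _).trans (hD 0)
    simpa using this
  have hD' : ∀ x, ‖iteratedFDeriv ℝ 4 f x‖ ≤ D := by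
    intro x
    refine (hD x).trans (mul_le_of_le_one_right hD0 ?_)
    exact zpow_le_one_of_nonpos₀ (by linarith [norm_nonneg x]) (by norm_num)
  have hB0 : 0 ≤ B := (norm_nonneg (fderiv ℝ (fderiv ℝ f) 0)).trans (hB' 0)
  have hA0 : 0 ≤ A := by simpa using (abs_nonneg _).trans (hA' 0)
  refine ⟨A + B + D, by positivity, fun x => (hA' x).trans ?_, fun x => (hB' x).trans ?_,
    fun x u => (abs_second_difference_le hf.1 hD' x u).trans ?_⟩
  · exact mul_le_mul_of_nonneg_right (by linarith) (by positivity)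
  · linarith
  · exact mul_le_mul_of_nonneg_right (by linarith) (by positivity)

end SecondOrder

/-! ### Entries of the moment operators and their regularization -/

section Regularized

variable {n : Type} [Fintype n]

/-- The entry `(i, j)` of `‖x‖² (|x⟩⟨x| / ‖x‖²)^{⊗k}` with the singular factor
`‖x‖^{-2(k-1)}` replaced by `(1 + ‖x‖²)^{-(k-1)}`. -/
def regEntry (k : ℕ) (i j : Fin k → n) (x : Ket n) : ℂ :=
  (∏ l, x (i l) * star (x (j l))) * (((1 + ‖x‖ ^ 2)⁻¹ ^ (k - 1) : ℝ) : ℂ)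

/-- The entry `(i, j)` of `‖x‖² (|x⟩⟨x| / ‖x‖²)^{⊗k}`. -/
def homEntry (k : ℕ) (i j : Fin k → n) (x : Ket n) : ℂ :=
  ((‖x‖ ^ 2 : ℝ) : ℂ) * tensorPow k (ketbra (((‖x‖⁻¹ : ℝ) : ℂ) • x)) i j

lemma isSymbol_regEntry {k : ℕ} (hk : 1 ≤ k) (i j : Fin k → n) :
    IsSymbol 2 (regEntry k i j) := by
  have hcoord : ∀ a : n, IsSymbol 1 (fun x : Ket n => x a) := fun a =>
    IsSymbol.clm ((EuclideanSpace.proj a : Ket n →L[ℂ] ℂ).restrictScalars ℝ)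
  have hstar : ∀ a : n, IsSymbol 1 (fun x : Ket n => star (x a)) := fun a =>
    (hcoord a).clm_comp (Complex.conjCLE : ℂ →L[ℝ] ℂ)
  have h1 := IsSymbol.prod Finset.univ (f := fun (l : Fin k) (x : Ket n) =>
    x (i l) * star (x (j l))) (e := 1 + 1) fun l _ => (hcoord _).mul (hstar _)
  have h2 := IsSymbol.prod (Finset.range (k - 1)) (f := fun _ (x : Ket n) =>
    (((1 + ‖x‖ ^ 2)⁻¹ : ℝ) : ℂ)) (e := -2) fun _ _ =>
      isSymbol_inv_one_add_norm_sq.clm_comp Complex.ofRealCLM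
  convert h1.mul h2 using 1
  · simp only [Finset.card_univ, Fintype.card_fin, Finset.card_range]
    push_cast [hk]
    ring
  · ext x
    simp [regEntry]

lemma norm_coord_le (x : Ket n) (a : n) : ‖x a‖ ≤ ‖x‖ := PiLp.norm_apply_le x a

lemma norm_prod_entry_le (k : ℕ) (i j : Fin k → n) (x : Ket n) :
    ‖∏ l, x (i l) * star (x (j l))‖ ≤ (‖x‖ ^ 2) ^ k := by
  rw [norm_prod]
  refine (Finset.prod_le_prod (fun _ _ => norm_nonneg _) (fun l _ => ?_)).trans_eq
    (by simp : ∏ _l : Fin k, ‖x‖ ^ 2 = (‖x‖ ^ 2) ^ k)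
  rw [norm_mul, norm_star, sq]
  exact mul_le_mul (norm_coord_le _ _) (norm_coord_le _ _) (norm_nonneg _) (norm_nonneg _)

lemma homEntry_eq {k : ℕ} (hk : 1 ≤ k) (i j : Fin k → n) (x : Ket n) :
    homEntry k i j x =
      (∏ l, x (i l) * star (x (j l))) * ((((‖x‖ ^ 2)⁻¹) ^ (k - 1) : ℝ) : ℂ) := by
  by_cases hx : ‖x‖ = 0
  · have hx0 : x = 0 := norm_eq_zero.mp hx
    subst hx0
    have : ∏ l : Fin k, (0 : Ket n) (i l) * star ((0 : Ket n) (j l)) = 0 :=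
      Finset.prod_eq_zero (Finset.mem_univ ⟨0, hk⟩) (by simp)
    rw [this]
    simp [homEntry]
  · obtain ⟨m, rfl⟩ : ∃ m, k = m + 1 := ⟨k - 1, by omega⟩
    have hx' : (‖x‖ : ℂ) ≠ 0 := by exact_mod_cast hx
    have : ∀ l, ((‖x‖⁻¹ : ℝ) : ℂ) * x (i l) * star (((‖x‖⁻¹ : ℝ) : ℂ) * x (j l)) =
        ((((‖x‖ ^ 2)⁻¹ : ℝ)) : ℂ) * (x (i l) * star (x (j l))) := by
      intro l
      rw [star_mul', Complex.star_def, Complex.conj_ofReal]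
      push_cast
      ring
    simp only [homEntry, tensorPow, ketbra, Matrix.of_apply, PiLp.smul_apply, smul_eq_mul]
    rw [Finset.prod_congr rfl fun l _ => this l, Finset.prod_mul_distrib, Finset.prod_const,
      Finset.card_univ, Fintype.card_fin, Nat.add_sub_cancel, pow_succ' _ m]
    push_cast
    have h2 : (‖x‖ : ℂ) ^ 2 * ((‖x‖ : ℂ) ^ 2)⁻¹ = 1 := mul_inv_cancel₀ (pow_ne_zero 2 hx')
    rw [← mul_assoc, ← mul_assoc, h2, one_mul, mul_comm]

lemma norm_homEntry_le {k : ℕ} (hk : 1 ≤ k) (i j : Fin k → n) (x : Ket n) :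
    ‖homEntry k i j x‖ ≤ ‖x‖ ^ 2 := by
  rw [homEntry_eq hk, norm_mul, Complex.norm_real, Real.norm_of_nonneg (by positivity)]
  refine (mul_le_mul_of_nonneg_right (norm_prod_entry_le k i j x) (by positivity)).trans ?_
  obtain ⟨m, rfl⟩ : ∃ m, k = m + 1 := ⟨k - 1, by omega⟩
  rw [Nat.add_sub_cancel, pow_succ']
  rw [mul_assoc, ← mul_pow]
  exact mul_le_of_le_one_right (by positivity)
    (pow_le_one₀ (by positivity) (mul_inv_le_one))

/-- The regularization is at a bounded distance, although both functions grow quadratically. With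
`p = ‖x‖²`, the difference is at most `p (1 - (p / (1 + p)) ^ (k - 1)) ≤ k - 1`. -/
lemma norm_homEntry_sub_regEntry_le {k : ℕ} (hk : 1 ≤ k) (i j : Fin k → n) (x : Ket n) :
    ‖homEntry k i j x - regEntry k i j x‖ ≤ k := by
  by_cases hx : ‖x‖ = 0
  · have h : ∏ l : Fin k, x (i l) * star (x (j l)) = 0 := by
      rw [norm_eq_zero.mp hx]
      exact Finset.prod_eq_zero (Finset.mem_univ ⟨0, hk⟩) (by simp)
    rw [homEntry_eq hk, regEntry, h]
    simp
  rw [homEntry_eq hk, regEntry, ← mul_sub, ← Complex.ofReal_sub, norm_mul, Complex.norm_real,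
    Real.norm_eq_abs]
  obtain ⟨m, rfl⟩ : ∃ m, k = m + 1 := ⟨k - 1, by omega⟩
  rw [Nat.add_sub_cancel]
  set p := ‖x‖ ^ 2 with hp
  have hp0 : 0 < p := by positivity
  have h1 : (1 + p)⁻¹ ≤ p⁻¹ := inv_anti₀ hp0 (by linarith)
  have h2 : (1 + p)⁻¹ ^ m ≤ p⁻¹ ^ m := pow_le_pow_left₀ (by positivity) h1 m
  rw [abs_of_nonneg (by linarith)]
  refine (mul_le_mul_of_nonneg_right (norm_prod_entry_le _ i j x) (by linarith)).trans ?_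
  -- Bernoulli's inequality, for `(p / (1 + p)) ^ m = (1 - 1 / (1 + p)) ^ m`.
  have hB := one_add_mul_le_pow (a := -(1 + p)⁻¹)
    (by have : (1 + p)⁻¹ ≤ 1 := inv_le_one_of_one_le₀ (by linarith)
        linarith) m
  have h3 : 1 + -(1 + p)⁻¹ = p * (1 + p)⁻¹ := by field_simp; ring
  rw [h3, mul_pow] at hB
  have h4 : p ^ (m + 1) * (p⁻¹ ^ m - (1 + p)⁻¹ ^ m) = p * (1 - p ^ m * (1 + p)⁻¹ ^ m) := by
    have : p ^ m * p⁻¹ ^ m = 1 := by rw [← mul_pow, mul_inv_cancel₀ hp0.ne', one_pow]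
    calc p ^ (m + 1) * (p⁻¹ ^ m - (1 + p)⁻¹ ^ m)
        = p * (p ^ m * p⁻¹ ^ m - p ^ m * (1 + p)⁻¹ ^ m) := by ring
      _ = _ := by rw [this]
  rw [h4]
  have h5 : p * (1 + p)⁻¹ ≤ 1 := by
    rw [← div_eq_mul_inv, div_le_one (by positivity)]; linarith
  calc p * (1 - p ^ m * (1 + p)⁻¹ ^ m) ≤ p * (m * (1 + p)⁻¹) :=
        mul_le_mul_of_nonneg_left (by linarith) hp0.le
    _ = m * (p * (1 + p)⁻¹) := by ring
    _ ≤ m * 1 := mul_le_mul_of_nonneg_left h5 (by positivity)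
    _ ≤ ((m + 1 : ℕ) : ℝ) := by push_cast; linarith

lemma homEntry_smul {k : ℕ} (i j : Fin k → n) {r : ℝ} (hr : 0 < r) (x : Ket n) :
    homEntry k i j (r • x) = ((r ^ 2 : ℝ) : ℂ) * homEntry k i j x := by
  have h : (((‖r • x‖⁻¹ : ℝ) : ℂ) • (r • x)) = ((‖x‖⁻¹ : ℝ) : ℂ) • x := by
    ext a
    simp only [norm_smul, Real.norm_of_nonneg hr.le, PiLp.smul_apply, smul_eq_mul,
      Complex.real_smul]
    have : (r : ℂ) ≠ 0 := by exact_mod_cast hr.ne'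
    push_cast
    field_simp
  rw [homEntry, homEntry, h, norm_smul, Real.norm_of_nonneg hr.le, mul_pow]
  push_cast
  ring

lemma measurable_homEntry (k : ℕ) (i j : Fin k → n) : Measurable (homEntry k i j) := by
  unfold homEntry tensorPow ketbra
  simp only [Matrix.of_apply, PiLp.smul_apply, smul_eq_mul]
  fun_prop

lemma regEntry_neg (k : ℕ) (i j : Fin k → n) (x : Ket n) :
    regEntry k i j (-x) = regEntry k i j x := by
  simp [regEntry]

end Regularized

/-! ### The Poincaré inequality on the torus -/

section Poincare

/-- The uniform distribution on `[0, 2π)`. -/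
def phaseUnif : Measure ℝ := ProbabilityTheory.cond volume (Set.Ico 0 (2 * Real.pi))

lemma volume_Ico_two_pi : volume (Set.Ico 0 (2 * Real.pi)) = ENNReal.ofReal (2 * Real.pi) := by
  simp

instance : IsProbabilityMeasure phaseUnif :=
  ProbabilityTheory.cond_isProbabilityMeasure_of_finite
    (by simp [Real.pi_pos]) (by simp [ENNReal.mul_eq_top])

instance (D : ℕ) : IsProbabilityMeasure (phaseMeasure D) :=
  inferInstanceAs (IsProbabilityMeasure (Measure.pi fun _ => phaseUnif))

lemma phaseMeasure_eq (D : ℕ) : phaseMeasure D = Measure.pi fun _ => phaseUnif := rfl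

lemma ae_phaseUnif : ∀ᵐ t ∂phaseUnif, t ∈ Set.Icc 0 (2 * Real.pi) := by
  have : ∀ᵐ t ∂phaseUnif, t ∈ Set.Ico 0 (2 * Real.pi) :=
    ProbabilityTheory.ae_cond_mem measurableSet_Ico
  exact this.mono fun t ht => Set.Ico_subset_Icc_self ht

lemma integral_phaseUnif {E : Type*} [NormedAddCommGroup E] [NormedSpace ℝ E] (f : ℝ → E) :
    ∫ t, f t ∂phaseUnif = (2 * Real.pi)⁻¹ • ∫ t in (0 : ℝ)..(2 * Real.pi), f t := by
  rw [phaseUnif, ProbabilityTheory.cond, integral_smul_measure, volume_Ico_two_pi,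
    intervalIntegral.integral_of_le (by positivity), integral_Ico_eq_integral_Ioc]
  congr 1
  rw [ENNReal.toReal_inv, ENNReal.toReal_ofReal (by positivity)]

lemma ae_phaseMeasure (D : ℕ) :
    ∀ᵐ φ ∂phaseMeasure D, φ ∈ Set.univ.pi fun _ => Set.Icc 0 (2 * Real.pi) := by
  rw [phaseMeasure_eq]
  have : ∀ᵐ φ ∂(Measure.pi fun _ : Fin D => phaseUnif), ∀ i, φ i ∈ Set.Icc 0 (2 * Real.pi) :=
    ae_all_iff.mpr fun i => Measure.tendsto_eval_ae_ae.eventually ae_phaseUnif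
  exact this.mono fun φ h i _ => h i

lemma Continuous.integrable_phaseUnif {E : Type*} [NormedAddCommGroup E] {f : ℝ → E}
    (hf : Continuous f) : Integrable f phaseUnif := by
  obtain ⟨C, hC⟩ := (isCompact_Icc (a := (0 : ℝ)) (b := 2 * Real.pi)).exists_bound_of_continuousOn
    hf.continuousOn
  exact Integrable.of_bound hf.aestronglyMeasurable C (ae_phaseUnif.mono fun t ht => hC t ht)

lemma Continuous.integrable_phaseMeasure {E : Type*} [NormedAddCommGroup E]
    [SecondCountableTopology E] {D : ℕ}
    {f : (Fin D → ℝ) → E} (hf : Continuous f) : Integrable f (phaseMeasure D) := by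
  obtain ⟨C, hC⟩ := (isCompact_univ_pi fun _ : Fin D =>
    isCompact_Icc (a := (0 : ℝ)) (b := 2 * Real.pi)).exists_bound_of_continuousOn hf.continuousOn
  exact Integrable.of_bound hf.aestronglyMeasurable C
    ((ae_phaseMeasure D).mono fun t ht => hC t ht)

lemma integral_sub_mean_sq {Ω : Type*} [MeasurableSpace Ω] (μ : Measure Ω)
    [IsProbabilityMeasure μ] {f : Ω → ℝ} (hf : Integrable f μ)
    (hf2 : Integrable (fun x => f x ^ 2) μ) (m : ℝ) :
    ∫ x, (f x - m) ^ 2 ∂μ = ∫ x, f x ^ 2 ∂μ - 2 * m * (∫ x, f x ∂μ) + m ^ 2 := by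
  have h1 : Integrable (fun x => f x ^ 2 - (2 * m) * f x) μ := hf2.sub (hf.const_mul _)
  calc ∫ x, (f x - m) ^ 2 ∂μ = ∫ x, ((f x ^ 2 - (2 * m) * f x) + m ^ 2) ∂μ :=
        integral_congr_ae (ae_of_all _ fun x => by ring)
    _ = ∫ x, (f x ^ 2 - (2 * m) * f x) ∂μ + m ^ 2 := by
        rw [integral_add h1 (integrable_const _)]; simp
    _ = _ := by rw [integral_sub hf2 (hf.const_mul _), integral_const_mul]

lemma sq_integral_le {Ω : Type*} [MeasurableSpace Ω] (μ : Measure Ω) [IsProbabilityMeasure μ]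
    {f : Ω → ℝ} (hf : Integrable f μ) (hf2 : Integrable (fun x => f x ^ 2) μ) :
    (∫ x, f x ∂μ) ^ 2 ≤ ∫ x, f x ^ 2 ∂μ := by
  have h : 0 ≤ ∫ x, (f x - ∫ y, f y ∂μ) ^ 2 ∂μ := integral_nonneg fun x => sq_nonneg _
  rw [integral_sub_mean_sq μ hf hf2] at h
  linarith

lemma continuous_sq_comp {X : Type*} [TopologicalSpace X] {f : X → ℝ} (hf : Continuous f) :
    Continuous fun x => f x ^ 2 := by fun_prop

/-- A Poincaré inequality on `[0, 2π]`, with a non-optimal constant. -/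
lemma poincare_phaseUnif {f f' : ℝ → ℝ} (hf : ∀ t, HasDerivAt f (f' t) t) (hf' : Continuous f') :
    ∫ t, f t ^ 2 ∂phaseUnif - (∫ t, f t ∂phaseUnif) ^ 2 ≤
      (2 * Real.pi) ^ 2 * ∫ t, f' t ^ 2 ∂phaseUnif := by
  have hfc : Continuous f := continuous_iff_continuousAt.mpr fun t => (hf t).continuousAt
  set m := ∫ t, f t ∂phaseUnif with hm
  set A := ∫ t, |f' t| ∂phaseUnif with hA
  have hfi := hfc.integrable_phaseUnif
  have hf2i := (continuous_sq_comp hfc).integrable_phaseUnif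
  have hA0 : 0 ≤ A := integral_nonneg fun _ => abs_nonneg _
  have hAI : 2 * Real.pi * A = ∫ t in (0 : ℝ)..(2 * Real.pi), |f' t| := by
    rw [hA, integral_phaseUnif, smul_eq_mul, mul_inv_cancel_left₀ (by positivity)]
  have hosc : ∀ s ∈ Set.Icc 0 (2 * Real.pi), ∀ t ∈ Set.Icc 0 (2 * Real.pi),
      |f s - f t| ≤ 2 * Real.pi * A := by
    intro s hs t ht
    rw [← intervalIntegral.integral_eq_sub_of_hasDerivAt (fun x _ => hf x)
      (hf'.intervalIntegrable _ _), hAI]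
    refine (intervalIntegral.norm_integral_le_abs_integral_norm (f := f')).trans ?_
    refine (intervalIntegral.abs_integral_mono_interval (c := 0) (d := 2 * Real.pi) ?_
      (ae_of_all _ fun _ => norm_nonneg _) (hf'.norm.intervalIntegrable _ _)).trans_eq
      (abs_of_nonneg ?_)
    · rw [Set.uIoc_of_le (by positivity : (0 : ℝ) ≤ 2 * Real.pi), Set.uIoc]
      exact Set.Ioc_subset_Ioc (le_min ht.1 hs.1) (max_le ht.2 hs.2)
    · exact intervalIntegral.integral_nonneg (by positivity) fun _ _ => norm_nonneg _
  have hpt : ∀ s ∈ Set.Icc 0 (2 * Real.pi), (f s - m) ^ 2 ≤ (2 * Real.pi * A) ^ 2 := by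
    intro s hs
    have h1 : f s - m = ∫ t, (f s - f t) ∂phaseUnif := by
      rw [integral_sub (integrable_const _) hfi]; simp [hm]
    have h2 : |f s - m| ≤ 2 * Real.pi * A := by
      rw [h1]
      have := norm_integral_le_of_norm_le_const (μ := phaseUnif) (f := fun t => f s - f t)
        (C := 2 * Real.pi * A) (ae_phaseUnif.mono fun t ht => hosc s hs t ht)
      simpa using this
    exact sq_le_sq' (by linarith [(abs_le.mp h2).1]) (abs_le.mp h2).2
  have h3 : ∫ t, (f t - m) ^ 2 ∂phaseUnif ≤ (2 * Real.pi * A) ^ 2 := by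
    have : ∫ t, (f t - m) ^ 2 ∂phaseUnif ≤ ∫ _t, (2 * Real.pi * A) ^ 2 ∂phaseUnif :=
      integral_mono_ae (continuous_sq_comp (hfc.sub continuous_const)).integrable_phaseUnif
        (integrable_const _) (ae_phaseUnif.mono hpt)
    simpa using this
  rw [integral_sub_mean_sq _ hfi hf2i] at h3
  have h4 : A ^ 2 ≤ ∫ t, f' t ^ 2 ∂phaseUnif := by
    have := sq_integral_le phaseUnif (f := fun t => |f' t|) hf'.abs.integrable_phaseUnif
      (by simpa using (continuous_sq_comp hf').integrable_phaseUnif)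
    simpa using this
  have h5 := mul_le_mul_of_nonneg_left h4 (sq_nonneg (2 * Real.pi))
  rw [mul_pow] at h3
  have : m * m = m ^ 2 := by ring
  nlinarith

/-- Tensorization of the variance over a product of two probability spaces. -/
lemma variance_prod_le {X Y : Type*} [MeasurableSpace X] [MeasurableSpace Y] (μ : Measure X)
    (ν : Measure Y) [IsProbabilityMeasure μ] [IsProbabilityMeasure ν] {F : X × Y → ℝ}
    (hF : Integrable F (μ.prod ν)) (hF2 : Integrable (fun p => F p ^ 2) (μ.prod ν)) :
    ∫ p, F p ^ 2 ∂(μ.prod ν) - (∫ p, F p ∂(μ.prod ν)) ^ 2 ≤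
      ∫ y, (∫ x, F (x, y) ^ 2 ∂μ - (∫ x, F (x, y) ∂μ) ^ 2) ∂ν +
      ∫ x, (∫ y, F (x, y) ^ 2 ∂ν - (∫ y, F (x, y) ∂ν) ^ 2) ∂μ := by
  set m : Y → ℝ := fun y => ∫ x, F (x, y) ∂μ with hm
  set a : X → ℝ := fun x => ∫ y, F (x, y) ∂ν with ha
  set M := ∫ p, F p ∂(μ.prod ν) with hM
  have hmi : Integrable m ν := hF.integral_prod_right
  have hai : Integrable a μ := hF.integral_prod_left
  have hmM : ∫ y, m y ∂ν = M := (integral_prod_symm F hF).symm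
  have haM : ∫ x, a x ∂μ = M := (integral_prod F hF).symm
  have hFx : ∀ᵐ x ∂μ, Integrable (fun y => F (x, y)) ν := hF.prod_right_ae
  have hFy : ∀ᵐ y ∂ν, Integrable (fun x => F (x, y)) μ := hF.prod_left_ae
  have hF2x : ∀ᵐ x ∂μ, Integrable (fun y => F (x, y) ^ 2) ν := hF2.prod_right_ae
  have hF2y : ∀ᵐ y ∂ν, Integrable (fun x => F (x, y) ^ 2) μ := hF2.prod_left_ae
  have hm2 : Integrable (fun y => m y ^ 2) ν := by
    refine Integrable.mono' hF2.integral_prod_right (hmi.1.pow 2) ?_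
    filter_upwards [hFy, hF2y] with y h1 h2
    rw [Real.norm_of_nonneg (sq_nonneg _)]
    exact sq_integral_le μ h1 h2
  have ha2 : Integrable (fun x => a x ^ 2) μ := by
    refine Integrable.mono' hF2.integral_prod_left (hai.1.pow 2) ?_
    filter_upwards [hFx, hF2x] with x h1 h2
    rw [Real.norm_of_nonneg (sq_nonneg _)]
    exact sq_integral_le ν h1 h2
  have haf : Integrable (fun p : X × Y => a p.1) (μ.prod ν) := hai.comp_fst ν
  have hG : Integrable (fun p : X × Y => F p - a p.1) (μ.prod ν) := hF.sub haf
  have hG2 : Integrable (fun p : X × Y => (F p - a p.1) ^ 2) (μ.prod ν) := by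
    have h1 := (memLp_two_iff_integrable_sq hF.1).mpr hF2
    have h2 := (memLp_two_iff_integrable_sq haf.1).mpr (ha2.comp_fst ν)
    exact (h1.sub h2).integrable_sq
  -- The mean over `x` has smaller variance in `y` than `F (x, ·)` has on average.
  have h1 : ∫ y, (m y - M) ^ 2 ∂ν ≤ ∫ y, ∫ x, (F (x, y) - a x) ^ 2 ∂μ ∂ν := by
    refine integral_mono_ae ?_ hG2.integral_prod_right ?_
    · exact (((memLp_two_iff_integrable_sq hmi.1).mpr hm2).sub (memLp_const M)).integrable_sq
    · filter_upwards [hFy, hG.prod_left_ae, hG2.prod_left_ae] with y h1 h2 h3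
      have : m y - M = ∫ x, (F (x, y) - a x) ∂μ := by rw [integral_sub h1 hai, haM]
      rw [this]
      exact sq_integral_le μ h2 h3
  have h2 : ∫ y, ∫ x, (F (x, y) - a x) ^ 2 ∂μ ∂ν =
      ∫ x, (∫ y, F (x, y) ^ 2 ∂ν - a x ^ 2) ∂μ := by
    rw [← integral_prod_symm (fun p : X × Y => (F p - a p.1) ^ 2) hG2, integral_prod _ hG2]
    refine integral_congr_ae ?_
    filter_upwards [hFx, hF2x] with x h1 h2
    rw [integral_sub_mean_sq ν h1 h2]
    simp only [ha]
    ring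
  have h3 : ∫ y, (m y - M) ^ 2 ∂ν = ∫ y, m y ^ 2 ∂ν - M ^ 2 := by
    rw [integral_sub_mean_sq ν hmi hm2, hmM]
    ring
  have h4 : ∫ y, (∫ x, F (x, y) ^ 2 ∂μ - m y ^ 2) ∂ν =
      ∫ p, F p ^ 2 ∂(μ.prod ν) - ∫ y, m y ^ 2 ∂ν := by
    rw [integral_sub hF2.integral_prod_right hm2, ← integral_prod_symm _ hF2]
  rw [h4, ← h2]
  linarith

lemma piFinSuccAbove_symm_eq_cons {α : Type*} [MeasurableSpace α] {D : ℕ} (p : α × (Fin D → α)) :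
    (MeasurableEquiv.piFinSuccAbove (fun _ : Fin (D + 1) => α) 0).symm p = Fin.cons p.1 p.2 := by
  simp [MeasurableEquiv.piFinSuccAbove]
  rfl

lemma integral_phaseMeasure_succ {D : ℕ} (G : (Fin (D + 1) → ℝ) → ℝ) :
    ∫ φ, G φ ∂phaseMeasure (D + 1) =
      ∫ p, G (Fin.cons p.1 p.2) ∂(phaseUnif.prod (phaseMeasure D)) := by
  have h := (measurePreserving_piFinSuccAbove (fun _ : Fin (D + 1) => phaseUnif) 0).symm
  rw [phaseMeasure_eq, ← h.integral_comp']
  simp only [piFinSuccAbove_symm_eq_cons]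
  rfl

/-- The Poincaré inequality for the uniform distribution on the torus `[0, 2π)^D`. -/
lemma poincare_phaseMeasure (D : ℕ) {F : (Fin D → ℝ) → ℝ} {F' : Fin D → (Fin D → ℝ) → ℝ}
    (hF : Continuous F) (hF' : ∀ j, Continuous (F' j))
    (hd : ∀ φ j, HasDerivAt (fun t => F (Function.update φ j t)) (F' j φ) (φ j)) :
    ∫ φ, F φ ^ 2 ∂phaseMeasure D - (∫ φ, F φ ∂phaseMeasure D) ^ 2 ≤
      (2 * Real.pi) ^ 2 * ∑ j, ∫ φ, F' j φ ^ 2 ∂phaseMeasure D := by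
  induction D with
  | zero =>
    have : ∀ φ, F φ = F 0 := fun φ => congrArg F (Subsingleton.elim _ _)
    simp [this]
  | succ D ih =>
    have hcons : Continuous fun p : ℝ × (Fin D → ℝ) => (Fin.cons p.1 p.2 : Fin (D + 1) → ℝ) :=
      Continuous.finCons continuous_fst continuous_snd
    have hint : ∀ {G : (Fin (D + 1) → ℝ) → ℝ}, Continuous G →
        Integrable (fun p : ℝ × (Fin D → ℝ) => G (Fin.cons p.1 p.2))
          (phaseUnif.prod (phaseMeasure D)) := by
      intro G hG
      have h := (measurePreserving_piFinSuccAbove (fun _ : Fin (D + 1) => phaseUnif) 0).symm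
      have h2 := (h.integrable_comp_emb (MeasurableEquiv.measurableEmbedding _)).mpr
        hG.integrable_phaseMeasure
      simp only [Function.comp_def, piFinSuccAbove_symm_eq_cons] at h2
      exact h2
    simp only [integral_phaseMeasure_succ]
    have hG := hint hF
    have hG2 := hint (continuous_sq_comp hF)
    refine (variance_prod_le phaseUnif (phaseMeasure D) hG hG2).trans ?_
    rw [Fin.sum_univ_succ, mul_add]
    refine add_le_add ?_ ?_
    · rw [integral_prod_symm _ (hint (continuous_sq_comp (hF' 0))), ← integral_const_mul]
      refine integral_mono_of_nonneg (ae_of_all _ fun ψ => ?_)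
        ((hint (continuous_sq_comp (hF' 0))).integral_prod_right.const_mul _)
        (ae_of_all _ fun ψ => ?_)
      · have hc : Continuous fun t : ℝ => F (Fin.cons t ψ) :=
          hF.comp (hcons.comp (continuous_id.prodMk continuous_const))
        exact sub_nonneg.mpr (sq_integral_le _ hc.integrable_phaseUnif
          (continuous_sq_comp hc).integrable_phaseUnif)
      · refine poincare_phaseUnif (fun t => ?_)
          ((hF' 0).comp (hcons.comp (continuous_id.prodMk continuous_const)))
        simpa using hd (Fin.cons t ψ) 0
    · have hint' : Integrable (fun t : ℝ => ∑ j : Fin D,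
          ∫ ψ, F' j.succ (Fin.cons t ψ) ^ 2 ∂phaseMeasure D) phaseUnif :=
        integrable_finsetSum _ fun j _ =>
          (hint (continuous_sq_comp (hF' j.succ))).integral_prod_left
      have hsum : ∑ j : Fin D, ∫ p, F' j.succ (Fin.cons p.1 p.2) ^ 2
            ∂(phaseUnif.prod (phaseMeasure D)) =
          ∫ t, ∑ j : Fin D, ∫ ψ, F' j.succ (Fin.cons t ψ) ^ 2 ∂phaseMeasure D ∂phaseUnif := by
        rw [integral_finsetSum _ fun j _ =>
          (hint (continuous_sq_comp (hF' j.succ))).integral_prod_left]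
        exact Finset.sum_congr rfl fun j _ =>
          integral_prod _ (hint (continuous_sq_comp (hF' j.succ)))
      rw [hsum, ← integral_const_mul]
      refine integral_mono_of_nonneg (ae_of_all _ fun t => ?_) (hint'.const_mul _)
        (ae_of_all _ fun t => ?_)
      · have hc : Continuous fun ψ : Fin D → ℝ => F (Fin.cons t ψ) :=
          hF.comp (hcons.comp (continuous_const.prodMk continuous_id))
        exact sub_nonneg.mpr (sq_integral_le _ hc.integrable_phaseMeasure
          (continuous_sq_comp hc).integrable_phaseMeasure)
      · refine ih (hF.comp (hcons.comp (continuous_const.prodMk continuous_id)))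
          (fun j => (hF' j.succ).comp (hcons.comp (continuous_const.prodMk continuous_id)))
          fun ψ j => ?_
        have := hd (Fin.cons t ψ) j.succ
        simp only [← Fin.cons_update, Fin.cons_succ] at this
        exact this

end Poincare

/-! ### Random phases -/

section Circle

/-- The uniform distribution on the unit circle of `ℂ`. -/
def circleLaw : Measure ℂ := phaseUnif.map fun θ : ℝ => Complex.exp (Complex.I * θ)

lemma continuous_exp_I_mul : Continuous fun θ : ℝ => Complex.exp (Complex.I * θ) := by fun_prop

instance : IsProbabilityMeasure circleLaw :=
  Measure.isProbabilityMeasure_map continuous_exp_I_mul.aemeasurable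

lemma integral_circleLaw {f : ℂ → ℝ} (hf : Continuous f) : ∫ z, f z ∂circleLaw =
    (2 * Real.pi)⁻¹ * ∫ θ in (0 : ℝ)..(2 * Real.pi), f (Complex.exp (Complex.I * θ)) := by
  rw [circleLaw, integral_map continuous_exp_I_mul.aemeasurable hf.aestronglyMeasurable,
    integral_phaseUnif, smul_eq_mul]

/-- The uniform distribution on the circle is invariant under rotations. -/
lemma circleLaw_map_mul (a : ℝ) :
    circleLaw.map (fun z => Complex.exp (Complex.I * a) * z) = circleLaw := by
  have hc : Continuous fun z : ℂ => Complex.exp (Complex.I * a) * z := by fun_prop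
  have := Measure.isProbabilityMeasure_map (μ := circleLaw) hc.aemeasurable
  refine ext_of_forall_integral_eq_of_IsFiniteMeasure fun h => ?_
  rw [integral_map hc.aemeasurable h.continuous.aestronglyMeasurable,
    integral_circleLaw (f := fun z => h (Complex.exp (Complex.I * a) * z))
      (h.continuous.comp hc), integral_circleLaw h.continuous]
  congr 1
  set g : ℝ → ℝ := fun θ => h (Complex.exp (Complex.I * θ)) with hg
  have hper : Function.Periodic g (2 * Real.pi) := by
    intro θ
    simp only [hg]
    congr 1
    push_cast
    rw [mul_add, Complex.exp_add, mul_comm Complex.I (2 * _), Complex.exp_two_pi_mul_I, mul_one]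
  have h1 : ∀ θ : ℝ, h (Complex.exp (Complex.I * a) * Complex.exp (Complex.I * θ)) =
      g (θ + a) := by
    intro θ
    simp only [hg]
    rw [← Complex.exp_add]
    congr 2
    push_cast
    ring
  have h2 := hper.intervalIntegral_add_eq a 0
  simp only [h1]
  rw [intervalIntegral.integral_comp_add_right, zero_add, add_comm (2 * Real.pi) a, h2, zero_add]

lemma circleLaw_map_neg : circleLaw.map (fun z => -z) = circleLaw := by
  have := circleLaw_map_mul Real.pi
  rw [mul_comm Complex.I, Complex.exp_pi_mul_I] at this
  simpa using this

lemma phaseMeasure_map_exp (D : ℕ) :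
    (phaseMeasure D).map (fun φ j => Complex.exp (Complex.I * φ j)) =
      Measure.pi fun _ => circleLaw := by
  rw [phaseMeasure_eq]
  exact (Measure.pi_map_pi fun _ => continuous_exp_I_mul.aemeasurable)

/-- An odd function of the phase factors has mean zero. -/
lemma integral_phaseMeasure_eq_zero_of_odd {D : ℕ} {g : (Fin D → ℂ) → ℝ} (hg : Continuous g)
    (hodd : ∀ ζ, g (-ζ) = -g ζ) :
    ∫ φ, g (fun j => Complex.exp (Complex.I * φ j)) ∂phaseMeasure D = 0 := by
  have hm : Measurable fun (φ : Fin D → ℝ) j => Complex.exp (Complex.I * φ j) := by fun_prop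
  have h1 : ∫ φ, g (fun j => Complex.exp (Complex.I * φ j)) ∂phaseMeasure D =
      ∫ ζ, g ζ ∂(Measure.pi fun _ : Fin D => circleLaw) := by
    rw [← phaseMeasure_map_exp, integral_map hm.aemeasurable hg.aestronglyMeasurable]
  have h2 : (Measure.pi fun _ : Fin D => circleLaw).map (fun ζ => -ζ) =
      Measure.pi fun _ : Fin D => circleLaw := by
    have := Measure.pi_map_pi (μ := fun _ : Fin D => circleLaw) (f := fun _ z => -z)
      fun _ => measurable_neg.aemeasurable
    simp only [circleLaw_map_neg] at this
    exact this
  have h3 : ∫ ζ, g ζ ∂(Measure.pi fun _ : Fin D => circleLaw) =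
      -∫ ζ, g ζ ∂(Measure.pi fun _ : Fin D => circleLaw) := by
    conv_lhs => rw [← h2, integral_map measurable_neg.aemeasurable hg.aestronglyMeasurable]
    simp only [hodd, integral_neg]
  rw [h1]
  linarith

end Circle

/-! ### Variance of functions of a random phase vector -/

section Variance

variable {n ι : Type} [Fintype n] [Fintype ι] {D : ℕ}

/-- `∑ⱼ cⱼ e^{iφⱼ} vⱼ`. -/
def phaseSum (c : Fin D → ℝ) (v : Fin D → Ket n) (φ : Fin D → ℝ) : Ket n :=
  ∑ j, ((c j : ℂ) * Complex.exp (Complex.I * φ j)) • v j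

lemma continuous_phaseSum (c : Fin D → ℝ) (v : Fin D → Ket n) : Continuous (phaseSum c v) := by
  unfold phaseSum
  fun_prop

lemma hasDerivAt_phaseSum (c : Fin D → ℝ) (v : Fin D → Ket n) (φ : Fin D → ℝ) (j : Fin D) :
    HasDerivAt (fun t => phaseSum c v (Function.update φ j t))
      (c j • ((Complex.I * Complex.exp (Complex.I * φ j)) • v j)) (φ j) := by
  have h : ∀ l ∈ Finset.univ, HasDerivAt (fun t : ℝ =>
      ((c l : ℂ) * Complex.exp (Complex.I * (Function.update φ j t l : ℝ))) • v l)
      (if l = j then c j • ((Complex.I * Complex.exp (Complex.I * φ j)) • v j) else 0) (φ j) := by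
    intro l _
    split_ifs with hl
    · subst hl
      simp only [Function.update_self]
      have h1 : HasDerivAt (fun t : ℝ => (t : ℂ)) 1 (φ l) := Complex.ofRealCLM.hasDerivAt
      have h2 := (((h1.const_mul Complex.I).cexp).const_mul (c l : ℂ)).smul_const (v l)
      refine h2.congr_deriv ?_
      rw [← Complex.coe_smul, smul_smul]
      congr 1
      ring
    · simp only [Function.update_of_ne hl]
      exact hasDerivAt_const _ _
  have := HasDerivAt.fun_sum h
  simpa [phaseSum] using this

variable (v : ι → Fin D → Ket n)

/-- Bessel's inequality for the vectors `(v s l)_s`, which are orthonormal by `hv`, and the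
functional `∑ₛ L s`, in its dual form. -/
lemma sum_sq_apply_le (hv : ∀ a : Fin D → ℂ, ∑ s, ‖∑ l, a l • v s l‖ ^ 2 = ∑ l, ‖a l‖ ^ 2)
    (L : ι → Ket n →L[ℝ] ℝ) (u : Fin D → ℂ) (hu : ∀ l, ‖u l‖ = 1) :
    ∑ l, (∑ s, L s (u l • v s l)) ^ 2 ≤ ∑ s, ‖L s‖ ^ 2 := by
  set b : Fin D → ℝ := fun l => ∑ s, L s (u l • v s l) with hb
  set X := ∑ l, b l ^ 2 with hX
  set A := ∑ s, ‖L s‖ ^ 2 with hA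
  set y : ι → Ket n := fun s => ∑ l, ((b l : ℂ) * u l) • v s l with hy
  have hX0 : 0 ≤ X := Finset.sum_nonneg fun _ _ => sq_nonneg _
  have hA0 : 0 ≤ A := Finset.sum_nonneg fun _ _ => sq_nonneg _
  have h1 : X = ∑ s, L s (y s) := by
    have : ∀ s, L s (y s) = ∑ l, b l * L s (u l • v s l) := by
      intro s
      rw [hy, map_sum]
      refine Finset.sum_congr rfl fun l _ => ?_
      rw [mul_smul, Complex.coe_smul, map_smul, smul_eq_mul]
    simp only [this]
    rw [Finset.sum_comm]
    refine Finset.sum_congr rfl fun l _ => ?_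
    rw [← Finset.mul_sum, sq]
  have h2 : ∑ s, ‖y s‖ ^ 2 = X := by
    rw [hy, hv]
    refine Finset.sum_congr rfl fun l _ => ?_
    rw [norm_mul, hu, mul_one, Complex.norm_real, Real.norm_eq_abs, sq_abs]
  have h3 : X ^ 2 ≤ A * X := by
    have h4 : X ≤ ∑ s, ‖L s‖ * ‖y s‖ := by
      rw [h1]
      exact Finset.sum_le_sum fun s _ => (le_abs_self _).trans ((L s).le_opNorm _)
    calc X ^ 2 ≤ (∑ s, ‖L s‖ * ‖y s‖) ^ 2 := pow_le_pow_left₀ hX0 h4 2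
      _ ≤ A * ∑ s, ‖y s‖ ^ 2 := Finset.sum_mul_sq_le_sq_mul_sq _ _ _
      _ = A * X := by rw [h2]
  rcases hX0.eq_or_lt with h | h
  · rw [← h]; exact hA0
  · nlinarith

lemma sum_norm_sq_eq_one
    (hv : ∀ a : Fin D → ℂ, ∑ s, ‖∑ l, a l • v s l‖ ^ 2 = ∑ l, ‖a l‖ ^ 2) (j : Fin D) :
    ∑ s, ‖v s j‖ ^ 2 = 1 := by
  have := hv (Pi.single j 1)
  simpa [Pi.single_apply, ite_smul, apply_ite] using this

/-- A sum of functions of the components `∑ⱼ cⱼ e^{iφⱼ} v_{sj}` of a random phase vector, with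
bounded second derivatives, has variance `O(∑ⱼ cⱼ⁴)`. The Poincaré inequality is used twice:
after the first use, the derivatives are (up to phases) odd, hence centred, and the second use
brings in the matrix of second derivatives in the isometric family `v`, whose rows and columns are
bounded in `ℓ²` by Bessel's inequality. -/
lemma variance_sum_le (c : Fin D → ℝ)
    (hv : ∀ a : Fin D → ℂ, ∑ s, ‖∑ l, a l • v s l‖ ^ 2 = ∑ l, ‖a l‖ ^ 2)
    {f : ι → Ket n → ℝ} (hf : ∀ s, ContDiff ℝ ⊤ (f s)) (hev : ∀ s x, f s (-x) = f s x) {M : ℝ}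
    (hM : ∀ s x, ‖fderiv ℝ (fderiv ℝ (f s)) x‖ ≤ M) :
    ∫ φ, (∑ s, f s (phaseSum c (v s) φ)) ^ 2 ∂phaseMeasure D -
        (∫ φ, ∑ s, f s (phaseSum c (v s) φ) ∂phaseMeasure D) ^ 2 ≤
      2 * (2 * Real.pi) ^ 4 * M ^ 2 * ∑ j, c j ^ 4 := by
  have hd1 : ∀ s x, HasFDerivAt (f s) (fderiv ℝ (f s) x) x := fun s x =>
    ((hf s).differentiable (by simp) x).hasFDerivAt
  have hc2 : ∀ s, ContDiff ℝ ⊤ (fderiv ℝ (f s)) := fun s => (hf s).fderiv_right le_top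
  have hd2 : ∀ s x, HasFDerivAt (fderiv ℝ (f s)) (fderiv ℝ (fderiv ℝ (f s)) x) x := fun s x =>
    ((hc2 s).differentiable (by simp) x).hasFDerivAt
  have hc3 : ∀ s, Continuous (fderiv ℝ (fderiv ℝ (f s))) := fun s =>
    ((hc2 s).fderiv_right (m := 0) le_top).continuous
  have hcf : ∀ s, Continuous (f s) := fun s => (hf s).continuous
  have hcf' : ∀ s, Continuous (fderiv ℝ (f s)) := fun s => (hc2 s).continuous
  have hps : ∀ s, Continuous (phaseSum c (v s)) := fun s => continuous_phaseSum _ _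
  -- `e φ j` is the direction of the `j`-th derivative, `K w j` the derivative along `w vⱼ`.
  set e : (Fin D → ℝ) → Fin D → ℂ := fun φ j => Complex.I * Complex.exp (Complex.I * φ j) with he
  have hen : ∀ φ j, ‖e φ j‖ = 1 := by
    intro φ j
    simp [he, mul_comm Complex.I, Complex.norm_exp_ofReal_mul_I]
  set K : ℂ → Fin D → (Fin D → ℝ) → ℝ := fun w j φ =>
    ∑ s, fderiv ℝ (f s) (phaseSum c (v s) φ) (w • v s j) with hK
  set Hs : ℂ → Fin D → Fin D → (Fin D → ℝ) → ℝ := fun w j l φ =>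
    ∑ s, fderiv ℝ (fderiv ℝ (f s)) (phaseSum c (v s) φ) (e φ l • v s l) (w • v s j) with hH
  have hKc : ∀ w j, Continuous (K w j) := fun w j =>
    continuous_finsetSum _ fun s _ => ((hcf' s).comp (hps s)).clm_apply continuous_const
  have hec : ∀ l, Continuous fun φ => e φ l := fun l => by fun_prop
  have hHc : ∀ w j l, Continuous (Hs w j l) := fun w j l =>
    continuous_finsetSum _ fun s _ => (((hc3 s).comp (hps s)).clm_apply
      ((hec l).smul continuous_const)).clm_apply continuous_const
  have hF : Continuous fun φ => ∑ s, f s (phaseSum c (v s) φ) :=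
    continuous_finsetSum _ fun s _ => (hcf s).comp (hps s)
  -- First use of the Poincaré inequality.
  have hdF : ∀ φ j, HasDerivAt (fun t => ∑ s, f s (phaseSum c (v s) (Function.update φ j t)))
      (c j * K (e φ j) j φ) (φ j) := by
    intro φ j
    have : ∀ s ∈ Finset.univ, HasDerivAt
        (fun t => f s (phaseSum c (v s) (Function.update φ j t)))
        (c j * fderiv ℝ (f s) (phaseSum c (v s) φ) (e φ j • v s j)) (φ j) := by
      intro s _
      have h1 := (hd1 s (phaseSum c (v s) (Function.update φ j (φ j)))).comp_hasDerivAt (φ j)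
        (hasDerivAt_phaseSum c (v s) φ j)
      rw [Function.update_eq_self, map_smul, smul_eq_mul] at h1
      exact h1
    have := HasDerivAt.fun_sum this
    rwa [← Finset.mul_sum] at this
  have hKe : ∀ φ j, K (e φ j) j φ =
      -Real.sin (φ j) * K 1 j φ + Real.cos (φ j) * K Complex.I j φ := by
    intro φ j
    simp only [hK, Finset.mul_sum, ← Finset.sum_add_distrib]
    refine Finset.sum_congr rfl fun s _ => ?_
    have h1 : e φ j • v s j = (-Real.sin (φ j)) • ((1 : ℂ) • v s j) +
        (Real.cos (φ j)) • (Complex.I • v s j) := by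
      rw [← Complex.coe_smul, ← Complex.coe_smul, smul_smul, smul_smul, ← add_smul]
      congr 1
      simp only [he]
      rw [mul_comm Complex.I (φ j : ℂ), Complex.exp_mul_I]
      push_cast
      ring_nf
      rw [Complex.I_sq]
      ring
    rw [h1, map_add, ContinuousLinearMap.map_smul (R₁ := ℝ), ContinuousLinearMap.map_smul (R₁ := ℝ),
      smul_eq_mul, smul_eq_mul]
  have hKe2 : ∀ φ j, (c j * K (e φ j) j φ) ^ 2 ≤ c j ^ 2 * (K 1 j φ ^ 2 + K Complex.I j φ ^ 2) := by
    intro φ j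
    rw [hKe, mul_pow]
    refine mul_le_mul_of_nonneg_left ?_ (sq_nonneg _)
    have := Real.sin_sq_add_cos_sq (φ j)
    have h2 := sq_nonneg (Real.cos (φ j) * K 1 j φ + Real.sin (φ j) * K Complex.I j φ)
    have h3 : (-Real.sin (φ j) * K 1 j φ + Real.cos (φ j) * K Complex.I j φ) ^ 2 +
        (Real.cos (φ j) * K 1 j φ + Real.sin (φ j) * K Complex.I j φ) ^ 2 =
        (Real.sin (φ j) ^ 2 + Real.cos (φ j) ^ 2) * (K 1 j φ ^ 2 + K Complex.I j φ ^ 2) := by ring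
    rw [this, one_mul] at h3
    linarith
  have hdc : ∀ j, Continuous fun φ => c j * K (e φ j) j φ := by
    intro j
    simp only [hKe]
    have := hKc 1 j
    have := hKc Complex.I j
    fun_prop
  have hP1 := poincare_phaseMeasure D hF hdc hdF
  -- Second use of the Poincaré inequality.
  have hK0 : ∀ w j, ∫ φ, K w j φ ∂phaseMeasure D = 0 := by
    intro w j
    set g : (Fin D → ℂ) → ℝ := fun ζ =>
      ∑ s, fderiv ℝ (f s) (∑ j, ((c j : ℂ) * ζ j) • v s j) (w • v s j) with hg
    refine integral_phaseMeasure_eq_zero_of_odd (g := g) ?_ fun ζ => ?_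
    · refine continuous_finsetSum _ fun s _ => ((hcf' s).comp ?_).clm_apply continuous_const
      fun_prop
    · simp only [hg, ← Finset.sum_neg_distrib]
      refine Finset.sum_congr rfl fun s _ => ?_
      have h1 : ∑ j, ((c j : ℂ) * (-ζ) j) • v s j = -∑ j, ((c j : ℂ) * ζ j) • v s j := by
        simp [Finset.sum_neg_distrib]
      set x := ∑ j, ((c j : ℂ) * ζ j) • v s j
      have h3 := (hd1 s (- -x)).comp (-x) (hasFDerivAt_id (-x)).neg
      have h4 : (f s ∘ fun x => -x) = f s := funext fun x => hev s x
      rw [h1]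
      have h5 : HasFDerivAt (f s ∘ fun x => -x) _ (-x) := h3
      rw [h4] at h5
      rw [h5.fderiv]
      simp
  have hP2 : ∀ w j, ∫ φ, K w j φ ^ 2 ∂phaseMeasure D ≤
      (2 * Real.pi) ^ 2 * ∑ l, ∫ φ, (c l * Hs w j l φ) ^ 2 ∂phaseMeasure D := by
    intro w j
    have h := poincare_phaseMeasure D (hKc w j) (F' := fun l φ => c l * Hs w j l φ)
      (fun l => continuous_const.mul (hHc w j l)) ?_
    · rw [hK0, zero_pow two_ne_zero, sub_zero] at h
      exact h
    · intro φ l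
      have : ∀ s ∈ Finset.univ, HasDerivAt
          (fun t => fderiv ℝ (f s) (phaseSum c (v s) (Function.update φ l t)) (w • v s j))
          (c l * fderiv ℝ (fderiv ℝ (f s)) (phaseSum c (v s) φ) (e φ l • v s l) (w • v s j))
          (φ l) := by
        intro s _
        have h1 := (hd2 s (phaseSum c (v s) (Function.update φ l (φ l)))).comp_hasDerivAt (φ l)
          (hasDerivAt_phaseSum c (v s) φ l)
        rw [Function.update_eq_self, map_smul] at h1
        have h2 := h1.clm_apply (hasDerivAt_const (φ l) (w • v s j))
        simpa using h2
      have := HasDerivAt.fun_sum this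
      rwa [← Finset.mul_sum] at this
  -- Bessel's inequality for the rows and the columns of the matrix of second derivatives.
  have hM0 : ∀ s x, 0 ≤ M := fun s x => (norm_nonneg (fderiv ℝ (fderiv ℝ (f s)) x)).trans (hM s x)
  have hrow : ∀ w : ℂ, ‖w‖ = 1 → ∀ φ j, ∑ l, Hs w j l φ ^ 2 ≤ M ^ 2 := by
    intro w hw φ j
    refine (sum_sq_apply_le v hv (fun s => (fderiv ℝ (fderiv ℝ (f s))
      (phaseSum c (v s) φ)).flip (w • v s j)) (e φ) (hen φ)).trans ?_
    have : M ^ 2 = ∑ s, (M * ‖v s j‖) ^ 2 := by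
      simp only [mul_pow, ← Finset.mul_sum, sum_norm_sq_eq_one v hv j, mul_one]
    rw [this]
    refine Finset.sum_le_sum fun s _ => pow_le_pow_left₀ (norm_nonneg _) ?_ 2
    refine (ContinuousLinearMap.le_opNorm _ _).trans ?_
    rw [ContinuousLinearMap.opNorm_flip, norm_smul, hw, one_mul]
    exact mul_le_mul_of_nonneg_right (hM s _) (norm_nonneg _)
  have hcol : ∀ w : ℂ, ‖w‖ = 1 → ∀ φ l, ∑ j, Hs w j l φ ^ 2 ≤ M ^ 2 := by
    intro w hw φ l
    refine (sum_sq_apply_le v hv (fun s => fderiv ℝ (fderiv ℝ (f s))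
      (phaseSum c (v s) φ) (e φ l • v s l)) (fun _ => w) (fun _ => hw)).trans ?_
    have : M ^ 2 = ∑ s, (M * ‖v s l‖) ^ 2 := by
      simp only [mul_pow, ← Finset.mul_sum, sum_norm_sq_eq_one v hv l, mul_one]
    rw [this]
    refine Finset.sum_le_sum fun s _ => pow_le_pow_left₀ (norm_nonneg _) ?_ 2
    refine (ContinuousLinearMap.le_opNorm _ _).trans ?_
    rw [norm_smul, hen, one_mul]
    exact mul_le_mul_of_nonneg_right (hM s _) (norm_nonneg _)
  have hptw : ∀ w : ℂ, ‖w‖ = 1 → ∀ φ,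
      ∑ j, c j ^ 2 * ∑ l, (c l * Hs w j l φ) ^ 2 ≤ M ^ 2 * ∑ j, c j ^ 4 := by
    intro w hw φ
    have h1 : ∑ j, c j ^ 2 * ∑ l, (c l * Hs w j l φ) ^ 2 ≤
        ∑ j, ∑ l, (c j ^ 4 * Hs w j l φ ^ 2 / 2 + c l ^ 4 * Hs w j l φ ^ 2 / 2) := by
      refine Finset.sum_le_sum fun j _ => ?_
      rw [Finset.mul_sum]
      refine Finset.sum_le_sum fun l _ => ?_
      nlinarith [mul_nonneg (sq_nonneg (c j ^ 2 - c l ^ 2)) (sq_nonneg (Hs w j l φ))]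
    refine h1.trans ?_
    simp only [Finset.sum_add_distrib]
    have h2 : ∑ j, ∑ l, c j ^ 4 * Hs w j l φ ^ 2 / 2 ≤ M ^ 2 * (∑ j, c j ^ 4) / 2 := by
      rw [Finset.mul_sum, Finset.sum_div]
      refine Finset.sum_le_sum fun j _ => ?_
      rw [← Finset.sum_div, ← Finset.mul_sum, mul_comm]
      have := mul_le_mul_of_nonneg_right (hrow w hw φ j) (by positivity : 0 ≤ c j ^ 4)
      linarith
    have h3 : ∑ j, ∑ l, c l ^ 4 * Hs w j l φ ^ 2 / 2 ≤ M ^ 2 * (∑ j, c j ^ 4) / 2 := by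
      rw [Finset.sum_comm, Finset.mul_sum, Finset.sum_div]
      refine Finset.sum_le_sum fun l _ => ?_
      rw [← Finset.sum_div, ← Finset.mul_sum, mul_comm]
      have := mul_le_mul_of_nonneg_right (hcol w hw φ l) (by positivity : 0 ≤ c l ^ 4)
      linarith
    linarith
  have hw : ∀ w : ℂ, ‖w‖ = 1 → ∑ j, c j ^ 2 * ∫ φ, K w j φ ^ 2 ∂phaseMeasure D ≤
      (2 * Real.pi) ^ 2 * (M ^ 2 * ∑ j, c j ^ 4) := by
    intro w hw
    have hi : ∀ j l, Integrable (fun φ => (c l * Hs w j l φ) ^ 2) (phaseMeasure D) := fun j l =>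
      (continuous_sq_comp (continuous_const.mul (hHc w j l))).integrable_phaseMeasure
    calc ∑ j, c j ^ 2 * ∫ φ, K w j φ ^ 2 ∂phaseMeasure D
        ≤ ∑ j, c j ^ 2 * ((2 * Real.pi) ^ 2 *
            ∑ l, ∫ φ, (c l * Hs w j l φ) ^ 2 ∂phaseMeasure D) :=
          Finset.sum_le_sum fun j _ => mul_le_mul_of_nonneg_left (hP2 w j) (sq_nonneg _)
      _ = (2 * Real.pi) ^ 2 * ∫ φ, ∑ j, c j ^ 2 * ∑ l, (c l * Hs w j l φ) ^ 2 ∂phaseMeasure D := by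
          rw [integral_finsetSum _ fun j _ =>
            (integrable_finsetSum _ fun l _ => hi j l).const_mul _, Finset.mul_sum]
          refine Finset.sum_congr rfl fun j _ => ?_
          rw [integral_const_mul, integral_finsetSum _ fun l _ => hi j l]
          ring
      _ ≤ (2 * Real.pi) ^ 2 * ∫ _φ, M ^ 2 * ∑ j, c j ^ 4 ∂phaseMeasure D := by
          refine mul_le_mul_of_nonneg_left (integral_mono ?_ (integrable_const _) (hptw w hw))
            (by positivity)
          exact integrable_finsetSum _ fun j _ =>
            (integrable_finsetSum _ fun l _ => hi j l).const_mul _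
      _ = _ := by simp
  refine hP1.trans ?_
  have hKi : ∀ w j, Integrable (fun φ => K w j φ ^ 2) (phaseMeasure D) := fun w j =>
    (continuous_sq_comp (hKc w j)).integrable_phaseMeasure
  have hsum : ∑ j, ∫ φ, (c j * K (e φ j) j φ) ^ 2 ∂phaseMeasure D ≤
      ∑ j, c j ^ 2 * ∫ φ, K 1 j φ ^ 2 ∂phaseMeasure D +
      ∑ j, c j ^ 2 * ∫ φ, K Complex.I j φ ^ 2 ∂phaseMeasure D := by
    rw [← Finset.sum_add_distrib]
    refine Finset.sum_le_sum fun j _ => ?_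
    rw [← mul_add, ← integral_add (hKi _ _) (hKi _ _), ← integral_const_mul]
    exact integral_mono (continuous_sq_comp (hdc j)).integrable_phaseMeasure
      (((hKi 1 j).add (hKi Complex.I j)).const_mul _) fun φ => hKe2 φ j
  have h1 := hw 1 (by simp)
  have h2 := hw Complex.I (by simp)
  calc (2 * Real.pi) ^ 2 * ∑ j, ∫ φ, (c j * K (e φ j) j φ) ^ 2 ∂phaseMeasure D
      ≤ (2 * Real.pi) ^ 2 * (2 * ((2 * Real.pi) ^ 2 * (M ^ 2 * ∑ j, c j ^ 4))) :=
        mul_le_mul_of_nonneg_left (by linarith) (by positivity)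
    _ = _ := by ring

end Variance

/-! ### Lindeberg's replacement argument -/

section Lindeberg

/-- A symmetric distribution on `ℂ` with finite fourth moment and the second moments of a
standard complex Gaussian variable: `E ζ² = 0`, `E |ζ|² = 1`. -/
structure IsStdSymm (μ : Measure ℂ) : Prop where
  prob : IsProbabilityMeasure μ
  neg : μ.map (fun z => -z) = μ
  memLp : MemLp (fun z : ℂ => z) 4 μ
  re_sq : ∫ z, z.re ^ 2 ∂μ = 1 / 2
  im_sq : ∫ z, z.im ^ 2 ∂μ = 1 / 2
  re_im : ∫ z, z.re * z.im ∂μ = 0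

lemma IsStdSymm.memLp_two {μ : Measure ℂ} (h : IsStdSymm μ) : MemLp (fun z : ℂ => z) 2 μ :=
  have := h.prob
  h.memLp.mono_exponent (by norm_num)

lemma IsStdSymm.integrable_norm_pow {μ : Measure ℂ} (h : IsStdSymm μ) :
    Integrable (fun z : ℂ => ‖z‖ ^ 4) μ := by
  have := h.memLp.integrable_norm_pow (p := 4) (by norm_num)
  simpa using this

variable {n : Type} [Fintype n]

lemma integrable_comp_of_quadratic {Ω : Type*} [MeasurableSpace Ω] {P : Measure Ω}
    [IsProbabilityMeasure P] {f : Ket n → ℝ} (hf : Continuous f) {C : ℝ}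
    (hC : ∀ x, |f x| ≤ C * (1 + ‖x‖) ^ 2) {X : Ω → Ket n} (hX : MemLp X 2 P) :
    Integrable (fun ω => f (X ω)) P := by
  have h1 : MemLp (fun ω => 1 + ‖X ω‖) 2 P := (memLp_const (1 : ℝ)).add hX.norm
  exact Integrable.mono' (h1.integrable_sq.const_mul C)
    (hf.comp_aestronglyMeasurable hX.1) (ae_of_all _ fun ω => hC _)

lemma memLp_sum_smul {D : ℕ} {μ : Measure ℂ} (hμ : IsStdSymm μ) (x : Ket n) (v : Fin D → Ket n) :
    MemLp (fun ζ : Fin D → ℂ => x + ∑ j, ζ j • v j) 2 (Measure.pi fun _ => μ) := by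
  have := hμ.prob
  refine (memLp_const x).add ?_
  refine memLp_finsetSum _ fun j _ => ?_
  have h1 : MemLp (fun ζ : Fin D → ℂ => ζ j) 2 (Measure.pi fun _ => μ) :=
    hμ.memLp_two.comp_measurePreserving (measurePreserving_eval (fun _ : Fin D => μ) j)
  exact (ContinuousLinearMap.toSpanSingleton ℂ (v j)).comp_memLp' h1

/-- Second-order Taylor expansion of `E f (x + ζ v)`; only the second moments of `ζ` enter. -/
lemma abs_integral_taylor_le {μ : Measure ℂ} (hμ : IsStdSymm μ) {f : Ket n → ℝ}
    (hf : Continuous f) {C : ℝ} (hC : ∀ x, |f x| ≤ C * (1 + ‖x‖) ^ 2)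
    (B : Ket n →L[ℝ] Ket n →L[ℝ] ℝ) (x v : Ket n)
    (hT : ∀ u, |f (x + u) + f (x - u) - 2 * f x - B u u| ≤ C * ‖u‖ ^ 4) :
    |∫ z, f (x + z • v) ∂μ -
        (f x + (B v v + B (Complex.I • v) (Complex.I • v)) / 4)| ≤
      C * ‖v‖ ^ 4 * ∫ z, ‖z‖ ^ 4 ∂μ := by
  have := hμ.prob
  have hmem : MemLp (fun z : ℂ => x + z • v) 2 μ := (memLp_const x).add
    ((ContinuousLinearMap.toSpanSingleton ℂ v).comp_memLp' hμ.memLp_two)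
  have hmem' : MemLp (fun z : ℂ => x - z • v) 2 μ := (memLp_const x).sub
    ((ContinuousLinearMap.toSpanSingleton ℂ v).comp_memLp' hμ.memLp_two)
  have hi := integrable_comp_of_quadratic hf hC hmem
  have hi' := integrable_comp_of_quadratic hf hC hmem'
  have hsymm : ∫ z, f (x - z • v) ∂μ = ∫ z, f (x + z • v) ∂μ := by
    conv_lhs => rw [← hμ.neg]
    rw [integral_map measurable_neg.aemeasurable]
    · simp
    · exact (by fun_prop : Continuous fun z : ℂ => f (x - z • v)).aestronglyMeasurable
  have hre2 : Integrable (fun z : ℂ => z.re ^ 2) μ :=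
    (Complex.reCLM.comp_memLp' hμ.memLp_two).integrable_sq
  have him2 : Integrable (fun z : ℂ => z.im ^ 2) μ :=
    (Complex.imCLM.comp_memLp' hμ.memLp_two).integrable_sq
  have hreim : Integrable (fun z : ℂ => z.re * z.im) μ :=
    (Complex.reCLM.comp_memLp' hμ.memLp_two).integrable_mul
      (Complex.imCLM.comp_memLp' hμ.memLp_two)
  have hB : ∀ z : ℂ, B (z • v) (z • v) = z.re ^ 2 * B v v +
      z.im ^ 2 * B (Complex.I • v) (Complex.I • v) +
      z.re * z.im * (B v (Complex.I • v) + B (Complex.I • v) v) := by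
    intro z
    have : z • v = z.re • v + z.im • (Complex.I • v) := by
      conv_lhs => rw [← Complex.re_add_im z]
      rw [add_smul, mul_smul, Complex.coe_smul, Complex.coe_smul]
    rw [this]
    simp only [map_add, ContinuousLinearMap.map_smul (R₁ := ℝ), add_apply, smul_apply, smul_eq_mul]
    ring
  have hBi : Integrable (fun z : ℂ => B (z • v) (z • v)) μ := by
    rw [funext hB]
    exact ((hre2.mul_const _).add (him2.mul_const _)).add (hreim.mul_const _)
  have hBint : ∫ z, B (z • v) (z • v) ∂μ =
      (B v v + B (Complex.I • v) (Complex.I • v)) / 2 := by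
    have h1 : Integrable (fun z : ℂ => z.re ^ 2 * B v v +
        z.im ^ 2 * B (Complex.I • v) (Complex.I • v)) μ :=
      (hre2.mul_const _).add (him2.mul_const _)
    rw [integral_congr_ae (ae_of_all _ hB), integral_add h1 (hreim.mul_const _),
      integral_add (hre2.mul_const _) (him2.mul_const _), integral_mul_const, integral_mul_const,
      integral_mul_const, hμ.re_sq, hμ.im_sq, hμ.re_im]
    ring
  have hI : ∫ z, (f (x + z • v) + f (x - z • v) - 2 * f x - B (z • v) (z • v)) ∂μ =
      2 * (∫ z, f (x + z • v) ∂μ - (f x + (B v v + B (Complex.I • v) (Complex.I • v)) / 4)) := by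
    have h1 : Integrable (fun z => f (x + z • v) + f (x - z • v)) μ := hi.add hi'
    have h2 : Integrable (fun z => f (x + z • v) + f (x - z • v) - 2 * f x) μ :=
      h1.sub (integrable_const _)
    rw [integral_sub h2 hBi, integral_sub h1 (integrable_const _), integral_add hi hi', hsymm,
      hBint]
    simp
    ring
  have hle : |∫ z, (f (x + z • v) + f (x - z • v) - 2 * f x - B (z • v) (z • v)) ∂μ| ≤
      C * ‖v‖ ^ 4 * ∫ z, ‖z‖ ^ 4 ∂μ := by
    rw [← integral_const_mul]
    have h1 : ∀ z : ℂ, ‖f (x + z • v) + f (x - z • v) - 2 * f x - B (z • v) (z • v)‖ ≤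
        C * ‖v‖ ^ 4 * ‖z‖ ^ 4 := by
      intro z
      refine (hT (z • v)).trans_eq ?_
      rw [norm_smul]
      ring
    exact norm_integral_le_of_norm_le (hμ.integrable_norm_pow.const_mul _) (ae_of_all _ h1)
  rw [hI, abs_mul, abs_two] at hle
  linarith [abs_nonneg (∫ z, f (x + z • v) ∂μ -
    (f x + (B v v + B (Complex.I • v) (Complex.I • v)) / 4))]

/-- Lindeberg's replacement argument: exchanging one standardized symmetric distribution for
another in `f (x + ∑ⱼ ζⱼ vⱼ)` costs `O(∑ⱼ ‖vⱼ‖⁴)`, as the moments up to order three agree. -/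
lemma lindeberg {μ ν : Measure ℂ} (hμ : IsStdSymm μ) (hν : IsStdSymm ν) {f : Ket n → ℝ}
    (hf : Continuous f) {C : ℝ} (hC : ∀ x, |f x| ≤ C * (1 + ‖x‖) ^ 2)
    (B : Ket n → Ket n →L[ℝ] Ket n →L[ℝ] ℝ)
    (hT : ∀ x u, |f (x + u) + f (x - u) - 2 * f x - B x u u| ≤ C * ‖u‖ ^ 4)
    {D : ℕ} (v : Fin D → Ket n) (x : Ket n) :
    |∫ ζ, f (x + ∑ j, ζ j • v j) ∂(Measure.pi fun _ : Fin D => μ) -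
        ∫ ζ, f (x + ∑ j, ζ j • v j) ∂(Measure.pi fun _ : Fin D => ν)| ≤
      C * (∫ z, ‖z‖ ^ 4 ∂μ + ∫ z, ‖z‖ ^ 4 ∂ν) * ∑ j, ‖v j‖ ^ 4 := by
  have := hμ.prob
  have := hν.prob
  induction D generalizing x with
  | zero => simp
  | succ D ih =>
    have hsucc : ∀ {ρ : Measure ℂ}, IsStdSymm ρ →
        ∫ ζ, f (x + ∑ j, ζ j • v j) ∂(Measure.pi fun _ : Fin (D + 1) => ρ) =
        ∫ p, f (x + p.1 • v 0 + ∑ j : Fin D, p.2 j • v j.succ)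
          ∂(ρ.prod (Measure.pi fun _ : Fin D => ρ)) := by
      intro ρ hρ
      have := hρ.prob
      have h := (measurePreserving_piFinSuccAbove (fun _ : Fin (D + 1) => ρ) 0).symm
      rw [← h.integral_comp']
      simp only [piFinSuccAbove_symm_eq_cons, Fin.sum_univ_succ, Fin.cons_zero, Fin.cons_succ,
        add_assoc]
    have hint : ∀ {ρ ρ' : Measure ℂ}, IsStdSymm ρ → IsStdSymm ρ' →
        Integrable (fun p : ℂ × (Fin D → ℂ) => f (x + p.1 • v 0 + ∑ j : Fin D, p.2 j • v j.succ))
          (ρ.prod (Measure.pi fun _ : Fin D => ρ')) := by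
      intro ρ ρ' hρ hρ'
      have := hρ.prob
      have := hρ'.prob
      refine integrable_comp_of_quadratic hf hC (MemLp.add ?_ ?_)
      · exact (memLp_const x).add ((ContinuousLinearMap.toSpanSingleton ℂ (v 0)).comp_memLp'
          (hρ.memLp_two.comp_measurePreserving measurePreserving_fst))
      · have := (memLp_sum_smul hρ' 0 fun j : Fin D => v j.succ).comp_measurePreserving
          (measurePreserving_snd (μ := ρ))
        simpa [Function.comp_def] using this
    set A := ∫ z, ‖z‖ ^ 4 ∂μ + ∫ z, ‖z‖ ^ 4 ∂ν with hA
    rw [hsucc hμ, hsucc hν, Fin.sum_univ_succ, mul_add]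
    have h1 : |∫ p, f (x + p.1 • v 0 + ∑ j : Fin D, p.2 j • v j.succ)
          ∂(μ.prod (Measure.pi fun _ : Fin D => μ)) -
        ∫ p, f (x + p.1 • v 0 + ∑ j : Fin D, p.2 j • v j.succ)
          ∂(μ.prod (Measure.pi fun _ : Fin D => ν))| ≤
        C * A * ∑ j : Fin D, ‖v j.succ‖ ^ 4 := by
      rw [integral_prod _ (hint hμ hμ), integral_prod _ (hint hμ hν),
        ← integral_sub (hint hμ hμ).integral_prod_left (hint hμ hν).integral_prod_left]
      have := norm_integral_le_of_norm_le_const (μ := μ) (ae_of_all _ fun z : ℂ =>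
        (Real.norm_eq_abs _).trans_le (ih (fun j => v j.succ) (x + z • v 0)))
      simpa using this
    have h2 : |∫ p, f (x + p.1 • v 0 + ∑ j : Fin D, p.2 j • v j.succ)
          ∂(μ.prod (Measure.pi fun _ : Fin D => ν)) -
        ∫ p, f (x + p.1 • v 0 + ∑ j : Fin D, p.2 j • v j.succ)
          ∂(ν.prod (Measure.pi fun _ : Fin D => ν))| ≤ C * A * ‖v 0‖ ^ 4 := by
      rw [integral_prod_symm _ (hint hμ hν), integral_prod_symm _ (hint hν hν),
        ← integral_sub (hint hμ hν).integral_prod_right (hint hν hν).integral_prod_right]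
      have hone : ∀ y, |∫ z, f (y + z • v 0) ∂μ - ∫ z, f (y + z • v 0) ∂ν| ≤
          C * A * ‖v 0‖ ^ 4 := by
        intro y
        have e1 := abs_integral_taylor_le hμ hf hC (B y) y (v 0) (hT y)
        have e2 := abs_integral_taylor_le hν hf hC (B y) y (v 0) (hT y)
        rw [abs_sub_comm] at e2
        refine (abs_sub_le _ _ _).trans ((add_le_add e1 e2).trans_eq ?_)
        rw [hA]
        ring
      have := norm_integral_le_of_norm_le_const (μ := Measure.pi fun _ : Fin D => ν)
        (ae_of_all _ fun ζ : Fin D → ℂ => (Real.norm_eq_abs _).trans_le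
          (hone (x + ∑ j : Fin D, ζ j • v j.succ)))
      simpa [add_right_comm] using this
    refine (abs_sub_le _ _ _).trans ((add_le_add h1 h2).trans_eq (add_comm _ _))

end Lindeberg

/-! ### The standardized distributions: random phases and complex Gaussians -/

section StdSymm

/-- A distribution on `ℂ` that is invariant under multiplication by `i` has the second moments
of a standard complex Gaussian variable as soon as `E |ζ|² = 1`. -/
lemma IsStdSymm.of_map_I_mul {μ : Measure ℂ} [IsProbabilityMeasure μ]
    (hI : μ.map (fun z => Complex.I * z) = μ) (hm : MemLp (fun z : ℂ => z) 4 μ)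
    (h2 : ∫ z, ‖z‖ ^ 2 ∂μ = 1) : IsStdSymm μ := by
  have hm2 : MemLp (fun z : ℂ => z) 2 μ := hm.mono_exponent (by norm_num)
  have hre2 : Integrable (fun z : ℂ => z.re ^ 2) μ :=
    (Complex.reCLM.comp_memLp' hm2).integrable_sq
  have him2 : Integrable (fun z : ℂ => z.im ^ 2) μ :=
    (Complex.imCLM.comp_memLp' hm2).integrable_sq
  have hmeas : Measurable fun z : ℂ => Complex.I * z := by fun_prop
  have hrot : ∀ {g : ℂ → ℝ}, Continuous g → ∫ z, g z ∂μ = ∫ z, g (Complex.I * z) ∂μ := by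
    intro g hg
    conv_lhs => rw [← hI]
    rw [integral_map hmeas.aemeasurable hg.aestronglyMeasurable]
  have h3 : ∫ z : ℂ, z.re ^ 2 ∂μ = ∫ z : ℂ, z.im ^ 2 ∂μ := by
    rw [hrot (g := fun z : ℂ => z.re ^ 2) (by fun_prop)]
    simp
  have h4 : ∫ z : ℂ, z.re * z.im ∂μ = -∫ z : ℂ, z.re * z.im ∂μ := by
    rw [← integral_neg]
    conv_lhs => rw [hrot (g := fun z : ℂ => z.re * z.im) (by fun_prop)]
    refine integral_congr_ae (ae_of_all _ fun z => ?_)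
    simp
    ring
  have h5 : ∫ z : ℂ, z.re ^ 2 ∂μ + ∫ z : ℂ, z.im ^ 2 ∂μ = 1 := by
    rw [← integral_add hre2 him2, ← h2]
    refine integral_congr_ae (ae_of_all _ fun z => ?_)
    simp only
    rw [← Complex.normSq_eq_norm_sq, Complex.normSq_apply]
    ring
  refine ⟨inferInstance, ?_, hm, by linarith, by linarith, by linarith⟩
  conv_rhs => rw [← hI, ← hI]
  rw [Measure.map_map hmeas hmeas]
  congr 1
  ext z
  simp [← mul_assoc]

lemma ae_circleLaw : ∀ᵐ z ∂circleLaw, ‖z‖ = 1 := by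
  rw [circleLaw, ae_map_iff continuous_exp_I_mul.aemeasurable
    (measurableSet_eq_fun (by fun_prop) (by fun_prop))]
  refine ae_of_all _ fun θ => ?_
  rw [mul_comm, Complex.norm_exp_ofReal_mul_I]

lemma isStdSymm_circleLaw : IsStdSymm circleLaw := by
  refine IsStdSymm.of_map_I_mul ?_ ?_ ?_
  · have := circleLaw_map_mul (Real.pi / 2)
    have h : Complex.exp (Complex.I * (Real.pi / 2 : ℝ)) = Complex.I := by
      rw [mul_comm]; push_cast; exact Complex.exp_pi_div_two_mul_I
    rwa [h] at this
  · exact MemLp.of_bound (by fun_prop) 1 (ae_circleLaw.mono fun z hz => hz.le)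
  · rw [integral_congr_ae (g := fun _ => (1 : ℝ)) (ae_circleLaw.mono fun z hz => by simp [hz])]
    simp

open ProbabilityTheory in
/-- The standard complex Gaussian distribution, `E |ζ|² = 1`. -/
def gaussC : Measure ℂ := (stdGaussian ℂ).map fun z => (√2)⁻¹ • z

instance : IsProbabilityMeasure gaussC :=
  Measure.isProbabilityMeasure_map (by fun_prop)

open ProbabilityTheory in
lemma charFun_gaussC (t : ℂ) : charFun gaussC t = Complex.exp (-‖t‖ ^ 2 / 4) := by
  rw [gaussC, charFun_map_smul, charFun_stdGaussian, norm_smul, Real.norm_of_nonneg (by positivity)]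
  congr 1
  push_cast
  rw [mul_pow, inv_pow]
  have : ((√2 : ℝ) : ℂ) ^ 2 = 2 := by
    norm_cast
    exact Real.sq_sqrt (by norm_num)
  rw [this]
  ring

open ProbabilityTheory in
lemma isStdSymm_gaussC : IsStdSymm gaussC := by
  have hmeas : Measurable fun z : ℂ => (√2)⁻¹ • z := by fun_prop
  refine IsStdSymm.of_map_I_mul ?_ ?_ ?_
  · refine Measure.ext_of_charFun ?_
    ext t
    have h : (fun z : ℂ => Complex.I * z) = (Complex.I • · : ℂ → ℂ) := rfl
    have : charFun (gaussC.map fun z => Complex.I * z) t = charFun gaussC (-Complex.I * t) := by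
      rw [charFun_apply, integral_map (by fun_prop) (by fun_prop), charFun_apply]
      refine integral_congr_ae (ae_of_all _ fun z => ?_)
      simp only [Complex.inner]
      congr 4
      simp
      ring
    rw [this, charFun_gaussC, charFun_gaussC]
    simp
  · rw [gaussC, memLp_map_measure_iff (by fun_prop) hmeas.aemeasurable]
    exact (IsGaussian.memLp_id (stdGaussian ℂ) 4 (by norm_num)).const_smul (√2)⁻¹
  · have hvar : ∀ L : StrongDual ℝ ℂ, ∫ z, L z ^ 2 ∂(stdGaussian ℂ) = ‖L‖ ^ 2 := by
      intro L
      rw [← variance_dual_stdGaussian, variance_of_integral_eq_zero (by fun_prop)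
        (integral_strongDual_stdGaussian L)]
    have hL : ∀ L : StrongDual ℝ ℂ, Integrable (fun z => L z ^ 2) (stdGaussian ℂ) := fun L =>
      (L.comp_memLp' (IsGaussian.memLp_id (stdGaussian ℂ) 2 (by norm_num))).integrable_sq
    rw [gaussC, integral_map hmeas.aemeasurable (by fun_prop)]
    have h1 : ∀ z : ℂ, ‖(√2)⁻¹ • z‖ ^ 2 =
        (1 / 2) * (Complex.reCLM z ^ 2 + Complex.imCLM z ^ 2) := by
      intro z
      rw [norm_smul, mul_pow, Real.norm_of_nonneg (by positivity), inv_pow,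
        Real.sq_sqrt (by norm_num), ← Complex.normSq_eq_norm_sq, Complex.normSq_apply]
      simp only [Complex.reCLM_apply, Complex.imCLM_apply]
      ring
    simp only [h1]
    rw [integral_const_mul, integral_add (hL _) (hL _), hvar, hvar, Complex.reCLM_norm,
      Complex.imCLM_norm]
    norm_num

end StdSymm

/-! ### Gaussian vectors -/

section GaussianVector

variable {n : Type} [Fintype n]

lemma real_inner_ket (x y : Ket n) : inner ℝ x y = (inner ℂ x y).re := by
  simp [PiLp.inner_apply, Complex.inner]

lemma charFun_sum_gaussC {D : ℕ} (u : Fin D → Ket n) (t : Ket n) :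
    charFun ((Measure.pi fun _ : Fin D => gaussC).map fun ζ => ∑ j, ζ j • u j) t =
      Complex.exp (-((∑ j, ‖inner ℂ (u j) t‖ ^ 2 : ℝ) : ℂ) / 4) := by
  have hc : Continuous fun ζ : Fin D → ℂ => ∑ j, ζ j • u j := by fun_prop
  rw [charFun_apply, integral_map hc.aemeasurable (by fun_prop)]
  have h1 : ∀ ζ : Fin D → ℂ, Complex.exp ((inner ℝ (∑ j, ζ j • u j) t : ℝ) * Complex.I) =
      ∏ j, Complex.exp ((inner ℝ (ζ j) (inner ℂ (u j) t : ℂ) : ℝ) * Complex.I) := by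
    intro ζ
    rw [← Complex.exp_sum, ← Finset.sum_mul]
    congr 2
    rw [← Complex.ofReal_sum]
    congr 1
    rw [sum_inner]
    refine Finset.sum_congr rfl fun j _ => ?_
    rw [real_inner_ket, inner_smul_left, Complex.inner, mul_comm]
  simp only [h1]
  rw [integral_fintype_prod_eq_prod (f := fun j (z : ℂ) =>
    Complex.exp ((inner ℝ z (inner ℂ (u j) t : ℂ) : ℝ) * Complex.I))]
  simp only [← charFun_apply, charFun_gaussC]
  rw [← Complex.exp_sum]
  congr 1
  push_cast
  rw [← Finset.sum_div, Finset.sum_neg_distrib]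

/-- The standard complex Gaussian distribution on `ℂᵈ`, with density `π^{-d} e^{-‖x‖²}`. -/
def gaussKet (d : ℕ) : Measure (Ket (Fin d)) :=
  volume.withDensity fun x => ENNReal.ofReal ((Real.pi ^ d)⁻¹ * Real.exp (-‖x‖ ^ 2))

lemma finrank_ket (d : ℕ) : Module.finrank ℝ (Ket (Fin d)) = 2 * d := by
  have := Module.finrank_mul_finrank ℝ ℂ (Ket (Fin d))
  rw [Complex.finrank_real_complex, finrank_euclideanSpace_fin] at this
  exact this.symm

lemma integrable_gaussDensity (d : ℕ) :
    Integrable fun x : Ket (Fin d) => (Real.pi ^ d)⁻¹ * Real.exp (-‖x‖ ^ 2) := by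
  have h := (GaussianFourier.integrable_cexp_neg_mul_sq_norm_add (b := 1) (V := Ket (Fin d))
    (by simp) 0 0).norm
  refine Integrable.const_mul ?_ _
  refine h.congr (ae_of_all _ fun x => ?_)
  simp only [Complex.norm_exp]
  congr 1
  simp [← Complex.ofReal_pow]

instance (d : ℕ) : IsFiniteMeasure (gaussKet d) :=
  isFiniteMeasure_withDensity_ofReal (integrable_gaussDensity d).2

lemma integral_gaussKet {d : ℕ} (f : Ket (Fin d) → ℂ) :
    ∫ x, f x ∂gaussKet d = ∫ x, ((Real.pi ^ d)⁻¹ * Real.exp (-‖x‖ ^ 2)) • f x := by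
  rw [gaussKet, integral_withDensity_eq_integral_toReal_smul (by fun_prop) (by simp)]
  refine integral_congr_ae (ae_of_all _ fun x => ?_)
  simp only
  rw [ENNReal.toReal_ofReal (by positivity)]

lemma charFun_gaussKet (d : ℕ) (t : Ket (Fin d)) :
    charFun (gaussKet d) t = Complex.exp (-((‖t‖ ^ 2 : ℝ) : ℂ) / 4) := by
  rw [charFun_apply, integral_gaussKet]
  have h := GaussianFourier.integral_cexp_neg_mul_sq_norm_add (b := 1) (V := Ket (Fin d))
    (by simp) Complex.I t
  have h1 : ∀ x : Ket (Fin d), ((Real.pi ^ d)⁻¹ * Real.exp (-‖x‖ ^ 2)) •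
      Complex.exp ((inner ℝ x t : ℝ) * Complex.I) = ((Real.pi : ℂ) ^ d)⁻¹ *
        Complex.exp (-1 * (‖x‖ : ℂ) ^ 2 + Complex.I * (inner ℝ t x : ℝ)) := by
    intro x
    rw [Complex.exp_add, Complex.real_smul, real_inner_comm]
    push_cast
    rw [mul_comm Complex.I]
    simp [mul_assoc]
  simp only [h1]
  rw [integral_const_mul, h, finrank_ket]
  have h2 : ((Real.pi : ℂ) / 1) ^ (((2 * d : ℕ) : ℂ) / 2) = (Real.pi : ℂ) ^ d := by
    rw [div_one]
    have : (((2 * d : ℕ) : ℂ) / 2) = d := by push_cast; ring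
    rw [this, Complex.cpow_natCast]
  rw [h2, inv_mul_cancel_left₀ (by simp [Real.pi_ne_zero])]
  congr 1
  rw [Complex.I_sq]
  push_cast
  ring

end GaussianVector

/-! ### Gaussian averages as averages over the sphere -/

section Polar

/-- Polar coordinates: the integral of a radial weight times a function that is homogeneous of
degree two factors into a spherical and a radial integral. -/
lemma integral_homogeneous_mul_norm {d : ℕ} [NeZero d] (ρ : ℝ → ℝ) {F : Ket (Fin d) → ℂ}
    (hF : ∀ (r : ℝ) x, 0 < r → F (r • x) = ((r ^ 2 : ℝ) : ℂ) * F x) :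
    ∫ x, ρ ‖x‖ • F x =
      (∫ φ, F φ.1 ∂((volume : Measure (Ket (Fin d))).toSphere)) *
      ∫ r, ((ρ r.1 * r.1 ^ 2 : ℝ) : ℂ)
        ∂(Measure.volumeIoiPow (Module.finrank ℝ (Ket (Fin d)) - 1)) := by
  set μ : Measure (Ket (Fin d)) := volume with hμ
  have : Nontrivial (Ket (Fin d)) := inferInstance
  calc ∫ x, ρ ‖x‖ • F x ∂μ
      = ∫ x : ({(0 : Ket (Fin d))}ᶜ : Set _), ρ ‖x.1‖ • F x.1 ∂(μ.comap (↑)) := by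
        rw [integral_subtype_comap (measurableSet_singleton _).compl fun x => ρ ‖x‖ • F x,
          restrict_compl_singleton]
    _ = ∫ p, F p.1.1 * ((ρ p.2.1 * p.2.1 ^ 2 : ℝ) : ℂ) ∂μ.toSphere.prod
          (Measure.volumeIoiPow (Module.finrank ℝ (Ket (Fin d)) - 1)) := by
        rw [← μ.measurePreserving_homeomorphUnitSphereProd.integral_comp
          (Homeomorph.measurableEmbedding _)]
        refine integral_congr_ae (ae_of_all _ fun x => ?_)
        have hx : 0 < ‖x.1‖ := norm_pos_iff.mpr x.2
        simp only [homeomorphUnitSphereProd_apply_snd_coe, homeomorphUnitSphereProd_apply_fst_coe]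
        have h1 : x.1 = ‖x.1‖ • (‖x.1‖⁻¹ • x.1) := by
          rw [smul_smul, mul_inv_cancel₀ hx.ne', one_smul]
        conv_lhs => rw [h1, hF _ _ hx, ← h1]
        rw [Complex.real_smul]
        push_cast
        ring
    _ = _ := integral_prod_mul (fun φ : Metric.sphere (0 : Ket (Fin d)) 1 => F φ.1)
          fun r : Set.Ioi (0 : ℝ) => ((ρ r.1 * r.1 ^ 2 : ℝ) : ℂ)

instance haarSphere_isProbabilityMeasure (d : ℕ) [NeZero d] :
    IsProbabilityMeasure (haarSphere d) := by
  have : Nontrivial (Ket (Fin d)) := inferInstance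
  exact ProbabilityTheory.cond_isProbabilityMeasure
    (fun h => Measure.toSphere_ne_zero (volume : Measure (Ket (Fin d)))
      (Measure.measure_univ_eq_zero.mp h))

lemma integral_haarSphere {d : ℕ} (f : Metric.sphere (0 : Ket (Fin d)) 1 → ℂ) :
    ∫ φ, f φ ∂haarSphere d =
      ((volume : Measure (Ket (Fin d))).toSphere.real Set.univ)⁻¹ •
        ∫ φ, f φ ∂((volume : Measure (Ket (Fin d))).toSphere) := by
  rw [haarSphere, ProbabilityTheory.cond, integral_smul_measure, Measure.restrict_univ,
    ENNReal.toReal_inv]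
  rfl

/-- A centred complex Gaussian vector is determined by its covariance: `∑ⱼ ζⱼ uⱼ` is distributed as
the image of a standard Gaussian vector under the self-adjoint map `T` with `T² = ∑ⱼ |uⱼ⟩⟨uⱼ|`. -/
lemma map_sum_gaussC_eq {d D : ℕ} {u : Fin D → Ket (Fin d)} {T : Ket (Fin d) → Ket (Fin d)}
    (hTc : Measurable T) (hT : ∀ x t, inner ℝ (T x) t = (inner ℝ x (T t) : ℝ))
    (hu : ∀ t, ‖T t‖ ^ 2 = ∑ j, ‖inner ℂ (u j) t‖ ^ 2) :
    (Measure.pi fun _ : Fin D => gaussC).map (fun ζ => ∑ j, ζ j • u j) =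
      (gaussKet d).map T := by
  have hc : Continuous fun ζ : Fin D → ℂ => ∑ j, ζ j • u j := by fun_prop
  have := Measure.isFiniteMeasure_map (gaussKet d) T
  have := Measure.isFiniteMeasure_map (Measure.pi fun _ : Fin D => gaussC) fun ζ => ∑ j, ζ j • u j
  refine Measure.ext_of_charFun ?_
  ext t
  rw [charFun_sum_gaussC, ← hu, charFun_apply, integral_map hTc.aemeasurable (by fun_prop)]
  simp only [hT]
  rw [← charFun_apply, charFun_gaussKet]

lemma integral_norm_sq_gaussKet (d : ℕ) : ∫ x, ((‖x‖ ^ 2 : ℝ) : ℂ) ∂gaussKet d = d := by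
  have h := map_sum_gaussC_eq (d := d) (u := fun j => EuclideanSpace.basisFun (Fin d) ℂ j)
    (T := fun x => x) measurable_id (fun _ _ => rfl) fun t => by
      rw [(EuclideanSpace.basisFun (Fin d) ℂ).sum_sq_norm_inner_right]
  rw [Measure.map_id'] at h
  have hc : Continuous fun ζ : Fin d → ℂ => ∑ j, ζ j • EuclideanSpace.basisFun (Fin d) ℂ j := by
    fun_prop
  rw [← h, integral_map hc.aemeasurable (by fun_prop)]
  have h1 : ∀ ζ : Fin d → ℂ, ((‖∑ j, ζ j • EuclideanSpace.basisFun (Fin d) ℂ j‖ ^ 2 : ℝ) : ℂ) =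
      ∑ j, ((‖ζ j‖ ^ 2 : ℝ) : ℂ) := by
    intro ζ
    rw [← Complex.ofReal_sum]
    congr 1
    rw [EuclideanSpace.norm_sq_eq]
    refine Finset.sum_congr rfl fun i _ => ?_
    simp [Pi.single_apply]
  have h2 : ∫ z, ‖z‖ ^ 2 ∂gaussC = 1 := by
    have e1 := isStdSymm_gaussC.re_sq
    have e2 := isStdSymm_gaussC.im_sq
    have hre2 : Integrable (fun z : ℂ => z.re ^ 2) gaussC :=
      (Complex.reCLM.comp_memLp' isStdSymm_gaussC.memLp_two).integrable_sq
    have him2 : Integrable (fun z : ℂ => z.im ^ 2) gaussC :=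
      (Complex.imCLM.comp_memLp' isStdSymm_gaussC.memLp_two).integrable_sq
    have : ∫ z, ‖z‖ ^ 2 ∂gaussC = ∫ z : ℂ, (z.re ^ 2 + z.im ^ 2) ∂gaussC := by
      refine integral_congr_ae (ae_of_all _ fun z => ?_)
      simp only
      rw [← Complex.normSq_eq_norm_sq, Complex.normSq_apply]
      ring
    rw [this, integral_add hre2 him2, e1, e2]
    norm_num
  have hi : Integrable (fun z : ℂ => ((‖z‖ ^ 2 : ℝ) : ℂ)) gaussC :=
    (isStdSymm_gaussC.memLp_two.norm.integrable_sq).ofReal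
  simp only [h1]
  have hi' : ∀ j : Fin d, Integrable (fun ζ : Fin d → ℂ => ((‖ζ j‖ ^ 2 : ℝ) : ℂ))
      (Measure.pi fun _ => gaussC) := fun j =>
    ((measurePreserving_eval (fun _ : Fin d => gaussC) j).integrable_comp
      hi.aestronglyMeasurable).mpr hi
  rw [integral_finsetSum _ fun j _ => hi' j]
  have h3 : ∀ j : Fin d,
      ∫ ζ : Fin d → ℂ, ((‖ζ j‖ ^ 2 : ℝ) : ℂ) ∂(Measure.pi fun _ => gaussC) = 1 := by
    intro j
    have h4 := (measurePreserving_eval (fun _ : Fin d => gaussC) j)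
    have h5 := integral_map (μ := Measure.pi fun _ : Fin d => gaussC)
      (f := fun z : ℂ => ((‖z‖ ^ 2 : ℝ) : ℂ)) h4.measurable.aemeasurable
      (by fun_prop)
    rw [h4.map_eq, integral_complex_ofReal, h2] at h5
    simpa using h5.symm
  rw [Finset.sum_congr rfl fun j _ => h3 j]
  simp

/-- In polar coordinates, a Gaussian vector is its norm times an independent uniform point of the
sphere; so Gaussian and spherical averages of a function that is homogeneous of degree two differ
by the factor `E ‖x‖² = d`. -/
lemma integral_gaussKet_of_homogeneous {d : ℕ} [NeZero d] {F : Ket (Fin d) → ℂ}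
    (hF : ∀ (r : ℝ) x, 0 < r → F (r • x) = ((r ^ 2 : ℝ) : ℂ) * F x) :
    ∫ x, F x ∂gaussKet d = d * ∫ φ, F φ.1 ∂haarSphere d := by
  set ρ : ℝ → ℝ := fun r => (Real.pi ^ d)⁻¹ * Real.exp (-r ^ 2) with hρ
  have h1 := integral_homogeneous_mul_norm ρ hF
  have h2 := integral_homogeneous_mul_norm (d := d) ρ (F := fun x => ((‖x‖ ^ 2 : ℝ) : ℂ))
    fun r x hr => by
      rw [norm_smul, mul_pow, Real.norm_of_nonneg hr.le, Complex.ofReal_mul]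
  have h3 := integral_norm_sq_gaussKet d
  rw [integral_gaussKet] at h3 ⊢
  rw [h3] at h2
  have : Nontrivial (Ket (Fin d)) := inferInstance
  have hτ : ((volume : Measure (Ket (Fin d))).toSphere.real Set.univ) ≠ 0 := by
    rw [measureReal_def, ENNReal.toReal_ne_zero]
    exact ⟨fun h => Measure.toSphere_ne_zero (volume : Measure (Ket (Fin d)))
      (Measure.measure_univ_eq_zero.mp h), measure_ne_top _ _⟩
  have h4 : ∫ φ : Metric.sphere (0 : Ket (Fin d)) 1, ((‖φ.1‖ ^ 2 : ℝ) : ℂ)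
      ∂((volume : Measure (Ket (Fin d))).toSphere) =
      ((volume : Measure (Ket (Fin d))).toSphere.real Set.univ : ℂ) := by
    simp
  rw [h4] at h2
  rw [h1, integral_haarSphere, h2, Complex.real_smul]
  push_cast
  have : ((volume : Measure (Ket (Fin d))).toSphere.real Set.univ : ℂ) ≠ 0 := by exact_mod_cast hτ
  field_simp

end Polar

/-! ### The Scrooge ensemble as a Gaussian expectation -/

section Scrooge

open scoped MatrixOrder ComplexOrder

variable {d : ℕ}

lemma sandwich_eq_inner {n : Type} [Fintype n] (M : Matrix n n ℂ) (v : Ket n) :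
    sandwich M v = inner ℂ v (WithLp.toLp 2 (M.mulVec v.ofLp)) := by
  simp only [sandwich, PiLp.inner_apply, Matrix.mulVec, dotProduct, RCLike.inner_apply]
  refine Finset.sum_congr rfl fun i _ => ?_
  rw [Finset.sum_mul]
  refine Finset.sum_congr rfl fun j _ => ?_
  simp only [starRingEnd_apply]
  ring

lemma inner_sqrtApply {σ : Matrix (Fin d) (Fin d) ℂ} (x t : Ket (Fin d)) :
    inner ℂ (sqrtApply σ x) t = inner ℂ x (sqrtApply σ t) := by
  have h : (CFC.sqrt σ).IsHermitian := (Matrix.nonneg_iff_posSemidef.mp (CFC.sqrt_nonneg σ)).1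
  simp only [EuclideanSpace.inner_eq_star_dotProduct, sqrtApply, Matrix.star_mulVec, h.eq]
  rw [dotProduct_comm, ← Matrix.dotProduct_mulVec, dotProduct_comm]

lemma norm_sqrtApply_sq {σ : Matrix (Fin d) (Fin d) ℂ} (hσ : σ.PosSemidef) (t : Ket (Fin d)) :
    ‖sqrtApply σ t‖ ^ 2 = (sandwich σ t).re := by
  have h : CFC.sqrt σ * CFC.sqrt σ = σ :=
    CFC.sqrt_mul_sqrt_self σ (Matrix.nonneg_iff_posSemidef.mpr hσ)
  rw [sandwich_eq_inner, ← inner_self_eq_norm_sq (𝕜 := ℂ), inner_sqrtApply]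
  simp only [sqrtApply, Matrix.mulVec_mulVec, h]
  rfl

lemma continuous_sqrtApply (σ : Matrix (Fin d) (Fin d) ℂ) : Continuous (sqrtApply σ) := by
  unfold sqrtApply
  fun_prop

lemma sqrtApply_smul (σ : Matrix (Fin d) (Fin d) ℂ) (r : ℝ) (x : Ket (Fin d)) :
    sqrtApply σ (r • x) = r • sqrtApply σ x := by
  simp [sqrtApply, Matrix.mulVec_smul]

/-- The Scrooge ensemble is the projectivized Gaussian ensemble, weighted by the squared norm. -/
lemma scroogeMoment_eq [NeZero d] {σ : Matrix (Fin d) (Fin d) ℂ} (hσ : σ.PosSemidef) {D : ℕ}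
    {u : Fin D → Ket (Fin d)} (hu : ∀ t, (sandwich σ t).re = ∑ j, ‖inner ℂ (u j) t‖ ^ 2) (k : ℕ)
    (i j : Fin k → Fin d) :
    scroogeMoment k σ i j =
      ∫ ζ, homEntry k i j (∑ l, ζ l • u l) ∂(Measure.pi fun _ : Fin D => gaussC) := by
  have hm := measurable_homEntry k i j
  have hsq := continuous_sqrtApply σ
  have h1 : ∫ ζ, homEntry k i j (∑ l, ζ l • u l) ∂(Measure.pi fun _ : Fin D => gaussC) =
      ∫ x, homEntry k i j (sqrtApply σ x) ∂gaussKet d := by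
    have hc : Continuous fun ζ : Fin D → ℂ => ∑ l, ζ l • u l := by fun_prop
    rw [← integral_map (f := homEntry k i j) hc.aemeasurable hm.aestronglyMeasurable,
      map_sum_gaussC_eq hsq.measurable (fun x t => by
        rw [real_inner_ket, real_inner_ket, inner_sqrtApply]) fun t => by
          rw [norm_sqrtApply_sq hσ, hu],
      integral_map hsq.aemeasurable hm.aestronglyMeasurable]
  rw [h1, integral_gaussKet_of_homogeneous (F := fun x => homEntry k i j (sqrtApply σ x))
    fun r x hr => by rw [sqrtApply_smul, homEntry_smul i j hr]]
  have hT : Measurable fun ψ : Ket (Fin d) => tensorPow k (ketbra ψ) i j := by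
    unfold tensorPow ketbra
    simp only [Matrix.of_apply]
    fun_prop
  have hφ : Measurable fun φ : Metric.sphere (0 : Ket (Fin d)) 1 => sqrtApply σ φ.1 :=
    hsq.measurable.comp measurable_subtype_coe
  have hs : Measurable fun φ : Metric.sphere (0 : Ket (Fin d)) 1 => (sandwich σ φ.1).re := by
    unfold sandwich
    fun_prop
  rw [scroogeMoment, stateMoment, Matrix.of_apply, scroogeEnsemble,
    integral_map (by fun_prop) hT.aestronglyMeasurable,
    integral_withDensity_eq_integral_toReal_smul (by fun_prop)
      (ae_of_all _ fun _ => ENNReal.ofReal_lt_top), ← integral_const_mul]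
  refine integral_congr_ae (ae_of_all _ fun φ => ?_)
  have hnn : 0 ≤ (sandwich σ φ.1).re := by rw [← norm_sqrtApply_sq hσ]; positivity
  simp only
  rw [ENNReal.toReal_ofReal (by positivity), ← norm_sqrtApply_sq hσ, homEntry, Complex.real_smul]
  push_cast
  ring

end Scrooge

/-! ### Schatten norms -/

section TraceNorm

variable {n : Type} [Fintype n] [DecidableEq n]

open scoped Matrix.Norms.L2Operator in
/-- The trace norm is `Tr √(M† M)`, and the continuous functional calculus is continuous. -/
lemma continuous_traceNorm : Continuous (traceNorm : Matrix n n ℂ → ℝ) := by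
  have h : (traceNorm : Matrix n n ℂ → ℝ) =
      fun M => (cfc Real.sqrt (M.conjTranspose * M)).trace.re := by
    ext M
    have hH := Matrix.isHermitian_conjTranspose_mul_self M
    rw [hH.cfc_eq, Matrix.IsHermitian.cfc, Unitary.conjStarAlgAut_apply, Matrix.trace_mul_cycle]
    simp [traceNorm, Matrix.trace]
  rw [h]
  have hc : Continuous fun M : Matrix n n ℂ => cfc Real.sqrt (M.conjTranspose * M) := by
    refine Continuous.cfc_of_mem_nhdsSet (s := Set.univ) Real.sqrt Filter.univ_mem (by fun_prop)
      (fun M => Matrix.isHermitian_conjTranspose_mul_self M) (by fun_prop)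
  exact Complex.continuous_re.comp hc.matrix_trace

omit [DecidableEq n] in
lemma trace_conjTranspose_mul_self (M : Matrix n n ℂ) :
    (M.conjTranspose * M).trace = ((∑ i, ∑ j, ‖M i j‖ ^ 2 : ℝ) : ℂ) := by
  simp only [Matrix.trace, Matrix.diag, Matrix.mul_apply, Matrix.conjTranspose_apply]
  rw [Finset.sum_comm]
  push_cast
  refine Finset.sum_congr rfl fun i _ => Finset.sum_congr rfl fun j _ => ?_
  rw [← Complex.ofReal_pow, ← Complex.normSq_eq_norm_sq, Complex.normSq_eq_conj_mul_self,
    Complex.star_def]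

omit [DecidableEq n] in
lemma hsNorm_sq (M : Matrix n n ℂ) : hsNorm M ^ 2 = ∑ i, ∑ j, ‖M i j‖ ^ 2 := by
  rw [hsNorm, trace_conjTranspose_mul_self, Complex.ofReal_re, Real.sq_sqrt (by positivity)]

lemma traceNorm_nonneg (M : Matrix n n ℂ) : 0 ≤ traceNorm M :=
  Finset.sum_nonneg fun _ _ => Real.sqrt_nonneg _

open scoped ComplexOrder in
/-- The trace norm is at most `√n` times the Hilbert–Schmidt norm, and the latter is at most the sum
of the moduli of the entries. -/
lemma traceNorm_le (M : Matrix n n ℂ) :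
    traceNorm M ≤ √(Fintype.card n) * ∑ i, ∑ j, ‖M i j‖ := by
  have hH := Matrix.isHermitian_conjTranspose_mul_self M
  have hpos : ∀ i, 0 ≤ hH.eigenvalues i :=
    (Matrix.posSemidef_conjTranspose_mul_self M).eigenvalues_nonneg
  have h1 : ∑ i, hH.eigenvalues i = ∑ i, ∑ j, ‖M i j‖ ^ 2 := by
    have h := hH.trace_eq_sum_eigenvalues
    rw [trace_conjTranspose_mul_self] at h
    have h' := congrArg Complex.re h
    rw [Complex.ofReal_re] at h'
    rw [h']
    simp
  have h2 : (traceNorm M) ^ 2 ≤ Fintype.card n * ∑ i, ∑ j, ‖M i j‖ ^ 2 := by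
    have := sq_sum_le_card_mul_sum_sq (s := Finset.univ) (f := fun i => √(hH.eigenvalues i))
    simp only [Real.sq_sqrt (hpos _), Finset.card_univ, h1] at this
    exact this
  have h3 : ∑ i, ∑ j, ‖M i j‖ ^ 2 ≤ (∑ i, ∑ j, ‖M i j‖) ^ 2 := by
    simp only [← Finset.sum_product', Finset.univ_product_univ]
    exact Finset.sum_sq_le_sq_sum_of_nonneg fun _ _ => norm_nonneg _
  have h4 : 0 ≤ ∑ i, ∑ j, ‖M i j‖ := by positivity
  refine abs_le_of_sq_le_sq' ?_ (by positivity) |>.2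
  rw [mul_pow, Real.sq_sqrt (by positivity)]
  exact h2.trans (mul_le_mul_of_nonneg_left h3 (by positivity))

end TraceNorm

/-! ### Bipartite systems -/

section Bipartite

variable {a b : Type} [Fintype a] [Fintype b]

lemma projKet_eq_inner (Ψ : Ket (a × b)) (z : Ket b) (x : a) :
    projKet Ψ z x = inner ℂ z (WithLp.toLp 2 fun y => Ψ (x, y)) := by
  simp only [projKet, PiLp.inner_apply, RCLike.inner_apply]
  exact Finset.sum_congr rfl fun y _ => mul_comm _ _

lemma projKet_sum_smul {D : ℕ} (α : Fin D → ℂ) (Φ : Fin D → Ket (a × b)) (z : Ket b) :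
    projKet (∑ j, α j • Φ j) z = ∑ j, α j • projKet (Φ j) z := by
  ext x
  simp only [projKet, WithLp.ofLp_sum, Finset.sum_apply, smul_eq_mul,
    WithLp.ofLp_smul, Pi.smul_apply, Finset.mul_sum]
  rw [Finset.sum_comm]
  exact Finset.sum_congr rfl fun _ _ => Finset.sum_congr rfl fun _ _ => by ring

lemma sum_norm_projKet_sq {ι : Type} [Fintype ι] (z : OrthonormalBasis ι ℂ (Ket b))
    (Ψ : Ket (a × b)) : ∑ s, ‖projKet Ψ (z s)‖ ^ 2 = ‖Ψ‖ ^ 2 := by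
  simp only [EuclideanSpace.norm_sq_eq (projKet _ _), projKet_eq_inner]
  rw [Finset.sum_comm]
  simp only [z.sum_sq_norm_inner_right, EuclideanSpace.norm_sq_eq]
  rw [← Finset.univ_product_univ, Finset.sum_product]

/-- Measuring `B` in an orthonormal basis preserves the total norm: the family of the
`(I ⊗ ⟨z_s|) |E_l⟩` is isometric in the sense required by the variance bound. -/
lemma sum_norm_sum_smul_projKet_sq {ι : Type} [Fintype ι] {D : ℕ}
    (E : OrthonormalBasis (Fin D) ℂ (Ket (a × b))) (z : OrthonormalBasis ι ℂ (Ket b))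
    (α : Fin D → ℂ) : ∑ s, ‖∑ l, α l • projKet (E l) (z s)‖ ^ 2 = ∑ l, ‖α l‖ ^ 2 := by
  simp only [← projKet_sum_smul]
  rw [sum_norm_projKet_sq, ← EuclideanSpace.norm_sq_eq (WithLp.toLp 2 α),
    ← E.repr.symm.norm_map (WithLp.toLp 2 α), ← E.sum_repr_symm]

variable {D : ℕ} (E : OrthonormalBasis (Fin D) ℂ (Ket (a × b))) (Ψ₀ : Ket (a × b))

lemma projKet_phaseState (φ : Fin D → ℝ) (z : Ket b) :
    projKet (phaseState E Ψ₀ φ) z =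
      phaseSum (fun j => ‖inner ℂ (E j) Ψ₀‖) (fun j => projKet (E j) z) φ := by
  rw [phaseState, projKet_sum_smul, phaseSum]

/-- `σ_{A|z} = ∑ⱼ |⟨Eⱼ|Ψ₀⟩|² |vⱼ⟩⟨vⱼ|` with `vⱼ = (I ⊗ ⟨z|) |Eⱼ⟩`. -/
lemma condA_sigmaDiag (z : Ket b) :
    condA (sigmaDiag E Ψ₀) z =
      ∑ j, ((‖inner ℂ (E j) Ψ₀‖ : ℂ) ^ 2) • ketbra (projKet (E j) z) := by
  ext x x'
  simp only [condA, sigmaDiag, ketbra, projKet, Matrix.of_apply, Matrix.sum_apply,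
    Matrix.smul_apply, smul_eq_mul, star_sum, Finset.mul_sum, Finset.sum_mul]
  rw [Finset.sum_congr rfl fun y _ => Finset.sum_comm, Finset.sum_comm]
  refine Finset.sum_congr rfl fun j _ => ?_
  conv_rhs => rw [Finset.sum_comm]
  refine Finset.sum_congr rfl fun y _ => Finset.sum_congr rfl fun y' _ => ?_
  simp only [star_mul', star_star]
  ring

lemma weightB_eq_trace (σ : Matrix (a × b) (a × b) ℂ) (z : Ket b) :
    weightB σ z = (condA σ z).trace.re := by
  rw [weightB]
  congr 1
  simp only [sandwich, traceA, condA, Matrix.trace, Matrix.diag, Matrix.of_apply, Finset.mul_sum,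
    Finset.sum_mul]
  rw [Finset.sum_congr rfl fun y _ => Finset.sum_comm, Finset.sum_comm]

lemma trace_ketbra {n : Type} [Fintype n] (ψ : Ket n) :
    (ketbra ψ).trace = ((‖ψ‖ ^ 2 : ℝ) : ℂ) := by
  simp only [Matrix.trace, Matrix.diag, ketbra, Matrix.of_apply, EuclideanSpace.norm_sq_eq]
  push_cast
  refine Finset.sum_congr rfl fun i _ => ?_
  rw [Complex.star_def, Complex.mul_conj, Complex.normSq_eq_norm_sq]
  push_cast
  rfl

lemma weightB_sigmaDiag (z : Ket b) :
    weightB (sigmaDiag E Ψ₀) z = ∑ j, ‖inner ℂ (E j) Ψ₀‖ ^ 2 * ‖projKet (E j) z‖ ^ 2 := by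
  rw [weightB_eq_trace, condA_sigmaDiag, Matrix.trace_sum]
  simp only [Matrix.trace_smul, trace_ketbra, smul_eq_mul]
  rw [← Complex.ofReal_re (∑ j, _)]
  push_cast
  rfl

lemma sandwich_ketbra {n : Type} [Fintype n] (ψ t : Ket n) :
    sandwich (ketbra ψ) t = ((‖inner ℂ ψ t‖ ^ 2 : ℝ) : ℂ) := by
  rw [← Complex.normSq_eq_norm_sq, Complex.normSq_eq_conj_mul_self]
  simp only [sandwich, ketbra, Matrix.of_apply, PiLp.inner_apply, RCLike.inner_apply, map_sum,
    Finset.sum_mul_sum, map_mul, Complex.conj_conj, Complex.star_def]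
  refine Finset.sum_congr rfl fun i _ => Finset.sum_congr rfl fun j _ => ?_
  ring

lemma sandwich_sum_smul {n : Type} [Fintype n] (α : Fin D → ℂ) (M : Fin D → Matrix n n ℂ)
    (t : Ket n) : sandwich (∑ j, α j • M j) t = ∑ j, α j * sandwich (M j) t := by
  simp only [sandwich, Matrix.sum_apply, Matrix.smul_apply, smul_eq_mul, Finset.mul_sum,
    Finset.sum_mul]
  rw [Finset.sum_congr rfl fun y _ => Finset.sum_comm, Finset.sum_comm]
  exact Finset.sum_congr rfl fun _ _ => Finset.sum_congr rfl fun _ _ =>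
    Finset.sum_congr rfl fun _ _ => by ring

lemma sandwich_traceATwo_ketbra_doubleKet (ψ : Ket (a × b)) (z : Ket b) :
    sandwich (traceATwo (ketbra (doubleKet ψ))) (doubleKet z) = ((‖projKet ψ z‖ ^ 4 : ℝ) : ℂ) := by
  have h1 : sandwich (traceATwo (ketbra (doubleKet ψ))) (doubleKet z) =
      ∑ x₁, ∑ x₂, (projKet ψ z x₁ * projKet ψ z x₂) * star (projKet ψ z x₁ * projKet ψ z x₂) := by
    have h2 : ∀ x₁ x₂, projKet ψ z x₁ * projKet ψ z x₂ =
        ∑ p : b × b, star (doubleKet z p) * doubleKet ψ ((x₁, p.1), (x₂, p.2)) := by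
      intro x₁ x₂
      simp only [projKet, doubleKet, Finset.sum_mul_sum, star_mul', Fintype.sum_prod_type]
      exact Finset.sum_congr rfl fun _ _ => Finset.sum_congr rfl fun _ _ => by ring
    simp only [h2, star_sum, sandwich, traceATwo, ketbra, Matrix.of_apply,
      Finset.mul_sum, Finset.sum_mul]
    rw [Finset.sum_congr rfl fun p _ => Finset.sum_comm, Finset.sum_comm]
    refine Finset.sum_congr rfl fun x₁ _ => ?_
    rw [Finset.sum_congr rfl fun p _ => Finset.sum_comm, Finset.sum_comm]
    refine Finset.sum_congr rfl fun x₂ _ => ?_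
    conv_rhs => rw [Finset.sum_comm]
    refine Finset.sum_congr rfl fun p _ => Finset.sum_congr rfl fun p' _ => ?_
    simp only [star_mul', star_star]
    ring
  rw [h1]
  have h2 : ‖projKet ψ z‖ ^ 4 = (∑ x, ‖projKet ψ z x‖ ^ 2) * ∑ x, ‖projKet ψ z x‖ ^ 2 := by
    rw [← EuclideanSpace.norm_sq_eq]; ring
  rw [h2, Finset.sum_mul_sum]
  push_cast
  refine Finset.sum_congr rfl fun i _ => Finset.sum_congr rfl fun j _ => ?_
  rw [Complex.star_def, Complex.mul_conj, Complex.normSq_eq_norm_sq, norm_mul]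
  push_cast
  ring

omit [Fintype b] in
lemma traceATwo_sum_smul (α : Fin D → ℂ)
    (M : Fin D → Matrix ((a × b) × (a × b)) ((a × b) × (a × b)) ℂ) :
    traceATwo (∑ j, α j • M j) = ∑ j, α j • traceATwo (M j) := by
  ext y y'
  simp only [traceATwo, Matrix.of_apply, Matrix.sum_apply, Matrix.smul_apply, smul_eq_mul,
    Finset.mul_sum]
  rw [Finset.sum_congr rfl fun y _ => Finset.sum_comm, Finset.sum_comm]

lemma deltaBeta_eq {ι : Type} [Fintype ι] (z : ι → Ket b) :
    deltaBeta E Ψ₀ z = ∑ s, (∑ j, ‖inner ℂ (E j) Ψ₀‖ ^ 4 * ‖projKet (E j) (z s)‖ ^ 4) /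
      ∑ j, ‖inner ℂ (E j) Ψ₀‖ ^ 2 * ‖projKet (E j) (z s)‖ ^ 2 := by
  rw [deltaBeta]
  refine Finset.sum_congr rfl fun s _ => ?_
  rw [weightB_sigmaDiag, sigmaDiagTwo, traceATwo_sum_smul, sandwich_sum_smul]
  simp only [sandwich_traceATwo_ketbra_doubleKet]
  congr 1
  rw [← Complex.ofReal_re (∑ j, _)]
  push_cast
  rfl

lemma sandwich_condAHat (z : Ket b) (t : Ket a) :
    (sandwich (condAHat (sigmaDiag E Ψ₀) z) t).re =
      (weightB (sigmaDiag E Ψ₀) z)⁻¹ *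
        ∑ j, ‖inner ℂ (E j) Ψ₀‖ ^ 2 * ‖inner ℂ (projKet (E j) z) t‖ ^ 2 := by
  have h : sandwich (condAHat (sigmaDiag E Ψ₀) z) t =
      (((weightB (sigmaDiag E Ψ₀) z)⁻¹ : ℝ) : ℂ) * sandwich (condA (sigmaDiag E Ψ₀) z) t := by
    simp only [condAHat, sandwich, Matrix.smul_apply, smul_eq_mul, Finset.mul_sum]
    exact Finset.sum_congr rfl fun _ _ => Finset.sum_congr rfl fun _ _ => by ring
  rw [h, condA_sigmaDiag, sandwich_sum_smul, Complex.re_ofReal_mul]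
  simp only [sandwich_ketbra]
  congr 1
  rw [← Complex.ofReal_re (∑ j, _)]
  push_cast
  rfl

open scoped ComplexOrder in
lemma ketbra_posSemidef {n : Type} [Fintype n] (ψ : Ket n) : (ketbra ψ).PosSemidef := by
  have : ketbra ψ = Matrix.vecMulVec ψ.ofLp (star ψ.ofLp) := by
    ext i j
    simp [ketbra, Matrix.vecMulVec_apply]
  rw [this]
  exact Matrix.posSemidef_vecMulVec_self_star _

lemma weightB_nonneg (z : Ket b) : 0 ≤ weightB (sigmaDiag E Ψ₀) z := by
  rw [weightB_sigmaDiag]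
  positivity

open scoped ComplexOrder in
lemma condAHat_posSemidef (z : Ket b) : (condAHat (sigmaDiag E Ψ₀) z).PosSemidef := by
  rw [condAHat, condA_sigmaDiag]
  refine Matrix.PosSemidef.smul (Matrix.posSemidef_sum _ fun j _ => ?_) ?_
  · refine (ketbra_posSemidef _).smul ?_
    rw [← Complex.ofReal_pow]
    exact Complex.zero_le_real.mpr (sq_nonneg _)
  · exact_mod_cast inv_nonneg.mpr (weightB_nonneg E Ψ₀ z)

/-- A state on `ℂᵈ` has Hilbert–Schmidt norm at least `d^{-1/2}`. -/
lemma one_le_card_mul_hsNorm_sq {z : Ket b} (hz : 0 < weightB (sigmaDiag E Ψ₀) z) :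
    1 ≤ Fintype.card a * hsNorm (condAHat (sigmaDiag E Ψ₀) z) ^ 2 := by
  set M := condAHat (sigmaDiag E Ψ₀) z with hM
  have h1 : ∑ x, (M x x).re = 1 := by
    have : M.trace.re = 1 := by
      rw [hM, condAHat, Matrix.trace_smul, smul_eq_mul, Complex.re_ofReal_mul, ← weightB_eq_trace,
        inv_mul_cancel₀ hz.ne']
    rw [← this]
    simp [Matrix.trace]
  have h2 : (∑ x, (M x x).re) ^ 2 ≤ Fintype.card a * ∑ x, (M x x).re ^ 2 :=
    sq_sum_le_card_mul_sum_sq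
  rw [h1, one_pow] at h2
  refine h2.trans (mul_le_mul_of_nonneg_left ?_ (by positivity))
  rw [hsNorm_sq]
  refine Finset.sum_le_sum fun x _ => ?_
  refine le_trans ?_ (Finset.single_le_sum (f := fun y => ‖M x y‖ ^ 2)
    (fun _ _ => sq_nonneg _) (Finset.mem_univ x))
  rw [← sq_abs]
  exact pow_le_pow_left₀ (abs_nonneg _) (Complex.abs_re_le_norm _) 2

end Bipartite

/-! ### Random phases against Gaussians for homogeneous functions -/

section Comparison

variable {n ι : Type} [Fintype n] [Fintype ι] {D : ℕ}

lemma sum_weight_eq_one (c : Fin D → ℝ) (hc : ∑ j, c j ^ 2 = 1) (v : ι → Fin D → Ket n)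
    (hv : ∀ a : Fin D → ℂ, ∑ s, ‖∑ l, a l • v s l‖ ^ 2 = ∑ l, ‖a l‖ ^ 2) :
    ∑ s, ∑ j, c j ^ 2 * ‖v s j‖ ^ 2 = 1 := by
  rw [Finset.sum_comm]
  simp only [← Finset.mul_sum, sum_norm_sq_eq_one v hv, mul_one, hc]

/-- The Cauchy–Schwarz inequality with the weights `wₛ = ∑ⱼ cⱼ² ‖v_{sj}‖²`, which add up to one. -/
lemma sum_sqrt_le (c : Fin D → ℝ) (hc : ∑ j, c j ^ 2 = 1) (v : ι → Fin D → Ket n)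
    (hv : ∀ a : Fin D → ℂ, ∑ s, ‖∑ l, a l • v s l‖ ^ 2 = ∑ l, ‖a l‖ ^ 2) :
    ∑ s, √(∑ j, c j ^ 4 * ‖v s j‖ ^ 4) ≤
      √(∑ s, (∑ j, c j ^ 4 * ‖v s j‖ ^ 4) / ∑ j, c j ^ 2 * ‖v s j‖ ^ 2) := by
  have h1 := Real.sum_sqrt_mul_sqrt_le (s := Finset.univ)
    (f := fun s => (∑ j, c j ^ 4 * ‖v s j‖ ^ 4) / ∑ j, c j ^ 2 * ‖v s j‖ ^ 2)
    (g := fun s => ∑ j, c j ^ 2 * ‖v s j‖ ^ 2) (fun s => by positivity) (fun s => by positivity)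
  rw [sum_weight_eq_one c hc v hv, Real.sqrt_one, mul_one] at h1
  refine le_trans (Finset.sum_le_sum fun s _ => ?_) h1
  rw [← Real.sqrt_mul (by positivity)]
  refine Real.sqrt_le_sqrt ?_
  by_cases h : ∑ j, c j ^ 2 * ‖v s j‖ ^ 2 = 0
  · rw [h, mul_zero]
    have h0 := (Finset.sum_eq_zero_iff_of_nonneg fun j _ => by positivity).mp h
    refine (Finset.sum_eq_zero fun j hj => ?_).le
    rw [show c j ^ 4 * ‖v s j‖ ^ 4 = (c j ^ 2 * ‖v s j‖ ^ 2) ^ 2 by ring, h0 j hj, sq, mul_zero]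
  · rw [div_mul_cancel₀ _ h]

/-- The purity `∑ⱼ cⱼ⁴` is bounded by the quantity that becomes `Δ_β`: write
`cⱼ² = ∑ₛ cⱼ² ‖v_{sj}‖²` and apply the Cauchy–Schwarz inequality with the weights `wₛ`. -/
lemma sum_pow_four_le (c : Fin D → ℝ) (hc : ∑ j, c j ^ 2 = 1) (v : ι → Fin D → Ket n)
    (hv : ∀ a : Fin D → ℂ, ∑ s, ‖∑ l, a l • v s l‖ ^ 2 = ∑ l, ‖a l‖ ^ 2) :
    ∑ j, c j ^ 4 ≤ ∑ s, (∑ j, c j ^ 4 * ‖v s j‖ ^ 4) / ∑ j, c j ^ 2 * ‖v s j‖ ^ 2 := by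
  set w : ι → ℝ := fun s => ∑ j, c j ^ 2 * ‖v s j‖ ^ 2 with hw
  have hw0 : ∀ s, 0 ≤ w s := fun s => by positivity
  have h1 : ∀ j, c j ^ 4 ≤ ∑ s, c j ^ 4 * ‖v s j‖ ^ 4 / w s := by
    intro j
    have h2 := Finset.sum_mul_sq_le_sq_mul_sq Finset.univ
      (fun s => c j ^ 2 * ‖v s j‖ ^ 2 / √(w s)) (fun s => √(w s))
    have h3 : ∀ s, c j ^ 2 * ‖v s j‖ ^ 2 / √(w s) * √(w s) = c j ^ 2 * ‖v s j‖ ^ 2 := by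
      intro s
      by_cases h : w s = 0
      · have h0 := (Finset.sum_eq_zero_iff_of_nonneg fun j _ => by positivity).mp h j
          (Finset.mem_univ j)
        rw [h0, zero_div, zero_mul]
      · exact div_mul_cancel₀ _ (Real.sqrt_ne_zero'.mpr ((hw0 s).lt_of_ne' h))
    simp only [h3, Real.sq_sqrt (hw0 _), div_pow] at h2
    rw [← Finset.mul_sum, sum_norm_sq_eq_one v hv, mul_one,
      show ∑ s, w s = 1 from sum_weight_eq_one c hc v hv, mul_one] at h2
    calc c j ^ 4 = (c j ^ 2) ^ 2 := by ring
      _ ≤ _ := h2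
      _ = _ := Finset.sum_congr rfl fun s _ => by ring
  calc ∑ j, c j ^ 4 ≤ ∑ j, ∑ s, c j ^ 4 * ‖v s j‖ ^ 4 / w s := Finset.sum_le_sum fun j _ => h1 j
    _ = _ := by
      rw [Finset.sum_comm]
      exact Finset.sum_congr rfl fun s _ => (Finset.sum_div _ _ _).symm

/-- The function `ε f(ε^{-1/2} x)`, whose second derivatives obey the same bound as those of `f`.
It is zero for `ε = 0`. -/
def rescale (f : Ket n → ℝ) (ε : ℝ) (x : Ket n) : ℝ := ε * f ((√ε)⁻¹ • x)

lemma contDiff_rescale {f : Ket n → ℝ} (hf : ContDiff ℝ ⊤ f) (ε : ℝ) :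
    ContDiff ℝ ⊤ (rescale f ε) :=
  contDiff_const.mul (hf.comp (contDiff_const_smul _))

lemma norm_fderiv_fderiv_rescale_le {f : Ket n → ℝ} (hf : ContDiff ℝ ⊤ f) {C : ℝ}
    (hC : ∀ x, ‖fderiv ℝ (fderiv ℝ f) x‖ ≤ C) {ε : ℝ} (hε : 0 ≤ ε) (x : Ket n) :
    ‖fderiv ℝ (fderiv ℝ (rescale f ε)) x‖ ≤ C := by
  set r := (√ε)⁻¹ with hr
  have hd : Differentiable ℝ f := hf.differentiable (by simp)
  have hd2 : Differentiable ℝ (fderiv ℝ f) :=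
    (hf.fderiv_right (m := 1) le_top).differentiable (by simp)
  have h1 : fderiv ℝ (rescale f ε) = fun x => (ε * r) • fderiv ℝ f (r • x) := by
    ext1 x
    have : rescale f ε = fun x => ε * f (r • x) := rfl
    have hx : DifferentiableAt ℝ (fun x => f (r • x)) x := by fun_prop
    rw [this, fderiv_const_mul hx, fderiv_comp_smul, smul_smul]
  have hx : DifferentiableAt ℝ (fun x => fderiv ℝ f (r • x)) x := by fun_prop
  rw [h1, fderiv_fun_const_smul hx (ε * r),
    fderiv_comp_smul (f := fderiv ℝ f), smul_smul]
  have h2 : ‖ε * r * r‖ ≤ 1 := by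
    rw [mul_assoc, ← sq, hr, inv_pow, Real.sq_sqrt hε, Real.norm_of_nonneg (by positivity)]
    exact mul_inv_le_one
  refine (ContinuousLinearMap.opNorm_smul_le (ε * r * r) (fderiv ℝ (fderiv ℝ f) (r • x))).trans ?_
  calc ‖ε * r * r‖ * ‖fderiv ℝ (fderiv ℝ f) (r • x)‖ ≤ 1 * C :=
        mul_le_mul h2 (hC _) (norm_nonneg (fderiv ℝ (fderiv ℝ f) (r • x))) zero_le_one
    _ = C := one_mul C

lemma integral_phaseSum_eq {f : Ket n → ℝ} (hf : Continuous f) (c : Fin D → ℝ)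
    (v : Fin D → Ket n) :
    ∫ φ, f (phaseSum c v φ) ∂phaseMeasure D =
      ∫ ζ, f (∑ j, ζ j • (c j • v j)) ∂(Measure.pi fun _ : Fin D => circleLaw) := by
  have hm : Continuous fun (φ : Fin D → ℝ) j => Complex.exp (Complex.I * φ j) := by fun_prop
  rw [← phaseMeasure_map_exp, integral_map hm.aemeasurable
    (by fun_prop : Continuous fun ζ : Fin D → ℂ => f (∑ j, ζ j • (c j • v j))).aestronglyMeasurable]
  refine integral_congr_ae (ae_of_all _ fun φ => ?_)
  simp only [phaseSum]
  congr 1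
  refine Finset.sum_congr rfl fun j _ => ?_
  rw [← Complex.coe_smul, smul_smul, mul_comm]

/-- The constant of Lindeberg's comparison between random phases and complex Gaussians. -/
def fourthMoments : ℝ := ∫ z, ‖z‖ ^ 4 ∂circleLaw + ∫ z, ‖z‖ ^ 4 ∂gaussC

lemma fourthMoments_nonneg : 0 ≤ fourthMoments :=
  add_nonneg (integral_nonneg fun _ => by positivity) (integral_nonneg fun _ => by positivity)

/-- The function `f₀`, homogeneous of degree two, has the even smooth approximation `f₁`, at
distance at most `κ` and with the bounds of a symbol of order two, all with the constant `C`. -/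
structure IsRegularization (f₀ f₁ : Ket n → ℝ) (κ C : ℝ) : Prop where
  measurable : Measurable f₀
  le_norm_sq : ∀ x, |f₀ x| ≤ ‖x‖ ^ 2
  homogeneous : ∀ (r : ℝ) x, 0 < r → f₀ (r • x) = r ^ 2 * f₀ x
  close : ∀ x, |f₀ x - f₁ x| ≤ κ
  contDiff : ContDiff ℝ ⊤ f₁
  even : ∀ x, f₁ (-x) = f₁ x
  nonneg : 0 ≤ C
  growth : ∀ x, |f₁ x| ≤ C * (1 + ‖x‖) ^ 2
  second : ∀ x, ‖fderiv ℝ (fderiv ℝ f₁) x‖ ≤ C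
  taylor : ∀ x u, |f₁ (x + u) + f₁ (x - u) - 2 * f₁ x - fderiv ℝ (fderiv ℝ f₁) x u u| ≤
    C * ‖u‖ ^ 4

variable {f₀ f₁ : Ket n → ℝ} {κ C : ℝ}

lemma IsRegularization.map_zero (h : IsRegularization f₀ f₁ κ C) : f₀ 0 = 0 := by
  have := h.le_norm_sq 0
  simpa using this

lemma IsRegularization.close_rescale (h : IsRegularization f₀ f₁ κ C) {ε : ℝ} (hε : 0 < ε)
    (x : Ket n) : |f₀ x - rescale f₁ ε x| ≤ κ * ε := by
  have hr : 0 < (√ε)⁻¹ := by positivity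
  have h1 : f₀ x = ε * f₀ ((√ε)⁻¹ • x) := by
    rw [h.homogeneous _ _ hr, inv_pow, Real.sq_sqrt hε.le, mul_inv_cancel_left₀ hε.ne']
  rw [h1, rescale, ← mul_sub, abs_mul, abs_of_pos hε, mul_comm]
  exact mul_le_mul_of_nonneg_right (h.close _) hε.le

lemma IsRegularization.integrable_rescale (h : IsRegularization f₀ f₁ κ C) (ε : ℝ) {μ : Measure ℂ}
    (hμ : IsStdSymm μ) (u : Fin D → Ket n) :
    Integrable (fun ζ => rescale f₁ ε (∑ j, ζ j • u j)) (Measure.pi fun _ : Fin D => μ) := by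
  have := hμ.prob
  have h1 := integrable_comp_of_quadratic h.contDiff.continuous h.growth
    (memLp_sum_smul hμ 0 fun j => (√ε)⁻¹ • u j)
  refine (h1.const_mul ε).congr (ae_of_all _ fun ζ => ?_)
  simp only [rescale, zero_add, Finset.smul_sum]
  congr 2
  exact Finset.sum_congr rfl fun j _ => smul_comm _ _ _

lemma IsRegularization.integrable_homogeneous (h : IsRegularization f₀ f₁ κ C) {μ : Measure ℂ}
    (hμ : IsStdSymm μ) (u : Fin D → Ket n) :
    Integrable (fun ζ => f₀ (∑ j, ζ j • u j)) (Measure.pi fun _ : Fin D => μ) := by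
  have := hμ.prob
  have h1 := memLp_sum_smul hμ 0 u
  simp only [zero_add] at h1
  refine Integrable.mono' h1.norm.integrable_sq ?_ (ae_of_all _ fun ζ => h.le_norm_sq _)
  have hc : Continuous fun ζ : Fin D → ℂ => ∑ j, ζ j • u j := by fun_prop
  exact (h.measurable.comp hc.measurable).aestronglyMeasurable

/-- Lindeberg's comparison at scale `√ε`, which trades a factor `ε` for `ε⁻²` in the sum of
fourth powers. -/
lemma IsRegularization.lindeberg_rescale (h : IsRegularization f₀ f₁ κ C) {ε : ℝ} (hε : 0 < ε)
    (u : Fin D → Ket n) :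
    |∫ ζ, rescale f₁ ε (∑ j, ζ j • u j) ∂(Measure.pi fun _ : Fin D => circleLaw) -
        ∫ ζ, rescale f₁ ε (∑ j, ζ j • u j) ∂(Measure.pi fun _ : Fin D => gaussC)| ≤
      C * fourthMoments * ((∑ j, ‖u j‖ ^ 4) / ε) := by
  have h1 := lindeberg isStdSymm_circleLaw isStdSymm_gaussC h.contDiff.continuous h.growth
    (fun x => fderiv ℝ (fderiv ℝ f₁) x) h.taylor (fun j => (√ε)⁻¹ • u j) 0
  have h2 : ∀ ζ : Fin D → ℂ, rescale f₁ ε (∑ j, ζ j • u j) =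
      ε * f₁ (0 + ∑ j, ζ j • ((√ε)⁻¹ • u j)) := by
    intro ζ
    simp only [rescale, zero_add, Finset.smul_sum]
    congr 2
    exact Finset.sum_congr rfl fun j _ => smul_comm _ _ _
  simp only [h2]
  rw [integral_const_mul, integral_const_mul, ← mul_sub, abs_mul, abs_of_pos hε]
  refine (mul_le_mul_of_nonneg_left h1 hε.le).trans_eq ?_
  have h3 : ∑ j, ‖(√ε)⁻¹ • u j‖ ^ 4 = (∑ j, ‖u j‖ ^ 4) * (ε ^ 2)⁻¹ := by
    rw [Finset.sum_mul]
    refine Finset.sum_congr rfl fun j _ => ?_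
    rw [norm_smul, Real.norm_of_nonneg (by positivity), mul_pow, inv_pow,
      show √ε ^ 4 = (√ε ^ 2) ^ 2 by ring, Real.sq_sqrt hε.le, mul_comm]
  rw [h3, fourthMoments]
  field_simp

/-- The average over `s` of a homogeneous function of the components of a random phase vector is
close to its Gaussian expectation. The singularity of `f₀` at the origin is smoothed at the scale
`ε_s = (∑ⱼ ‖cⱼ v_{sj}‖⁴)^{1/2}`, for which the smoothing error `ε_s` and Lindeberg's error
`ε_s⁻¹ ∑ⱼ ‖cⱼ v_{sj}‖⁴` are of the same size. -/
lemma IsRegularization.integral_abs_sub_le (h : IsRegularization f₀ f₁ κ C) (hκ : 0 ≤ κ)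
    (c : Fin D → ℝ) (hc : ∑ j, c j ^ 2 = 1) (v : ι → Fin D → Ket n)
    (hv : ∀ a : Fin D → ℂ, ∑ s, ‖∑ l, a l • v s l‖ ^ 2 = ∑ l, ‖a l‖ ^ 2) :
    ∫ φ, |∑ s, f₀ (phaseSum c (v s) φ) -
        ∑ s, ∫ ζ, f₀ (∑ j, ζ j • (c j • v s j)) ∂(Measure.pi fun _ : Fin D => gaussC)|
        ∂phaseMeasure D ≤
      (2 * κ + √2 * (2 * Real.pi) ^ 2 * C + C * fourthMoments) *
        √(∑ s, (∑ j, c j ^ 4 * ‖v s j‖ ^ 4) / ∑ j, c j ^ 2 * ‖v s j‖ ^ 2) := by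
  set R : ι → ℝ := fun s => ∑ j, c j ^ 4 * ‖v s j‖ ^ 4 with hR
  set Δ := ∑ s, R s / ∑ j, c j ^ 2 * ‖v s j‖ ^ 2 with hΔ
  set f : ι → Ket n → ℝ := fun s => rescale f₁ (√(R s)) with hf
  have hR0 : ∀ s, 0 ≤ R s := fun s => by positivity
  have hsum : ∑ s, √(R s) ≤ √Δ := sum_sqrt_le c hc v hv
  -- If `R s = 0` all vectors vanish, and so do both functions.
  have hzero : ∀ s, R s = 0 → ∀ j, c j • v s j = 0 := by
    intro s hs j
    have h0 := (Finset.sum_eq_zero_iff_of_nonneg fun j _ => by positivity).mp hs j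
      (Finset.mem_univ j)
    rw [show c j ^ 4 * ‖v s j‖ ^ 4 = (c j * ‖v s j‖) ^ 4 by ring] at h0
    have h1 := pow_eq_zero_iff (four_ne_zero) |>.mp h0
    rw [← norm_eq_zero, norm_smul, Real.norm_eq_abs]
    rcases mul_eq_zero.mp h1 with h2 | h2 <;> simp [h2]
  have hfz : ∀ s, R s = 0 → ∀ x, f s x = 0 := by
    intro s hs x
    simp [hf, rescale, hs]
  have hclose : ∀ s (ζ : Fin D → ℂ),
      |f₀ (∑ j, ζ j • (c j • v s j)) - f s (∑ j, ζ j • (c j • v s j))| ≤ κ * √(R s) := by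
    intro s ζ
    rcases (hR0 s).eq_or_lt with hs | hs
    · have h1 : ∑ j, ζ j • (c j • v s j) = 0 :=
        Finset.sum_eq_zero fun j _ => by rw [hzero s hs.symm j, smul_zero]
      rw [h1, h.map_zero, hfz s hs.symm, ← hs]
      simp
    · exact h.close_rescale (Real.sqrt_pos.mpr hs) _
  have hps : ∀ s φ, phaseSum c (v s) φ =
      ∑ j, Complex.exp (Complex.I * φ j) • (c j • v s j) := by
    intro s φ
    refine Finset.sum_congr rfl fun j _ => ?_
    rw [← Complex.coe_smul, smul_smul, mul_comm]
  have hlind : ∀ s, |∫ φ, f s (phaseSum c (v s) φ) ∂phaseMeasure D -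
      ∫ ζ, f s (∑ j, ζ j • (c j • v s j)) ∂(Measure.pi fun _ : Fin D => gaussC)| ≤
      C * fourthMoments * √(R s) := by
    intro s
    rcases (hR0 s).eq_or_lt with hs | hs
    · simp only [hfz s hs.symm, ← hs]
      simp
    · rw [integral_phaseSum_eq (contDiff_rescale h.contDiff _).continuous]
      refine (h.lindeberg_rescale (Real.sqrt_pos.mpr hs) _).trans_eq ?_
      have h1 : ∑ j, ‖c j • v s j‖ ^ 4 = R s := by
        refine Finset.sum_congr rfl fun j _ => ?_
        rw [norm_smul, mul_pow, Real.norm_eq_abs, show |c j| ^ 4 = (|c j| ^ 2) ^ 2 by ring, sq_abs]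
        ring
      rw [h1]
      congr 1
      rw [div_eq_iff (Real.sqrt_pos.mpr hs).ne', Real.mul_self_sqrt hs.le]
  have hgauss : ∀ s, |∫ ζ, f s (∑ j, ζ j • (c j • v s j)) ∂(Measure.pi fun _ : Fin D => gaussC) -
      ∫ ζ, f₀ (∑ j, ζ j • (c j • v s j)) ∂(Measure.pi fun _ : Fin D => gaussC)| ≤
      κ * √(R s) := by
    intro s
    rw [← integral_sub (h.integrable_rescale _ isStdSymm_gaussC _)
      (h.integrable_homogeneous isStdSymm_gaussC _)]
    have := norm_integral_le_of_norm_le_const (μ := Measure.pi fun _ : Fin D => gaussC)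
      (ae_of_all _ fun ζ : Fin D → ℂ => (Real.norm_eq_abs _).trans_le
        ((abs_sub_comm _ _).trans_le (hclose s ζ)))
    simpa using this
  set F : (Fin D → ℝ) → ℝ := fun φ => ∑ s, f s (phaseSum c (v s) φ) with hF
  have hfc : ∀ s, Continuous (f s) := fun s => (contDiff_rescale h.contDiff _).continuous
  have hfsc : ∀ s, Continuous fun φ => f s (phaseSum c (v s) φ) := fun s =>
    (hfc s).comp (continuous_phaseSum _ _)
  have hFc : Continuous F := continuous_finsetSum _ fun s _ => hfsc s
  set m := ∫ φ, F φ ∂phaseMeasure D with hm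
  have hmsum : m = ∑ s, ∫ φ, f s (phaseSum c (v s) φ) ∂phaseMeasure D :=
    integral_finsetSum _ fun s _ => (hfsc s).integrable_phaseMeasure
  have hvar : ∫ φ, |F φ - m| ∂phaseMeasure D ≤ √2 * (2 * Real.pi) ^ 2 * C * √Δ := by
    have h1 := variance_sum_le v c hv (f := f) (fun s => contDiff_rescale h.contDiff _)
      (fun s x => by simp only [hf, rescale, smul_neg, h.even])
      (fun s x => norm_fderiv_fderiv_rescale_le h.contDiff h.second (Real.sqrt_nonneg _) x)
    have h2 := integral_sub_mean_sq (phaseMeasure D) hFc.integrable_phaseMeasure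
      (continuous_sq_comp hFc).integrable_phaseMeasure m
    have hac : Continuous fun φ => |F φ - m| := (hFc.sub continuous_const).abs
    have h3 := sq_integral_le (phaseMeasure D) hac.integrable_phaseMeasure
      (continuous_sq_comp hac).integrable_phaseMeasure
    simp only [sq_abs] at h3
    have h4 := sum_pow_four_le c hc v hv
    have hΔ0 : 0 ≤ Δ := (Finset.sum_nonneg fun j _ => by positivity).trans h4
    have hC := h.nonneg
    refine abs_le_of_sq_le_sq' ?_ (by positivity) |>.2
    have h5 : (√2 * (2 * Real.pi) ^ 2 * C * √Δ) ^ 2 = 2 * (2 * Real.pi) ^ 4 * C ^ 2 * Δ := by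
      rw [mul_pow, mul_pow, mul_pow, Real.sq_sqrt (by norm_num), Real.sq_sqrt hΔ0]
      ring
    rw [h5]
    refine h3.trans ?_
    have h6 := mul_le_mul_of_nonneg_left h4
      (by positivity : 0 ≤ 2 * (2 * Real.pi) ^ 4 * C ^ 2)
    have h7 : ∫ φ, F φ ∂phaseMeasure D = m := rfl
    have h8 : m * m = m ^ 2 := by ring
    rw [h2]
    nlinarith
  -- Collect the four errors.
  set G : ι → ℝ := fun s => ∫ ζ, f₀ (∑ j, ζ j • (c j • v s j))
    ∂(Measure.pi fun _ : Fin D => gaussC) with hG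
  have hmG : |m - ∑ s, G s| ≤ (C * fourthMoments + κ) * √Δ := by
    rw [hmsum, ← Finset.sum_sub_distrib]
    refine (Finset.abs_sum_le_sum_abs _ _).trans ?_
    refine (Finset.sum_le_sum fun s _ => (abs_sub_le _ _ _).trans
      (add_le_add (hlind s) (hgauss s))).trans ?_
    simp only [← add_mul, ← Finset.mul_sum]
    exact mul_le_mul_of_nonneg_left hsum
      (add_nonneg (mul_nonneg h.nonneg fourthMoments_nonneg) hκ)
  have hpt : ∀ φ, |∑ s, f₀ (phaseSum c (v s) φ) - ∑ s, G s| ≤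
      κ * √Δ + |F φ - m| + (C * fourthMoments + κ) * √Δ := by
    intro φ
    have h1 : |∑ s, f₀ (phaseSum c (v s) φ) - F φ| ≤ κ * √Δ := by
      rw [hF, ← Finset.sum_sub_distrib]
      refine (Finset.abs_sum_le_sum_abs _ _).trans ?_
      refine le_trans ?_ (mul_le_mul_of_nonneg_left hsum hκ)
      rw [Finset.mul_sum]
      refine Finset.sum_le_sum fun s _ => ?_
      rw [hps]
      exact hclose s _
    calc _ ≤ |∑ s, f₀ (phaseSum c (v s) φ) - F φ| + |F φ - ∑ s, G s| := abs_sub_le _ _ _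
      _ ≤ |∑ s, f₀ (phaseSum c (v s) φ) - F φ| + (|F φ - m| + |m - ∑ s, G s|) := by
          gcongr
          exact abs_sub_le _ _ _
      _ ≤ _ := by linarith
  have hac : Continuous fun φ => |F φ - m| := (hFc.sub continuous_const).abs
  have hint : Integrable (fun φ => κ * √Δ + |F φ - m| + (C * fourthMoments + κ) * √Δ)
      (phaseMeasure D) := by
    refine Continuous.integrable_phaseMeasure ?_
    fun_prop
  refine (integral_mono_of_nonneg (ae_of_all _ fun φ => abs_nonneg _) hint
    (ae_of_all _ hpt)).trans ?_
  have e1 : Integrable (fun φ => κ * √Δ + |F φ - m|) (phaseMeasure D) := by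
    refine Continuous.integrable_phaseMeasure ?_
    fun_prop
  rw [integral_add e1 (integrable_const _),
    integral_add (integrable_const _) hac.integrable_phaseMeasure]
  simp only [integral_const, probReal_univ, one_smul]
  linarith

end Comparison

/-! ### The comparison for the entries of the moments -/

section Entries

variable {n : Type} [Fintype n]

/-- The real and imaginary parts of `regEntry` regularize those of `homEntry`. -/
lemma isRegularization_homEntry {k : ℕ} (hk : 1 ≤ k) (i j : Fin k → n) (L : ℂ →L[ℝ] ℝ)
    (hL : ∀ w, |L w| ≤ ‖w‖) :
    ∃ C, IsRegularization (fun x => L (homEntry k i j x)) (fun x => L (regEntry k i j x)) k C := by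
  have hs := (isSymbol_regEntry hk i j).clm_comp L
  obtain ⟨C, hC0, h1, h2, h3⟩ := hs.second_order
  refine ⟨C, L.continuous.measurable.comp (measurable_homEntry k i j),
    fun x => (hL _).trans (norm_homEntry_le hk i j x), fun r x hr => ?_, fun x => ?_, hs.1,
    fun x => by rw [regEntry_neg], hC0, h1, h2, h3⟩
  · rw [homEntry_smul i j hr, ← Complex.real_smul, map_smul, smul_eq_mul]
  · rw [← map_sub]
    exact (hL _).trans (norm_homEntry_sub_regEntry_le hk i j x)

/-- The comparison for one entry of the `k`-th moment. The constant depends on `k` and the dimension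
of the components, but not on the number of components or of phases. -/
lemma exists_integral_norm_sub_le {k : ℕ} (hk : 1 ≤ k) (i j : Fin k → n) :
    ∃ K, 0 ≤ K ∧ ∀ {ι : Type} [Fintype ι] {D : ℕ} (c : Fin D → ℝ), ∑ j, c j ^ 2 = 1 →
      ∀ v : ι → Fin D → Ket n,
      (∀ a : Fin D → ℂ, ∑ s, ‖∑ l, a l • v s l‖ ^ 2 = ∑ l, ‖a l‖ ^ 2) →
      ∫ φ, ‖∑ s, homEntry k i j (phaseSum c (v s) φ) - ∑ s, ∫ ζ,
          homEntry k i j (∑ j, ζ j • (c j • v s j)) ∂(Measure.pi fun _ : Fin D => gaussC)‖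
          ∂phaseMeasure D ≤
        K * √(∑ s, (∑ j, c j ^ 4 * ‖v s j‖ ^ 4) / ∑ j, c j ^ 2 * ‖v s j‖ ^ 2) := by
  obtain ⟨C₁, h₁⟩ := isRegularization_homEntry hk i j Complex.reCLM Complex.abs_re_le_norm
  obtain ⟨C₂, h₂⟩ := isRegularization_homEntry hk i j Complex.imCLM Complex.abs_im_le_norm
  have hC₁ := h₁.nonneg
  have hC₂ := h₂.nonneg
  have hF := fourthMoments_nonneg
  refine ⟨(2 * k + √2 * (2 * Real.pi) ^ 2 * C₁ + C₁ * fourthMoments) +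
    (2 * k + √2 * (2 * Real.pi) ^ 2 * C₂ + C₂ * fourthMoments), by positivity,
    fun {ι} _ {D} c hc v hv => ?_⟩
  have hi : ∀ s, Integrable (fun ζ : Fin D → ℂ => homEntry k i j (∑ j, ζ j • (c j • v s j)))
      (Measure.pi fun _ : Fin D => gaussC) := fun s => by
    have a1 := h₁.integrable_homogeneous isStdSymm_gaussC fun j => c j • v s j
    have a2 := h₂.integrable_homogeneous isStdSymm_gaussC fun j => c j • v s j
    refine (a1.ofReal.add (a2.ofReal.mul_const Complex.I)).congr (ae_of_all _ fun ζ => ?_)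
    exact Complex.re_add_im _
  have b₁ := h₁.integral_abs_sub_le (Nat.cast_nonneg k) c hc v hv
  have b₂ := h₂.integral_abs_sub_le (Nat.cast_nonneg k) c hc v hv
  simp only [ContinuousLinearMap.integral_comp_comm _ (hi _), ← map_sum, ← map_sub] at b₁ b₂
  set X : (Fin D → ℝ) → ℂ := fun φ => ∑ s, homEntry k i j (phaseSum c (v s) φ) - ∑ s, ∫ ζ,
    homEntry k i j (∑ j, ζ j • (c j • v s j)) ∂(Measure.pi fun _ : Fin D => gaussC) with hX
  have hXi : Integrable X (phaseMeasure D) := by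
    refine (integrable_finsetSum _ fun s _ => ?_).sub (integrable_const _)
    have hcs := continuous_phaseSum c (v s)
    refine Integrable.mono' (g := fun φ => ‖phaseSum c (v s) φ‖ ^ 2)
      (hcs.norm.pow 2).integrable_phaseMeasure
      ((measurable_homEntry k i j).comp hcs.measurable).aestronglyMeasurable
      (ae_of_all _ fun φ => norm_homEntry_le hk i j _)
  have e₁ : Integrable (fun φ => |Complex.reCLM (X φ)|) (phaseMeasure D) :=
    (Complex.reCLM.integrable_comp hXi).abs
  have e₂ : Integrable (fun φ => |Complex.imCLM (X φ)|) (phaseMeasure D) :=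
    (Complex.imCLM.integrable_comp hXi).abs
  refine (integral_mono hXi.norm (e₁.add e₂) fun φ => Complex.norm_le_abs_re_add_abs_im _).trans ?_
  simp only [Pi.add_apply]
  rw [integral_add e₁ e₂, add_mul]
  exact add_le_add b₁ b₂

end Entries

/-! ### The comparison in trace norm -/

section Assembly

variable {dA : ℕ} {b ι : Type} [Fintype b] [Fintype ι] {D : ℕ}

lemma projectedMoment_apply (k : ℕ) (z : ι → Ket b) (Ψ : Ket (Fin dA × b)) (i j : Fin k → Fin dA) :
    projectedMoment k z Ψ i j = ∑ s, homEntry k i j (projKet Ψ (z s)) := by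
  simp only [projectedMoment, Matrix.sum_apply, Matrix.smul_apply, smul_eq_mul, homEntry]

variable (E : OrthonormalBasis (Fin D) ℂ (Ket (Fin dA × b))) (Ψ₀ : Ket (Fin dA × b))

/-- The weighted Scrooge moment is a Gaussian expectation; the factor `⟨z|σ_B|z⟩` restores the
normalization of the Gaussian vector, by homogeneity. -/
lemma weightB_mul_scroogeMoment [NeZero dA] {k : ℕ} (hk : 1 ≤ k) (i j : Fin k → Fin dA)
    (z : Ket b) :
    (weightB (sigmaDiag E Ψ₀) z : ℂ) * scroogeMoment k (condAHat (sigmaDiag E Ψ₀) z) i j =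
      ∫ ζ, homEntry k i j (∑ l, ζ l • (‖inner ℂ (E l) Ψ₀‖ • projKet (E l) z))
        ∂(Measure.pi fun _ : Fin D => gaussC) := by
  set w := weightB (sigmaDiag E Ψ₀) z with hw
  rcases (weightB_nonneg E Ψ₀ z).eq_or_lt with h | h
  · have h0 : ∀ l, ‖inner ℂ (E l) Ψ₀‖ • projKet (E l) z = 0 := by
      intro l
      rw [weightB_sigmaDiag] at h
      have h1 := (Finset.sum_eq_zero_iff_of_nonneg fun j _ => by positivity).mp h.symm l
        (Finset.mem_univ l)
      rw [← mul_pow] at h1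
      rw [← norm_eq_zero, norm_smul, norm_norm]
      exact pow_eq_zero_iff two_ne_zero |>.mp h1
    have h2 : homEntry k i j 0 = 0 := by
      have := norm_homEntry_le hk i j 0
      simpa using this
    rw [hw, ← h]
    simp [h0, h2]
  · have hr : 0 < (√w)⁻¹ := by positivity
    have hu : ∀ t, (sandwich (condAHat (sigmaDiag E Ψ₀) z) t).re =
        ∑ l, ‖inner ℂ ((√w)⁻¹ • (‖inner ℂ (E l) Ψ₀‖ • projKet (E l) z)) t‖ ^ 2 := by
      intro t
      rw [sandwich_condAHat, Finset.mul_sum]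
      refine Finset.sum_congr rfl fun l _ => ?_
      rw [← Complex.coe_smul, ← Complex.coe_smul, inner_smul_left, inner_smul_left,
        Complex.conj_ofReal, Complex.conj_ofReal, norm_mul, norm_mul, Complex.norm_real,
        Complex.norm_real, norm_norm, Real.norm_of_nonneg hr.le, mul_pow, mul_pow, inv_pow,
        Real.sq_sqrt h.le]
    rw [scroogeMoment_eq (condAHat_posSemidef E Ψ₀ z) hu k i j, ← integral_const_mul]
    refine integral_congr_ae (ae_of_all _ fun ζ => ?_)
    have h1 : ∑ l, ζ l • ((√w)⁻¹ • (‖inner ℂ (E l) Ψ₀‖ • projKet (E l) z)) =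
        (√w)⁻¹ • ∑ l, ζ l • (‖inner ℂ (E l) Ψ₀‖ • projKet (E l) z) := by
      rw [Finset.smul_sum]
      exact Finset.sum_congr rfl fun l _ => smul_comm _ _ _
    have hw0 : (w : ℂ) ≠ 0 := by exact_mod_cast h.ne'
    simp only [h1]
    rw [homEntry_smul i j hr, inv_pow, Real.sq_sqrt h.le, Complex.ofReal_inv,
      mul_inv_cancel_left₀ hw0]

lemma scroogeMixture_apply [NeZero dA] {k : ℕ} (hk : 1 ≤ k) (z : ι → Ket b)
    (i j : Fin k → Fin dA) :
    scroogeMixture k (sigmaDiag E Ψ₀) z i j =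
      ∑ s, ∫ ζ, homEntry k i j (∑ l, ζ l • (‖inner ℂ (E l) Ψ₀‖ • projKet (E l) (z s)))
        ∂(Measure.pi fun _ : Fin D => gaussC) := by
  simp only [scroogeMixture, Matrix.sum_apply, Matrix.smul_apply, smul_eq_mul,
    weightB_mul_scroogeMoment E Ψ₀ hk]

lemma continuous_phaseState : Continuous (phaseState E Ψ₀) := by
  unfold phaseState
  fun_prop

lemma measurable_projectedMoment_apply (k : ℕ) (z : ι → Ket b) (i j : Fin k → Fin dA) :
    Measurable fun Ψ : Ket (Fin dA × b) => projectedMoment k z Ψ i j := by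
  simp only [projectedMoment_apply]
  refine Finset.measurable_sum _ fun s _ => (measurable_homEntry k i j).comp ?_
  have : Continuous fun Ψ : Ket (Fin dA × b) => projKet Ψ (z s) := by
    unfold projKet
    fun_prop
  exact this.measurable

lemma measurable_traceNorm_sub (k : ℕ) (z : ι → Ket b)
    (M : Matrix (Fin k → Fin dA) (Fin k → Fin dA) ℂ) :
    Measurable fun Ψ : Ket (Fin dA × b) => traceNorm (projectedMoment k z Ψ - M) := by
  have h : Measurable fun Ψ : Ket (Fin dA × b) =>
      (fun i j => projectedMoment k z Ψ i j - M i j :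
        (Fin k → Fin dA) → (Fin k → Fin dA) → ℂ) :=
    measurable_pi_iff.mpr fun i => measurable_pi_iff.mpr fun j =>
      (measurable_projectedMoment_apply k z i j).sub_const _
  have hc : Continuous fun N : (Fin k → Fin dA) → (Fin k → Fin dA) → ℂ =>
    traceNorm (Matrix.of N) := continuous_traceNorm
  exact hc.measurable.comp h

/-- The estimate for one fixed `k`, with a constant that may depend on `k`. -/
lemma exists_integral_traceNorm_le (dA : ℕ) [NeZero dA] {k : ℕ} (hk : 1 ≤ k) :
    ∃ K, 0 ≤ K ∧ ∀ {b ι : Type} [Fintype b] [Fintype ι] {D : ℕ}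
      (E : OrthonormalBasis (Fin D) ℂ (Ket (Fin dA × b))) (Ψ₀ : Ket (Fin dA × b)), ‖Ψ₀‖ = 1 →
      ∀ z : OrthonormalBasis ι ℂ (Ket b),
        Integrable
          (fun Ψ => traceNorm (projectedMoment k z Ψ - scroogeMixture k (sigmaDiag E Ψ₀) z))
          (randomPhaseEnsemble E Ψ₀) ∧
        ∫ Ψ, traceNorm (projectedMoment k z Ψ - scroogeMixture k (sigmaDiag E Ψ₀) z)
            ∂(randomPhaseEnsemble E Ψ₀) ≤ K * √(deltaBeta E Ψ₀ z) := by
  choose K hK0 hK using fun i j : Fin k → Fin dA => exists_integral_norm_sub_le hk i j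
  set r := √(Fintype.card (Fin k → Fin dA)) with hr
  have hr0 : 0 ≤ r := Real.sqrt_nonneg _
  refine ⟨r * ∑ i, ∑ j, K i j, mul_nonneg hr0
    (Finset.sum_nonneg fun i _ => Finset.sum_nonneg fun j _ => hK0 i j),
    fun {b ι} _ _ {D} E Ψ₀ hΨ z => ?_⟩
  set S := scroogeMixture k (sigmaDiag E Ψ₀) z with hS
  have hc := continuous_phaseState E Ψ₀
  have hm := measurable_traceNorm_sub k z S
  -- Each entry of the projected moment is integrable, as it is bounded by `‖Ψ‖²`.
  have hent : ∀ i j, Integrable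
      (fun φ => projectedMoment k z (phaseState E Ψ₀ φ) i j - S i j) (phaseMeasure D) := by
    intro i j
    refine Integrable.sub ?_ (integrable_const _)
    refine Integrable.mono' (g := fun φ => ‖phaseState E Ψ₀ φ‖ ^ 2)
      (hc.norm.pow 2).integrable_phaseMeasure
      ((measurable_projectedMoment_apply k z i j).comp hc.measurable).aestronglyMeasurable
      (ae_of_all _ fun φ => ?_)
    rw [projectedMoment_apply, ← sum_norm_projKet_sq z]
    exact (norm_sum_le _ _).trans (Finset.sum_le_sum fun s _ => norm_homEntry_le hk i j _)
  have hbound : Integrable (fun φ => r * ∑ i, ∑ j,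
      ‖projectedMoment k z (phaseState E Ψ₀ φ) i j - S i j‖) (phaseMeasure D) :=
    (integrable_finsetSum _ fun i _ => integrable_finsetSum _ fun j _ =>
      (hent i j).norm).const_mul r
  have hle : ∀ φ, traceNorm (projectedMoment k z (phaseState E Ψ₀ φ) - S) ≤
      r * ∑ i, ∑ j, ‖projectedMoment k z (phaseState E Ψ₀ φ) i j - S i j‖ :=
    fun φ => traceNorm_le _
  have hint : Integrable (fun φ => traceNorm (projectedMoment k z (phaseState E Ψ₀ φ) - S))
      (phaseMeasure D) :=
    Integrable.mono' hbound (hm.comp hc.measurable).aestronglyMeasurable (ae_of_all _ fun φ => by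
      rw [Real.norm_of_nonneg (traceNorm_nonneg _)]
      exact hle φ)
  refine ⟨(integrable_map_measure hm.aestronglyMeasurable hc.aemeasurable).mpr hint, ?_⟩
  rw [randomPhaseEnsemble, integral_map hc.aemeasurable hm.aestronglyMeasurable]
  refine (integral_mono hint hbound hle).trans ?_
  rw [integral_const_mul, integral_finsetSum _ fun i _ => integrable_finsetSum _ fun j _ =>
    (hent i j).norm, mul_assoc, Finset.sum_mul]
  refine mul_le_mul_of_nonneg_left (Finset.sum_le_sum fun i _ => ?_) hr0
  rw [integral_finsetSum _ fun j _ => (hent i j).norm, Finset.sum_mul]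
  refine Finset.sum_le_sum fun j _ => ?_
  have hsq : ∑ l, ‖inner ℂ (E l) Ψ₀‖ ^ 2 = 1 := by
    rw [E.sum_sq_norm_inner_right, hΨ, one_pow]
  have := hK i j (fun l => ‖inner ℂ (E l) Ψ₀‖) hsq (fun s l => projKet (E l) (z s))
    (sum_norm_sum_smul_projKet_sq E z)
  simp only [← projKet_phaseState] at this
  simp only [projectedMoment_apply, hS, scroogeMixture_apply E Ψ₀ hk, deltaBeta_eq]
  exact this

/-- The weights sum to one, so one of them is positive. A state on `ℂᵈ` has Hilbert–Schmidt norm at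
least `d^{-1/2}`, so that the hypothesis bounds `k` in terms of the dimension. -/
lemma le_of_sq_mul_hsNorm_le {k : ℕ} (hΨ : ‖Ψ₀‖ = 1) (z : OrthonormalBasis ι ℂ (Ket b))
    (h : ∀ s, 0 < weightB (sigmaDiag E Ψ₀) (z s) →
      (k : ℝ) ^ 2 * hsNorm (condAHat (sigmaDiag E Ψ₀) (z s)) ≤ 1) : k ≤ dA := by
  have hsq : ∑ l, ‖inner ℂ (E l) Ψ₀‖ ^ 2 = 1 := by
    rw [E.sum_sq_norm_inner_right, hΨ, one_pow]
  have h1 := sum_weight_eq_one _ hsq (fun s l => projKet (E l) (z s))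
    (sum_norm_sum_smul_projKet_sq E z)
  simp only [← weightB_sigmaDiag] at h1
  obtain ⟨s, hs⟩ : ∃ s, 0 < weightB (sigmaDiag E Ψ₀) (z s) := by
    by_contra! h2
    have := Finset.sum_nonpos fun s (_ : s ∈ Finset.univ) => h2 s
    linarith
  have h2 := h s hs
  have h3 := one_le_card_mul_hsNorm_sq E Ψ₀ hs
  rw [Fintype.card_fin] at h3
  set y := hsNorm (condAHat (sigmaDiag E Ψ₀) (z s)) with hy
  have hy0 : 0 ≤ y := Real.sqrt_nonneg _
  have h4 : ((k : ℝ) ^ 2 * y) ^ 2 ≤ 1 := pow_le_one₀ (by positivity) h2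
  have h5 : ((k ^ 4 : ℕ) : ℝ) ≤ dA := by
    push_cast
    calc (k : ℝ) ^ 4 ≤ (k : ℝ) ^ 4 * (dA * y ^ 2) := le_mul_of_one_le_right (by positivity) h3
      _ = dA * ((k : ℝ) ^ 2 * y) ^ 2 := by ring
      _ ≤ dA := mul_le_of_le_one_right (by positivity) h4
  exact (Nat.le_self_pow four_ne_zero k).trans (by exact_mod_cast h5)

end Assembly

end

theorem proposition1 :
    ∃ c : ℝ, 0 < c ∧ ∃ C : ℝ, 0 < C ∧ ∀ dA : ℕ, ∃ C' : ℝ, 0 < C' ∧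
      ∀ (dB k : ℕ), 1 ≤ k →
      ∀ (E : OrthonormalBasis (Fin (dA * dB)) ℂ (Ket (Fin dA × Fin dB)))
        (Ψ₀ : Ket (Fin dA × Fin dB)), ‖Ψ₀‖ = 1 →
      ∀ z : OrthonormalBasis (Fin dB) ℂ (Ket (Fin dB)),
        (∀ s, 0 < weightB (sigmaDiag E Ψ₀) (z s) →
          (k : ℝ) ^ 2 * hsNorm (condAHat (sigmaDiag E Ψ₀) (z s)) ≤ c) →
        Integrable
          (fun Ψ => traceNorm (projectedMoment k z Ψ - scroogeMixture k (sigmaDiag E Ψ₀) z))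
          (randomPhaseEnsemble E Ψ₀) ∧
        ∫ Ψ, traceNorm (projectedMoment k z Ψ - scroogeMixture k (sigmaDiag E Ψ₀) z)
            ∂(randomPhaseEnsemble E Ψ₀)
          ≤ (∑ s, weightB (sigmaDiag E Ψ₀) (z s) *
                (C * (k * hsNorm (condAHat (sigmaDiag E Ψ₀) (z s)))))
            + C' * √(deltaBeta E Ψ₀ z) := by
  refine ⟨1, one_pos, 1, one_pos, fun dA => ?_⟩
  rcases Nat.eq_zero_or_pos dA with rfl | hdA
  · -- There are no unit vectors in dimension zero.
    refine ⟨1, one_pos, fun dB k _ E Ψ₀ hΨ => ?_⟩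
    rw [Subsingleton.elim Ψ₀ 0, norm_zero] at hΨ
    exact absurd hΨ zero_ne_one
  have : NeZero dA := ⟨hdA.ne'⟩
  -- Only the values `k ≤ dA` are compatible with the hypothesis, so the constant is a finite sum.
  choose K hK0 hK using fun k : ℕ => exists_integral_traceNorm_le dA (Nat.le_add_left 1 k)
  have hsum : 0 ≤ ∑ m ∈ Finset.range dA, K m := Finset.sum_nonneg fun m _ => hK0 m
  refine ⟨1 + ∑ m ∈ Finset.range dA, K m, by linarith, fun dB k hk E Ψ₀ hΨ z hc => ?_⟩
  obtain ⟨m, rfl⟩ : ∃ m, k = m + 1 := ⟨k - 1, by omega⟩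
  have hkd := le_of_sq_mul_hsNorm_le E Ψ₀ hΨ z hc
  obtain ⟨h1, h2⟩ := hK m E Ψ₀ hΨ z
  refine ⟨h1, h2.trans ?_⟩
  have h3 : K m ≤ ∑ m ∈ Finset.range dA, K m :=
    Finset.single_le_sum (fun m _ => hK0 m) (Finset.mem_range.mpr hkd)
  have h4 : 0 ≤ ∑ s, weightB (sigmaDiag E Ψ₀) (z s) *
      (1 * (((m + 1 : ℕ) : ℝ) * hsNorm (condAHat (sigmaDiag E Ψ₀) (z s)))) :=
    Finset.sum_nonneg fun s _ => mul_nonneg (weightB_nonneg _ _ _)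
      (mul_nonneg zero_le_one (mul_nonneg (Nat.cast_nonneg _) (Real.sqrt_nonneg _)))
  have h5 := mul_le_mul_of_nonneg_right (show K m ≤ 1 + ∑ m ∈ Finset.range dA, K m by linarith)
    (Real.sqrt_nonneg (deltaBeta E Ψ₀ z))
  linarith
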